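/- **Corollary 4.3** (family $xu_{xx}+f u_x$, Riccati $xf'-f+\tfrac12 f^2=\tfrac23Ax^{3/2}+Cx-\tfrac38$). Let $A,C\in\mathbb R$, let $f:(0,\infty)\to\mathbb R$ be differentiable with $$xf'(x)-f(x)+\tfrac12 f(x)^2=\tfrac23Ax^{3/2}+Cx-\tfrac38\qquad(x>0),$$ and let $F'(x)=f(x)/x$ on $(0,\infty)$. For $x,t>0$ and $\lambda\ge 0$ with $\sqrt x(1+\lambda t)>A\lambda t^3/12$ put $$U_\lambda(x,t)=\sqrt{\frac{\sqrt x(1+\lambda t)}{\sqrt x(1+\lambda t)-A\lambda\frac{t^3}{12}}}\;e^{S(\lambda,x,t)}\exp\Big[-\tfrac12\Big(F(x)-F\Big(\tfrac{(12(1+\lambda t)\sqrt x-A\lambda t^3)^2}{144(1+\lambda t)^4}\Big)\Big)\Big],$$ $$S(\lambda,x,t)=-\frac{\lambda(x+Ct^2/2)}{1+\lambda t}-\frac{A\lambda t^2\sqrt x(3+\lambda t)}{6(1+\lambda t)^2}+\frac{A^2\lambda t^4(2\lambda t(3+\lambda t/2)-3)}{432(1+\lambda t)^3}.$$ Then there is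 a kernel $p(x,y,t)$, $x,y,t>0$, such that for all $x,t>0$ the function $p(x,\cdot,t)$ is the inverse Laplace transform in $\lambda$ of $U_\lambda(x,t)$: $\lambda\mapsto U_\lambda(x,t)$ continues analytically to $\operatorname{Re}\lambda>0$, and $$p(x,y,t)=\lim_{R\to\infty}\frac1{2\pi i}\int_{c-iR}^{c+iR}e^{\lambda y}U_\lambda(x,t)\,d\lambda\qquad\text{for all } c>0,\ y>0;$$ moreover $e^{-\lambda y}p(x,y,t)$ is integrable in $y$ over $(0,\infty)$ for all $\lambda\ge0$, and $\int_0^\infty e^{-\lambda y}p(x,y,t)\,dy=U_\lambda(x,t)$ for all $\lambda\geq 0$ with $\sqrt x(1+\lambda t)>A\lambda t^3/12$. Let further $\varphi\in C^2((0,\infty))$ be such that $e^{-\varepsilon y}y^{-1/2}\varphi(y)$ is integrable on $(0,\infty)$ for every $\varepsilon>0$. Then the integral $$u(x,t)=\int_0^\infty p(x,y,t)\varphi(y)\,dy$$ converges absolutely for all $x,t>0$, and the following hold. 1. $u$ solves $u_t=xu_{xx}+f(x)u_x$ for $x,t>0$, with $\lim_{t\to0^+}u(x,t)=\varphi(x)$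 for all $x>0$. 2. Let $0<\beta<1$, let $g_\beta(s;t)=t^{-\beta}\sum_{k\ge0}\frac{(-st^{-\beta})^k}{k!\,\Gamma(1-\beta-\beta k)}$ (where $1/\Gamma$ is $0$ at the poles of $\Gamma$), and suppose that the integral $$u_\beta(x,t)=\int_0^\infty u(x,s)\,g_\beta(s;t)\,ds$$ converges absolutely for every $t>0$, locally uniformly in $x>0$, in the sense that for all $0<a\le b$ and $t>0$ there is $M$ with $|u(x,s)|\le M(s)$ for $x\in[a,b]$, $s>0$, and $M\,g_\beta(\cdot;t)$ integrable on $(0,\infty)$. Then $u_\beta$ solves ${}_CD_t^\beta u_\beta=x\,\partial_x^2u_\beta+f(x)\,\partial_xu_\beta$ for $x,t>0$, with $\lim_{t\to0^+}u_\beta(x,t)=\varphi(x)$ for all $x>0$, where ${}_CD_t^\beta h(t)=\frac1{\Gamma(1-\beta)}\int_0^t(t-\tau)^{-\beta}h'(\tau)\,d\tau$ is the Caputo derivative (the integrals for $u_\beta$ existing absolutely). 3. If $0<\beta<1$, if $|\varphi(y)|\le Me^{k\sqrt y}$ on $(0,\infty)$ for some constants $M,k$, and if $A=0$ or $\beta>\frac23$,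 then the convergence assumed in 2 holds. The solutions in 1 and 2 are $C^2$ in $x>0$ and $C^1$ in $t>0$. Item 1 is the case $\beta=1$ of the equation ($g_1(s;t)=\delta(s-t)$, $u_1=u$). -/

import Mathlib

namespace FracPDE

open Set Filter Topology MeasureTheory

noncomputable section

/-- The real Wright function `W_{a,b}(z) = ∑ z^k / (k! Γ(a k + b))`, where `1 / Γ` vanishes at the
poles of `Γ` (this is the value of `(Real.Gamma _)⁻¹` there). -/
def wrightW (a b z : ℝ) : ℝ :=
  ∑' k : ℕ, z ^ k * (k.factorial : ℝ)⁻¹ * (Real.Gamma (a * k + b))⁻¹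

/-- The density `g_β(s; t) = t^{-β} W_{-β, 1-β}(-s t^{-β})`, used for `0 < β < 1`. -/
def wrightDensity (β s t : ℝ) : ℝ :=
  t ^ (-β) * wrightW (-β) (1 - β) (-(s * t ^ (-β)))

/-- The Wright-type transform in time, `u_β(x,t) = ∫₀^∞ u(x,s) g_β(s;t) ds`. -/
def wrightTransform (β : ℝ) (u : ℝ → ℝ → ℝ) (x t : ℝ) : ℝ :=
  ∫ s in Ioi (0 : ℝ), u x s * wrightDensity β s t

/-- The integral defining the Wright-type transform of `u` converges absolutely for every `t > 0`,
locally uniformly in `x > 0`. -/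
def WrightConvergent (β : ℝ) (u : ℝ → ℝ → ℝ) : Prop :=
  ∀ a b t : ℝ, 0 < a → a ≤ b → 0 < t → ∃ M : ℝ → ℝ,
    IntegrableOn (fun s => M s * wrightDensity β s t) (Ioi 0) ∧
    ∀ x ∈ Icc a b, ∀ s : ℝ, 0 < s → |u x s| ≤ M s

/-- The Caputo derivative of order `0 < β ≤ 1`: `J^{1-β} h'`, where `J^0` is the identity. -/
def caputo (β : ℝ) (h : ℝ → ℝ) (t : ℝ) : ℝ :=
  if β = 1 then deriv h t
  else (Real.Gamma (1 - β))⁻¹ * ∫ τ in Ioo (0 : ℝ) t, (t - τ) ^ (-β) * deriv h τ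

/-- `v` is a solution of `D_t^β v = x v_xx + f(x) v_x` on `x > 0`, `t > 0` with initial value `φ`. -/
structure IsSolution (β : ℝ) (f φ : ℝ → ℝ) (v : ℝ → ℝ → ℝ) : Prop where
  /-- twice continuously differentiable in space -/
  smooth_space : ∀ t : ℝ, 0 < t → ContDiffOn ℝ 2 (fun x => v x t) (Ioi 0)
  /-- continuously differentiable in time -/
  smooth_time : ∀ x : ℝ, 0 < x → ContDiffOn ℝ 1 (fun t => v x t) (Ioi 0)
  /-- the integral in the Caputo derivative exists -/
  caputo_exists : β < 1 → ∀ x t : ℝ, 0 < x → 0 < t →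
    IntegrableOn (fun τ => (t - τ) ^ (-β) * deriv (fun r => v x r) τ) (Ioo 0 t)
  /-- the equation -/
  equation : ∀ x t : ℝ, 0 < x → 0 < t →
    caputo β (fun r => v x r) t =
      x * deriv (deriv fun ξ => v ξ t) x + f x * deriv (fun ξ => v ξ t) x
  /-- the initial condition -/
  initial : ∀ x : ℝ, 0 < x → Tendsto (fun t => v x t) (𝓝[>] 0) (𝓝 (φ x))

/-- The exponent `S(λ, x, t)`, with `l` for `λ`. -/
def exponentS (A C l x t : ℝ) : ℝ :=
  -(l * (x + C * t ^ 2 / 2) / (1 + l * t))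
    - A * l * t ^ 2 * √x * (3 + l * t) / (6 * (1 + l * t) ^ 2)
    + A ^ 2 * l * t ^ 4 * (2 * l * t * (3 + l * t / 2) - 3) / (432 * (1 + l * t) ^ 3)

/-- The function `U_λ(x, t)`, with `l` for `λ`. -/
def laplaceU (A C : ℝ) (F : ℝ → ℝ) (l x t : ℝ) : ℝ :=
  √((√x * (1 + l * t)) / (√x * (1 + l * t) - A * l * t ^ 3 / 12))
    * Real.exp (exponentS A C l x t)
    * Real.exp (-(1 / 2) * (F x
        - F ((12 * (1 + l * t) * √x - A * l * t ^ 3) ^ 2 / (144 * (1 + l * t) ^ 4))))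

/-- The `λ ≥ 0` at which the radicand in `U_λ(x, t)` is meaningful (positive). For `x, t > 0` this
set contains a neighbourhood of `0` in `[0, ∞)`, and it is all of `[0, ∞)` if `A t ^ 2 ≤ 12 √x`. -/
def admissible (A x t : ℝ) : Set ℝ :=
  {l : ℝ | 0 ≤ l ∧ 0 < √x * (1 + l * t) - A * l * t ^ 3 / 12}

/-- `q` is on `(0, ∞)` the inverse Laplace transform of (the analytic continuation to the right
half-plane of) the function `G`, given on the set `S` of real numbers: for every `c > 0`
`q(y) = (2πi)⁻¹ ∫_{c - i∞}^{c + i∞} e^{zy} G(z) dz`, the integral being the limit of the integrals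
over `[c - iR, c + iR]`. -/
def IsInverseLaplaceOn (S : Set ℝ) (G q : ℝ → ℝ) : Prop :=
  ∃ H : ℂ → ℂ, DifferentiableOn ℂ H {z : ℂ | 0 < z.re} ∧
    (∀ l ∈ S, 0 < l → H (l : ℂ) = (G l : ℂ)) ∧
    ∀ c y : ℝ, 0 < c → 0 < y →
      Tendsto (fun R : ℝ => ((2 * Real.pi)⁻¹ : ℂ) *
        ∫ ω in (-R)..R, Complex.exp ((c + ω * Complex.I) * y) * H (c + ω * Complex.I))
        atTop (𝓝 (q y : ℂ))

/-- The solution `u(x,t) = ∫₀^∞ p(x,y,t) φ(y) dy` with kernel `p` and initial value `φ`. -/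
def kernelSolution (p : ℝ → ℝ → ℝ → ℝ) (φ : ℝ → ℝ) (x t : ℝ) : ℝ :=
  ∫ y in Ioi (0 : ℝ), p x y t * φ y

end

end FracPDE

/-! ### Gaussian moments and the heat equation with linear potential -/

namespace FracPDE

open Set Filter Topology MeasureTheory

noncomputable section

/-! Reduction to an explicit kernel. Put z = √x and u(x,t) = w(z,t)/h(z) with h'/h = (f(z²) −
1/2)/z. The first-order term disappears and the operator becomes w ↦ w''/4 − (h''/(4h)) w. The
Riccati equation says exactly that h''/(4h) = Az/3 + C/2, so the problem is the heat equation on the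
line with a linear potential, whose kernel `linKernel` is an explicit Gaussian. On z > 0 one has
h(z) = exp(F(z²)/2)/√z; as a solution of a linear equation of Airy type, h extends to the whole line
with growth below every Gaussian (`exists_gauge`, `AirySol.abs_le`). The kernel p is `linKernel`
conjugated by h, with the source points √y and −√y added together (`spaceKernel`).

Laplace transform. Multiplying `linKernel` by exp(−λy²) and completing the square gives a kernel of
the same family, at time t/(1+λt) and with a new base point (`linKernel_mul_exp_neg_sq`). Since h is
a stationary solution it is reproduced by the kernel (`AirySol.linHeat_eq_self`), so the transform
of p is an exponential times h(base point)/h(√x); this is U_λ as soon as the base point is positive,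
which is what admissibility means. The inversion formula is pointwise Fourier inversion at a point
of differentiability.

Order one. The evolution is a prefactor times Gaussian moments of ψ(z) = h(z)φ(z²), so
differentiability and the equation are explicit; near the initial time w − ψ = O(√s) pointwise on z
> 0.

Order β < 1. The density g_β is the member a = β of the family G_a(s,t) = (2πi)⁻¹∫ exp(σt − sσ^β)
σ^{a−1} dσ (`wrightG`). There ∂_t raises a by 1, −∂_s raises a by β, and the fractional integral of
order α lowers a by α. Hence the Caputo derivative of ∫ w G_β ds = ψ + ∫ (w−ψ) G_β ds is ∫ (w−ψ)
G_{2β} ds, and an integration by parts in s turns this into the transform of w_s, that is, of the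
space operator.

Two difficulties remain. Only integrability against G_β is assumed, while other indices and a range
of times occur: saddle-point bounds from above and below (`exists_abs_wrightG_le`,
`exists_le_wrightG`) show that G_β at one sufficiently large time dominates all of them for large s
(`exists_abs_wrightG_le_domKernel`). Moreover, nothing is assumed about the space derivatives of w:
the time integral is truncated, the second derivatives of the truncations are computed by parts, and
they converge boundedly, which suffices for the limit to be C² (`hasDerivAt_deriv_of_tendsto`).

Convergence in item 3 compares the growth exp(O(s) + O(A²s³)) of w with the decay exp(−κ
s^{1/(1−β)}) of the density; 1/(1−β) > 3 is the condition β > 2/3. -/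

/-- `ψ` is integrable against every centred Gaussian. -/
def GaussTame (ψ : ℝ → ℝ) : Prop :=
  ∀ ε : ℝ, 0 < ε → Integrable fun y => Real.exp (-(ε * y ^ 2)) * ψ y

/-- The moments of `ψ` against the Gaussian `exp (p y - q y ^ 2)`. -/
def gMoment (ψ : ℝ → ℝ) (k : ℕ) (p q : ℝ) : ℝ :=
  ∫ y, y ^ k * Real.exp (p * y - q * y ^ 2) * ψ y

theorem abs_pow_le_factorial_mul_exp (k : ℕ) (y : ℝ) :
    |y| ^ k ≤ k.factorial * Real.exp |y| := by
  have := Real.pow_div_factorial_le_exp |y| (abs_nonneg y) k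
  rwa [div_le_iff₀ (by positivity), mul_comm] at this

/-- The power costs one factor e^{|y|}, and half of the quadratic term absorbs (P+1)|y|. The bound
sees p and q only through P and q₀, so it dominates whole neighbourhoods of parameters. -/
theorem pow_mul_exp_quadratic_le (k : ℕ) {P q₀ p q : ℝ} (hq₀ : 0 < q₀) (hp : |p| ≤ P)
    (hq : q₀ ≤ q) (y : ℝ) :
    |y ^ k * Real.exp (p * y - q * y ^ 2)| ≤
      k.factorial * Real.exp ((P + 1) ^ 2 / (2 * q₀)) * Real.exp (-(q₀ / 2 * y ^ 2)) := by
  rw [abs_mul, abs_pow, Real.abs_exp, mul_assoc, ← Real.exp_add]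
  have h1 := abs_pow_le_factorial_mul_exp k y
  have h2 : p * y ≤ P * |y| := (le_abs_self _).trans (by rw [abs_mul]; gcongr)
  have h3 : (P + 1) * |y| ≤ (P + 1) ^ 2 / (2 * q₀) + q₀ / 2 * y ^ 2 := by
    have : 0 ≤ ((P + 1) - q₀ * |y|) ^ 2 / (2 * q₀) := by positivity
    have e : ((P + 1) - q₀ * |y|) ^ 2 / (2 * q₀) =
        (P + 1) ^ 2 / (2 * q₀) + q₀ / 2 * |y| ^ 2 - (P + 1) * |y| := by
      field_simp; ring
    rw [e, sq_abs] at this; linarith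
  have h4 : q₀ * y ^ 2 ≤ q * y ^ 2 := by gcongr
  calc |y| ^ k * Real.exp (p * y - q * y ^ 2)
      ≤ (k.factorial * Real.exp |y|) * Real.exp (p * y - q * y ^ 2) := by gcongr
    _ = k.factorial * Real.exp (|y| + (p * y - q * y ^ 2)) := by rw [mul_assoc, ← Real.exp_add]
    _ ≤ _ := by
        exact mul_le_mul_of_nonneg_left (Real.exp_le_exp.2 (by linarith)) (by positivity)

theorem GaussTame.aestronglyMeasurable {ψ : ℝ → ℝ} (hψ : GaussTame ψ) :
    AEStronglyMeasurable ψ := by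
  have h := (hψ 1 one_pos).aestronglyMeasurable
  have h2 : AEStronglyMeasurable (fun y : ℝ => Real.exp (1 * y ^ 2)) volume :=
    (by fun_prop : Continuous fun y : ℝ => Real.exp (1 * y ^ 2)).aestronglyMeasurable
  refine (h2.mul h).congr (.of_forall fun y => ?_)
  simp only [Pi.mul_apply]
  rw [← mul_assoc, ← Real.exp_add]; simp

theorem GaussTame.integrable_moment {ψ : ℝ → ℝ} (hψ : GaussTame ψ) (k : ℕ) (p : ℝ) {q : ℝ}
    (hq : 0 < q) : Integrable fun y => y ^ k * Real.exp (p * y - q * y ^ 2) * ψ y := by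
  have h := ((hψ (q / 2) (by positivity)).norm.const_mul
    (k.factorial * Real.exp ((|p| + 1) ^ 2 / (2 * q))))
  refine h.mono' ((by fun_prop : Continuous fun y : ℝ =>
    y ^ k * Real.exp (p * y - q * y ^ 2)).aestronglyMeasurable.mul hψ.aestronglyMeasurable)
    (.of_forall fun y => ?_)
  rw [norm_mul, norm_mul _ (ψ y), ← mul_assoc, Real.norm_eq_abs, Real.norm_eq_abs (Real.exp _),
    Real.abs_exp]
  gcongr
  exact pow_mul_exp_quadratic_le k hq le_rfl le_rfl y

/-- Differentiation under the integral: ∂_p inserts y and ∂_q inserts −y². A ball of radius q/2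
keeps the Gaussian coefficient above q/2, which gives the majorant. -/
theorem hasFDerivAt_gMoment {ψ : ℝ → ℝ} (hψ : GaussTame ψ) (k : ℕ) (p : ℝ) {q : ℝ} (hq : 0 < q) :
    HasFDerivAt (fun x : ℝ × ℝ => gMoment ψ k x.1 x.2)
      (gMoment ψ (k + 1) p q • ContinuousLinearMap.fst ℝ ℝ ℝ -
        gMoment ψ (k + 2) p q • ContinuousLinearMap.snd ℝ ℝ ℝ) (p, q) := by
  set L : ℝ → ℝ × ℝ →L[ℝ] ℝ := fun y =>
    y • ContinuousLinearMap.fst ℝ ℝ ℝ - y ^ 2 • ContinuousLinearMap.snd ℝ ℝ ℝ with hL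
  have hLc : Continuous L := by fun_prop
  set G : ℝ × ℝ → ℝ → ℝ := fun x y => y ^ k * Real.exp (x.1 * y - x.2 * y ^ 2) * ψ y with hG
  have hLn : ∀ y, ‖L y‖ ≤ |y| + |y| ^ 2 := by
    intro y
    refine (norm_sub_le _ _).trans ?_
    rw [norm_smul, norm_smul, norm_pow, Real.norm_eq_abs]
    have h1 := ContinuousLinearMap.norm_fst_le (𝕜 := ℝ) (E := ℝ) (F := ℝ)
    have h2 := ContinuousLinearMap.norm_snd_le (𝕜 := ℝ) (E := ℝ) (F := ℝ)
    nlinarith [abs_nonneg y, sq_nonneg |y|]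
  set B : ℕ → ℝ := fun n => n.factorial * Real.exp ((|p| + q / 2 + 1) ^ 2 / (2 * (q / 2))) with hB
  have hm : ∀ x : ℝ × ℝ, AEStronglyMeasurable (G x) := fun x =>
    (by fun_prop : Continuous fun y : ℝ =>
      y ^ k * Real.exp (x.1 * y - x.2 * y ^ 2)).aestronglyMeasurable.mul hψ.aestronglyMeasurable
  have key := hasFDerivAt_integral_of_dominated_of_fderiv_le (μ := volume) (𝕜 := ℝ)
    (F := G) (F' := fun x y => G x y • L y) (x₀ := (p, q))
    (s := Metric.ball (p, q) (q / 2))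
    (bound := fun y => (B (k + 1) + B (k + 2)) * ‖Real.exp (-(q / 2 / 2 * y ^ 2)) * ψ y‖)
    (Metric.ball_mem_nhds _ (by positivity)) (.of_forall hm)
    (hψ.integrable_moment k p hq) ((hm _).smul hLc.aestronglyMeasurable) ?_
    ((hψ (q / 2 / 2) (by positivity)).norm.const_mul _) ?_
  · refine key.congr_fderiv ?_
    have i1 := hψ.integrable_moment (k + 1) p hq
    have i2 := hψ.integrable_moment (k + 2) p hq
    have e : (fun y => G (p, q) y • L y) = fun y =>
        (y ^ (k + 1) * Real.exp (p * y - q * y ^ 2) * ψ y) • ContinuousLinearMap.fst ℝ ℝ ℝ -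
        (y ^ (k + 2) * Real.exp (p * y - q * y ^ 2) * ψ y) • ContinuousLinearMap.snd ℝ ℝ ℝ := by
      funext y
      simp only [hG, hL, smul_sub, smul_smul]
      congr 2 <;> ring
    rw [e, integral_sub (i1.smul_const _) (i2.smul_const _), integral_smul_const,
      integral_smul_const]
    rfl
  · refine .of_forall fun y x hx => ?_
    rw [Metric.mem_ball, Prod.dist_eq, max_lt_iff, Real.dist_eq, Real.dist_eq] at hx
    have hx1 : |x.1| ≤ |p| + q / 2 := by
      have := abs_sub_abs_le_abs_sub x.1 p
      simp only at hx; linarith [hx.1]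
    have hx2 : q / 2 ≤ x.2 := by
      have := (abs_lt.1 hx.2).1
      simp only at this; linarith
    have b1 := pow_mul_exp_quadratic_le (k + 1) (by positivity : 0 < q / 2) hx1 hx2 y
    have b2 := pow_mul_exp_quadratic_le (k + 2) (by positivity : 0 < q / 2) hx1 hx2 y
    rw [norm_smul]
    calc ‖G x y‖ * ‖L y‖ ≤ ‖G x y‖ * (|y| + |y| ^ 2) := by gcongr; exact hLn y
      _ = (|y ^ (k + 1) * Real.exp (x.1 * y - x.2 * y ^ 2)| +
          |y ^ (k + 2) * Real.exp (x.1 * y - x.2 * y ^ 2)|) * |ψ y| := by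
        simp only [hG, norm_mul, Real.norm_eq_abs, abs_mul, abs_pow]; ring
      _ ≤ ((B (k + 1)) * Real.exp (-(q / 2 / 2 * y ^ 2)) +
          (B (k + 2)) * Real.exp (-(q / 2 / 2 * y ^ 2))) * |ψ y| := by gcongr
      _ = _ := by rw [norm_mul, Real.norm_eq_abs, Real.norm_eq_abs, Real.abs_exp]; ring
  · refine .of_forall fun y x _ => ?_
    have h1 : HasFDerivAt (fun x : ℝ × ℝ => x.1 * y - x.2 * y ^ 2) (L y) x := by
      have a := (hasFDerivAt_fst (𝕜 := ℝ) (E := ℝ) (F := ℝ) (p := x)).mul_const y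
      have b := (hasFDerivAt_snd (𝕜 := ℝ) (E := ℝ) (F := ℝ) (p := x)).mul_const (y ^ 2)
      exact a.sub b
    have h2 := (h1.exp.const_mul (y ^ k)).mul_const (ψ y)
    refine h2.congr_fderiv ?_
    simp only [hG, smul_smul]
    congr 1; ring

theorem hasDerivAt_gMoment_comp {ψ : ℝ → ℝ} (hψ : GaussTame ψ) (k : ℕ) {P Q : ℝ → ℝ} {P' Q' τ : ℝ}
    (hP : HasDerivAt P P' τ) (hQ : HasDerivAt Q Q' τ) (hq : 0 < Q τ) :
    HasDerivAt (fun r => gMoment ψ k (P r) (Q r))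
      (P' * gMoment ψ (k + 1) (P τ) (Q τ) - Q' * gMoment ψ (k + 2) (P τ) (Q τ)) τ := by
  have h := (hasFDerivAt_gMoment hψ k (P τ) hq).comp_hasDerivAt τ (hP.prodMk hQ)
  refine h.congr_deriv ?_
  simp; ring

theorem continuousOn_gMoment {ψ : ℝ → ℝ} (hψ : GaussTame ψ) (k : ℕ) :
    ContinuousOn (fun x : ℝ × ℝ => gMoment ψ k x.1 x.2) {x | 0 < x.2} := fun x hx =>
  (hasFDerivAt_gMoment hψ k x.1 hx).continuousAt.continuousWithinAt

/-- The heat kernel of `w_t = w_zz / 4 - (α z + γ) w` on the line. -/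
def linKernel (α γ t z y : ℝ) : ℝ :=
  (√(Real.pi * t))⁻¹ *
    Real.exp (-((z - y) ^ 2 / t) - α * t * (z + y) / 2 - γ * t + α ^ 2 * t ^ 3 / 48)

/-- The solution of `w_t = w_zz / 4 - (α z + γ) w` on the line with initial value `ψ`. -/
def linHeat (α γ : ℝ) (ψ : ℝ → ℝ) (z t : ℝ) : ℝ :=
  ∫ y, linKernel α γ t z y * ψ y

/-- The part of the exponent of `linKernel` that is independent of the second variable. -/
def linExponent (α γ z t : ℝ) : ℝ :=
  -(z ^ 2 / t) - α * t * z / 2 - γ * t + α ^ 2 * t ^ 3 / 48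

/-- The prefactor of `linHeat` when it is written through Gaussian moments. -/
def linFactor (α γ z t : ℝ) : ℝ :=
  (√(Real.pi * t))⁻¹ * Real.exp (linExponent α γ z t)

/-- The Gaussian moment occurring in `linHeat`. -/
def linMoment (α : ℝ) (ψ : ℝ → ℝ) (k : ℕ) (z t : ℝ) : ℝ :=
  gMoment ψ k (2 * z / t - α * t / 2) (1 / t)

/-- Expanding (z − y)² isolates all dependence on y in one exponential of a quadratic polynomial;
this is what makes `linHeat` a prefactor times a Gaussian moment. -/
theorem linKernel_eq (α γ : ℝ) {t : ℝ} (ht : 0 < t) (z y : ℝ) :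
    linKernel α γ t z y = linFactor α γ z t *
      (y ^ 0 * Real.exp ((2 * z / t - α * t / 2) * y - 1 / t * y ^ 2)) := by
  rw [linKernel, linFactor, pow_zero, one_mul, mul_assoc (√(Real.pi * t))⁻¹, ← Real.exp_add,
    linExponent]
  congr 2
  field_simp
  ring

theorem linHeat_eq (α γ : ℝ) (ψ : ℝ → ℝ) {t : ℝ} (ht : 0 < t) (z : ℝ) :
    linHeat α γ ψ z t = linFactor α γ z t * linMoment α ψ 0 z t := by
  simp_rw [linHeat, linMoment, gMoment, ← integral_const_mul, linKernel_eq α γ ht, mul_assoc]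

theorem GaussTame.integrable_linKernel_mul {ψ : ℝ → ℝ} (hψ : GaussTame ψ) (α γ : ℝ) {t : ℝ}
    (ht : 0 < t) (z : ℝ) : Integrable fun y => linKernel α γ t z y * ψ y := by
  simp_rw [linKernel_eq α γ ht, mul_assoc]
  refine Integrable.const_mul ?_ _
  have := hψ.integrable_moment 0 (2 * z / t - α * t / 2) (by positivity : 0 < 1 / t)
  simpa only [mul_assoc] using this

/-- The first space derivative of `linHeat`. -/
def linHeatX (α γ : ℝ) (ψ : ℝ → ℝ) (z t : ℝ) : ℝ :=
  linFactor α γ z t * ((-(2 * z / t) - α * t / 2) * linMoment α ψ 0 z t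
    + 2 / t * linMoment α ψ 1 z t)

/-- The second space derivative of `linHeat`. -/
def linHeatXX (α γ : ℝ) (ψ : ℝ → ℝ) (z t : ℝ) : ℝ :=
  linFactor α γ z t * (((-(2 * z / t) - α * t / 2) ^ 2 - 2 / t) * linMoment α ψ 0 z t
    + 2 * (-(2 * z / t) - α * t / 2) * (2 / t) * linMoment α ψ 1 z t
    + 4 / t ^ 2 * linMoment α ψ 2 z t)

theorem hasDerivAt_linFactor_space (α γ z t : ℝ) :
    HasDerivAt (fun z => linFactor α γ z t)
      (linFactor α γ z t * (-(2 * z / t) - α * t / 2)) z := by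
  have h : HasDerivAt (fun z => linExponent α γ z t) (-(2 * z / t) - α * t / 2) z := by
    have := (((hasDerivAt_pow 2 z).div_const t).neg.sub
      (((hasDerivAt_id z).const_mul (α * t)).div_const 2)).sub_const (γ * t)
      |>.add_const (α ^ 2 * t ^ 3 / 48)
    refine this.congr_deriv ?_
    simp
  simpa only [linFactor, mul_assoc] using h.exp.const_mul (√(Real.pi * t))⁻¹

theorem hasDerivAt_linMoment_space {ψ : ℝ → ℝ} (hψ : GaussTame ψ) (α : ℝ) (k : ℕ) (z : ℝ) {t : ℝ}
    (ht : 0 < t) :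
    HasDerivAt (fun z => linMoment α ψ k z t) (2 / t * linMoment α ψ (k + 1) z t) z := by
  have hP : HasDerivAt (fun z => 2 * z / t - α * t / 2) (2 / t) z := by
    simpa using (((hasDerivAt_id z).const_mul 2).div_const t).sub_const (α * t / 2)
  have := hasDerivAt_gMoment_comp hψ k hP (hasDerivAt_const z (1 / t)) (by positivity)
  simpa [linMoment] using this

theorem hasDerivAt_linHeat_space {ψ : ℝ → ℝ} (hψ : GaussTame ψ) (α γ z : ℝ) {t : ℝ} (ht : 0 < t) :
    HasDerivAt (fun z => linHeat α γ ψ z t) (linHeatX α γ ψ z t) z := by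
  have e : (fun z => linHeat α γ ψ z t) = fun z => linFactor α γ z t * linMoment α ψ 0 z t :=
    funext fun z => linHeat_eq α γ ψ ht z
  rw [e]
  refine HasDerivAt.congr_deriv ((hasDerivAt_linFactor_space α γ z t).mul (hasDerivAt_linMoment_space hψ α 0 z ht)) ?_
  rw [linHeatX]; ring

theorem hasDerivAt_linHeatX_space {ψ : ℝ → ℝ} (hψ : GaussTame ψ) (α γ z : ℝ) {t : ℝ}
    (ht : 0 < t) : HasDerivAt (fun z => linHeatX α γ ψ z t) (linHeatXX α γ ψ z t) z := by
  have hP : HasDerivAt (fun z => -(2 * z / t) - α * t / 2) (-(2 / t)) z := by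
    simpa using (((hasDerivAt_id z).const_mul 2).div_const t).neg.sub_const (α * t / 2)
  refine HasDerivAt.congr_deriv ((hasDerivAt_linFactor_space α γ z t).mul
    ((hP.mul (hasDerivAt_linMoment_space hψ α 0 z ht)).add
      ((hasDerivAt_linMoment_space hψ α 1 z ht).const_mul (2 / t)))) ?_
  rw [linHeatXX]; ring

theorem hasDerivAt_linFactor_time (α γ z : ℝ) {t : ℝ} (ht : 0 < t) :
    HasDerivAt (fun t => linFactor α γ z t)
      (linFactor α γ z t * (z ^ 2 / t ^ 2 - α * z / 2 - γ + α ^ 2 * t ^ 2 / 16 - 1 / (2 * t))) t := by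
  have h : HasDerivAt (fun t => linExponent α γ z t)
      (z ^ 2 / t ^ 2 - α * z / 2 - γ + α ^ 2 * t ^ 2 / 16) t := by
    have := ((((hasDerivAt_inv ht.ne').const_mul (z ^ 2)).neg.sub
      ((((hasDerivAt_id t).const_mul α).mul_const z).div_const 2)).sub
        ((hasDerivAt_id t).const_mul γ)).add
      (((hasDerivAt_pow 3 t).const_mul (α ^ 2)).div_const 48)
    refine this.congr_deriv ?_
    field_simp; ring
  have hpt : 0 < Real.pi * t := by positivity
  have hs : HasDerivAt (fun t => (√(Real.pi * t))⁻¹) (-((√(Real.pi * t))⁻¹ * (1 / (2 * t)))) t := by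
    have := (((hasDerivAt_id t).const_mul Real.pi).sqrt hpt.ne').inv (by positivity)
    refine this.congr_deriv ?_
    simp only [id, mul_one]
    have := Real.sq_sqrt hpt.le
    rw [this]
    field_simp
  refine (hs.mul h.exp).congr_deriv ?_
  simp only [linFactor]; ring

/-- Both sides are the prefactor times a combination of the moments of order 0, 1 and 2, and the
coefficients agree; beyond integrability nothing about ψ enters. -/
theorem hasDerivAt_linHeat_time {ψ : ℝ → ℝ} (hψ : GaussTame ψ) (α γ z : ℝ) {t : ℝ} (ht : 0 < t) :
    HasDerivAt (fun t => linHeat α γ ψ z t)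
      (linHeatXX α γ ψ z t / 4 - (α * z + γ) * linHeat α γ ψ z t) t := by
  have e : (fun t => linHeat α γ ψ z t) =ᶠ[𝓝 t]
      fun t => linFactor α γ z t * linMoment α ψ 0 z t := by
    filter_upwards [lt_mem_nhds ht] with s hs using linHeat_eq α γ ψ hs z
  refine HasDerivAt.congr_of_eventuallyEq ?_ e
  have hP : HasDerivAt (fun t => 2 * z / t - α * t / 2) (-(2 * z / t ^ 2) - α / 2) t := by
    have := ((hasDerivAt_inv ht.ne').const_mul (2 * z)).sub
      (((hasDerivAt_id t).const_mul α).div_const 2)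
    refine this.congr_deriv ?_
    field_simp
  have hQ : HasDerivAt (fun t : ℝ => 1 / t) (-(1 / t ^ 2)) t := by
    have := hasDerivAt_inv ht.ne'
    simpa [one_div] using this
  have hm := hasDerivAt_gMoment_comp hψ 0 hP hQ (by positivity)
  refine HasDerivAt.congr_deriv ((hasDerivAt_linFactor_time α γ z ht).mul hm) ?_
  rw [linHeatXX, linHeat_eq α γ ψ ht]
  simp only [linMoment]
  field_simp
  ring

theorem continuousOn_linFactor (α γ : ℝ) :
    ContinuousOn (fun x : ℝ × ℝ => linFactor α γ x.1 x.2) {x | 0 < x.2} := by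
  unfold linFactor linExponent
  have h0 : ∀ x ∈ {x : ℝ × ℝ | 0 < x.2}, x.2 ≠ 0 := fun x hx => (ne_of_gt hx)
  have h1 : ∀ x ∈ {x : ℝ × ℝ | 0 < x.2}, √(Real.pi * x.2) ≠ 0 := fun x (hx : 0 < x.2) => by
    positivity
  fun_prop (disch := assumption)

theorem continuousOn_linMoment {ψ : ℝ → ℝ} (hψ : GaussTame ψ) (α : ℝ) (k : ℕ) :
    ContinuousOn (fun x : ℝ × ℝ => linMoment α ψ k x.1 x.2) {x | 0 < x.2} := by
  have h0 : ∀ x ∈ {x : ℝ × ℝ | 0 < x.2}, x.2 ≠ 0 := fun x hx => (ne_of_gt hx)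
  refine (continuousOn_gMoment hψ k).comp (f := fun x : ℝ × ℝ =>
    (2 * x.1 / x.2 - α * x.2 / 2, 1 / x.2)) ?_ ?_
  · fun_prop (disch := assumption)
  · intro x (hx : 0 < x.2)
    simpa using hx

theorem continuousOn_linHeat {ψ : ℝ → ℝ} (hψ : GaussTame ψ) (α γ : ℝ) :
    ContinuousOn (fun x : ℝ × ℝ => linHeat α γ ψ x.1 x.2) {x | 0 < x.2} :=
  ((continuousOn_linFactor α γ).mul (continuousOn_linMoment hψ α 0)).congr
    fun x hx => linHeat_eq α γ ψ hx x.1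

theorem continuousOn_linHeatXX {ψ : ℝ → ℝ} (hψ : GaussTame ψ) (α γ : ℝ) :
    ContinuousOn (fun x : ℝ × ℝ => linHeatXX α γ ψ x.1 x.2) {x | 0 < x.2} := by
  have h0 : ∀ x ∈ {x : ℝ × ℝ | 0 < x.2}, x.2 ≠ 0 := fun x hx => (ne_of_gt hx)
  have h0' : ∀ x ∈ {x : ℝ × ℝ | 0 < x.2}, x.2 ^ 2 ≠ 0 := fun x hx => pow_ne_zero 2 (h0 x hx)
  have f := continuousOn_linFactor α γ
  have m0 := continuousOn_linMoment hψ α 0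
  have m1 := continuousOn_linMoment hψ α 1
  have m2 := continuousOn_linMoment hψ α 2
  unfold linHeatXX
  fun_prop (disch := assumption)

theorem continuousOn_linHeatX {ψ : ℝ → ℝ} (hψ : GaussTame ψ) (α γ : ℝ) :
    ContinuousOn (fun x : ℝ × ℝ => linHeatX α γ ψ x.1 x.2) {x | 0 < x.2} := by
  have h0 : ∀ x ∈ {x : ℝ × ℝ | 0 < x.2}, x.2 ≠ 0 := fun x hx => (ne_of_gt hx)
  have f := continuousOn_linFactor α γ
  have m0 := continuousOn_linMoment hψ α 0
  have m1 := continuousOn_linMoment hψ α 1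
  unfold linHeatX
  fun_prop (disch := assumption)

end

end FracPDE

/-! ### Kernel bounds and behaviour at small times -/

namespace FracPDE

open Set Filter Topology MeasureTheory

noncomputable section

theorem gaussTame_const (c : ℝ) : GaussTame fun _ => c := fun ε hε => by
  simpa [neg_mul] using (integrable_exp_neg_mul_sq hε).mul_const c

theorem GaussTame.sub {ψ χ : ℝ → ℝ} (hψ : GaussTame ψ) (hχ : GaussTame χ) :
    GaussTame fun y => ψ y - χ y := fun ε hε => by
  simp only [mul_sub]
  exact (hψ ε hε).sub (hχ ε hε)

theorem integral_exp_neg_sq_div (z : ℝ) {s : ℝ} (hs : 0 < s) :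
    ∫ y : ℝ, Real.exp (-((z - y) ^ 2 / s)) = √(Real.pi * s) := by
  have h := integral_sub_left_eq_self (fun v : ℝ => Real.exp (-(1 / s) * v ^ 2)) volume z
  rw [integral_gaussian] at h
  rw [show Real.pi * s = Real.pi / (1 / s) by field_simp, ← h]
  congr 1; funext y; congr 1; ring

theorem integrable_exp_neg_sq_div (z : ℝ) {s : ℝ} (hs : 0 < s) :
    Integrable fun y : ℝ => Real.exp (-((z - y) ^ 2 / s)) := by
  have h := (integrable_exp_neg_mul_sq (by positivity : 0 < 1 / s)).comp_sub_left z
  refine h.congr (.of_forall fun y => ?_)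
  simp only; congr 1; ring

theorem linKernel_pos (α γ : ℝ) {t : ℝ} (ht : 0 < t) (z y : ℝ) : 0 < linKernel α γ t z y := by
  unfold linKernel; positivity

theorem linKernel_drift_le (α γ : ℝ) {R S s z y : ℝ} (hs : 0 < s) (hsS : s ≤ S) (hz : |z| ≤ R) :
    -(α * s * (z + y) / 2) - γ * s + α ^ 2 * s ^ 3 / 48 ≤
      |α| * S * (R + |y|) / 2 + |γ| * S + α ^ 2 * S ^ 3 / 48 := by
  have h1 : -(α * s * (z + y) / 2) ≤ |α| * S * (R + |y|) / 2 := by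
    have : |α * s * (z + y)| ≤ |α| * S * (R + |y|) := by
      rw [abs_mul, abs_mul, abs_of_pos hs]
      have : |z + y| ≤ R + |y| := (abs_add_le _ _).trans (add_le_add_left hz _)
      have hS : 0 ≤ S := hs.le.trans hsS
      gcongr
    have := neg_abs_le (α * s * (z + y)); linarith
  have h2 : -(γ * s) ≤ |γ| * S := by
    have : |γ * s| ≤ |γ| * S := by rw [abs_mul, abs_of_pos hs]; gcongr
    have := neg_abs_le (γ * s); linarith
  have h3 : α ^ 2 * s ^ 3 / 48 ≤ α ^ 2 * S ^ 3 / 48 := by gcongr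
  linarith

/-- Near z the drift terms are bounded and the kernel is comparable to the heat kernel. At distance
δ the factor exp(−δ²/(2s)) ≤ 2s/δ² beats the singular prefactor s^{−1/2} and leaves √s, with
Gaussian decay in y uniform for s ≤ S. -/
theorem linKernel_le (α γ : ℝ) {R S δ : ℝ} (hS : 0 < S) (hδ : 0 < δ) :
    ∃ C : ℝ, 0 ≤ C ∧ ∀ z s y : ℝ, |z| ≤ R → 0 < s → s ≤ S →
      (|y - z| ≤ δ → linKernel α γ s z y ≤
        C * ((√(Real.pi * s))⁻¹ * Real.exp (-((z - y) ^ 2 / s)))) ∧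
      (δ ≤ |y - z| → linKernel α γ s z y ≤ C * (√s * Real.exp (-(1 / (8 * S) * y ^ 2)))) := by
  set c₀ := |γ| * S + α ^ 2 * S ^ 3 / 48 with hc₀
  set C₁ := Real.exp (|α| * S * (R + (R + δ)) / 2 + c₀) with hC₁
  set C₂ := 2 / δ ^ 2 *
    Real.exp (R ^ 2 / (2 * S) + |α| * S * R / 2 + c₀ + 2 * S * (|α| * S / 2) ^ 2) with hC₂
  refine ⟨C₁ + C₂, by positivity, fun z s y hz hs hsS => ⟨fun hy => ?_, fun hy => ?_⟩⟩
  · have hd := linKernel_drift_le α γ hs hsS hz (y := y)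
    have hy' : |y| ≤ R + δ := by
      have := abs_sub_abs_le_abs_sub y z; linarith
    have : linKernel α γ s z y ≤ C₁ * ((√(Real.pi * s))⁻¹ * Real.exp (-((z - y) ^ 2 / s))) := by
      rw [linKernel, mul_left_comm, ← Real.exp_add]
      refine mul_le_mul_of_nonneg_left (Real.exp_le_exp.2 ?_) (by positivity)
      have : |α| * S * (R + |y|) / 2 ≤ |α| * S * (R + (R + δ)) / 2 := by gcongr
      linarith
    refine this.trans (mul_le_mul_of_nonneg_right ?_ (by positivity))
    have : 0 ≤ C₂ := by positivity
    linarith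
  · have hd := linKernel_drift_le α γ hs hsS hz (y := y)
    have hsq : δ ^ 2 ≤ (z - y) ^ 2 := by
      rw [← sq_abs (z - y), abs_sub_comm]; gcongr
    -- One half of the exponent pays for smallness in s, the other half, with s replaced by S, for
    -- decay in y.
    have h1 : δ ^ 2 / (2 * s) + (z - y) ^ 2 / (2 * S) ≤ (z - y) ^ 2 / s := by
      have a1 : δ ^ 2 / (2 * s) ≤ (z - y) ^ 2 / (2 * s) := by gcongr
      have a2 : (z - y) ^ 2 / (2 * S) ≤ (z - y) ^ 2 / (2 * s) := by gcongr
      have a3 : (z - y) ^ 2 / s = (z - y) ^ 2 / (2 * s) + (z - y) ^ 2 / (2 * s) := by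
        field_simp; ring
      linarith
    have h2 : y ^ 2 / (4 * S) - R ^ 2 / (2 * S) ≤ (z - y) ^ 2 / (2 * S) := by
      have b : z ^ 2 ≤ R ^ 2 := sq_le_sq' (by linarith [neg_abs_le z]) (by linarith [le_abs_self z])
      have : y ^ 2 / 2 - R ^ 2 ≤ (z - y) ^ 2 := by nlinarith [sq_nonneg (y - 2 * z)]
      calc _ = (y ^ 2 / 2 - R ^ 2) / (2 * S) := by field_simp; ring
        _ ≤ _ := by gcongr
    have h3 : |α| * S / 2 * |y| ≤ 2 * S * (|α| * S / 2) ^ 2 + y ^ 2 / (8 * S) := by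
      have : 0 ≤ (4 * S * (|α| * S / 2) - |y|) ^ 2 / (8 * S) := by positivity
      have e : (4 * S * (|α| * S / 2) - |y|) ^ 2 / (8 * S) =
          2 * S * (|α| * S / 2) ^ 2 + |y| ^ 2 / (8 * S) - |α| * S / 2 * |y| := by
        field_simp; ring
      rw [e, sq_abs] at this; linarith
    have h4 : (√(Real.pi * s))⁻¹ * Real.exp (-(δ ^ 2 / (2 * s))) ≤ 2 / δ ^ 2 * √s := by
      have e1 : Real.exp (-(δ ^ 2 / (2 * s))) ≤ 2 * s / δ ^ 2 := by
        rw [Real.exp_neg]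
        have := Real.add_one_le_exp (δ ^ 2 / (2 * s))
        rw [show 2 * s / δ ^ 2 = (δ ^ 2 / (2 * s))⁻¹ by rw [inv_div]]
        exact inv_anti₀ (by positivity) (by linarith)
      have e2 : (√(Real.pi * s))⁻¹ ≤ (√s)⁻¹ := by
        refine inv_anti₀ (by positivity) (Real.sqrt_le_sqrt ?_)
        nlinarith [Real.pi_gt_three]
      calc _ ≤ (√s)⁻¹ * (2 * s / δ ^ 2) := by gcongr
        _ = 2 / δ ^ 2 * √s := by
          have := Real.sq_sqrt hs.le
          have hp : 0 < √s := by positivity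
          field_simp
          linarith
    have : linKernel α γ s z y ≤ C₂ * (√s * Real.exp (-(1 / (8 * S) * y ^ 2))) := by
      have hexp : -((z - y) ^ 2 / s) - α * s * (z + y) / 2 - γ * s + α ^ 2 * s ^ 3 / 48 ≤
          -(δ ^ 2 / (2 * s)) +
          ((R ^ 2 / (2 * S) + |α| * S * R / 2 + c₀ + 2 * S * (|α| * S / 2) ^ 2) +
            -(1 / (8 * S) * y ^ 2)) := by
        have e3 : y ^ 2 / (4 * S) = y ^ 2 / (8 * S) + 1 / (8 * S) * y ^ 2 := by field_simp; ring
        linarith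
      calc linKernel α γ s z y ≤ (√(Real.pi * s))⁻¹ * Real.exp _ :=
            mul_le_mul_of_nonneg_left (Real.exp_le_exp.2 hexp) (by positivity)
        _ = ((√(Real.pi * s))⁻¹ * Real.exp (-(δ ^ 2 / (2 * s)))) *
            (Real.exp (R ^ 2 / (2 * S) + |α| * S * R / 2 + c₀ + 2 * S * (|α| * S / 2) ^ 2) *
              Real.exp (-(1 / (8 * S) * y ^ 2))) := by
            rw [Real.exp_add, Real.exp_add (_ + _ + _ + _)]; ring
        _ ≤ (2 / δ ^ 2 * √s) * _ := by gcongr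
        _ = _ := by rw [hC₂]; ring
    refine this.trans (mul_le_mul_of_nonneg_right ?_ (by positivity))
    have : 0 ≤ C₁ := by positivity
    linarith

/-- Only the part of ψ near z needs pointwise control; the rest enters through one Gaussian integral
and carries a factor √s. The case B = 0 gives the rate of convergence at a Lipschitz point, the case
L = 0 a bound uniform over a compact set. -/
theorem abs_linHeat_le (α γ R : ℝ) {S δ : ℝ} (hS : 0 < S) (hδ : 0 < δ) :
    ∃ C : ℝ, 0 ≤ C ∧ ∀ ψ : ℝ → ℝ, GaussTame ψ → ∀ z s B L : ℝ, |z| ≤ R → 0 < s → s ≤ S →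
      0 ≤ B → 0 ≤ L → (∀ y, |y - z| ≤ δ → |ψ y| ≤ B + L * |y - z|) →
      |linHeat α γ ψ z s| ≤
        C * (B + 2 * L * √s + √s * ∫ y, |Real.exp (-(1 / (8 * S) * y ^ 2)) * ψ y|) := by
  obtain ⟨C, hC, hK⟩ := linKernel_le α γ (R := R) hS hδ
  refine ⟨C, hC, fun ψ hψ z s B L hz hs hsS hB hL hψB => ?_⟩
  set g₁ : ℝ → ℝ := fun y => (√(Real.pi * s))⁻¹ * Real.exp (-((z - y) ^ 2 / s)) * B with hg₁
  set g₂ : ℝ → ℝ := fun y => (√(Real.pi * s))⁻¹ * Real.exp (-((z - y) ^ 2 / (2 * s))) * (L * √s)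
    with hg₂
  set g₃ : ℝ → ℝ := fun y => √s * |Real.exp (-(1 / (8 * S) * y ^ 2)) * ψ y| with hg₃
  have i₁ : Integrable g₁ := ((integrable_exp_neg_sq_div z hs).const_mul _).mul_const _
  have i₂ : Integrable g₂ :=
    ((integrable_exp_neg_sq_div z (by positivity : 0 < 2 * s)).const_mul _).mul_const _
  have i₃ : Integrable g₃ := (hψ (1 / (8 * S)) (by positivity)).abs.const_mul _
  have hps : 0 < √(Real.pi * s) := by positivity
  have I₁ : ∫ y, g₁ y = B := by
    rw [hg₁, integral_mul_const, integral_const_mul, integral_exp_neg_sq_div z hs]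
    field_simp
  have I₂ : ∫ y, g₂ y ≤ 2 * L * √s := by
    rw [hg₂, integral_mul_const, integral_const_mul,
      integral_exp_neg_sq_div z (by positivity : 0 < 2 * s),
      show Real.pi * (2 * s) = 2 * (Real.pi * s) by ring,
      Real.sqrt_mul (by norm_num : (0 : ℝ) ≤ 2) (Real.pi * s)]
    have : √2 ≤ 2 := by rw [Real.sqrt_le_left (by norm_num)]; norm_num
    calc _ = √2 * (L * √s) * ((√(Real.pi * s))⁻¹ * √(Real.pi * s)) := by ring
      _ = √2 * (L * √s) := by rw [inv_mul_cancel₀ hps.ne', mul_one]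
      _ ≤ 2 * (L * √s) := by gcongr
      _ = _ := by ring
  have I₃ : ∫ y, g₃ y = √s * ∫ y, |Real.exp (-(1 / (8 * S) * y ^ 2)) * ψ y| :=
    integral_const_mul _ _
  have hpt : ∀ y, |linKernel α γ s z y * ψ y| ≤ C * (g₁ y + g₂ y + g₃ y) := by
    intro y
    have n₁ : 0 ≤ g₁ y := by simp only [hg₁]; positivity
    have n₂ : 0 ≤ g₂ y := by simp only [hg₂]; positivity
    have n₃ : 0 ≤ g₃ y := by simp only [hg₃]; positivity
    rw [abs_mul, abs_of_pos (linKernel_pos α γ hs z y)]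
    rcases le_total |y - z| δ with hy | hy
    · have h1 := (hK z s y hz hs hsS).1 hy
      have h2 := hψB y hy
      -- Half of the exponent absorbs the linear factor at the price √s.
      have hx : |y - z| * Real.exp (-((z - y) ^ 2 / s)) ≤
          √s * Real.exp (-((z - y) ^ 2 / (2 * s))) := by
        have e : -((z - y) ^ 2 / (2 * s)) = (z - y) ^ 2 / (2 * s) + -((z - y) ^ 2 / s) := by
          field_simp; ring
        rw [e, Real.exp_add, ← mul_assoc]
        gcongr
        have h3 := Real.add_one_le_exp ((z - y) ^ 2 / (2 * s))
        have h4 : |y - z| ≤ √s * ((z - y) ^ 2 / (2 * s) + 1) := by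
          have hsq := Real.sq_sqrt hs.le
          have hp : 0 < √s := by positivity
          rw [abs_sub_comm, ← sq_abs (z - y)]
          have : √s * (|z - y| ^ 2 / (2 * s) + 1) = (|z - y| ^ 2 + 2 * √s ^ 2) / (2 * √s) := by
            field_simp
            rw [hsq]; ring
          rw [this, le_div_iff₀ (by positivity)]
          nlinarith [sq_nonneg (|z - y| - √s), sq_nonneg (√s)]
        exact h4.trans (by gcongr)
      calc linKernel α γ s z y * |ψ y|
          ≤ C * ((√(Real.pi * s))⁻¹ * Real.exp (-((z - y) ^ 2 / s))) * (B + L * |y - z|) := by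
            gcongr
        _ = C * (g₁ y + (√(Real.pi * s))⁻¹ * L *
            (|y - z| * Real.exp (-((z - y) ^ 2 / s)))) := by simp only [hg₁]; ring
        _ ≤ C * (g₁ y + (√(Real.pi * s))⁻¹ * L *
            (√s * Real.exp (-((z - y) ^ 2 / (2 * s))))) := by gcongr
        _ = C * (g₁ y + g₂ y) := by simp only [hg₂]; ring
        _ ≤ _ := mul_le_mul_of_nonneg_left (by linarith) hC
    · have h1 := (hK z s y hz hs hsS).2 hy
      calc linKernel α γ s z y * |ψ y|
          ≤ C * (√s * Real.exp (-(1 / (8 * S) * y ^ 2))) * |ψ y| := by gcongr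
        _ = C * g₃ y := by simp only [hg₃, abs_mul, Real.abs_exp]; ring
        _ ≤ _ := mul_le_mul_of_nonneg_left (by linarith) hC
  calc |linHeat α γ ψ z s| ≤ ∫ y, |linKernel α γ s z y * ψ y| := abs_integral_le_integral_abs
    _ ≤ ∫ y, C * (g₁ y + g₂ y + g₃ y) :=
      integral_mono (hψ.integrable_linKernel_mul α γ hs z).abs (((i₁.add i₂).add i₃).const_mul C) hpt
    _ = C * ((∫ y, g₁ y) + (∫ y, g₂ y) + ∫ y, g₃ y) := by
      rw [integral_const_mul]
      congr 1
      exact (integral_add (i₁.add i₂) i₃).trans (congrArg (· + _) (integral_add i₁ i₂))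
    _ ≤ _ := by rw [I₁, I₃]; gcongr

/-- Completing the square in y recentres the Gaussian at z − αs²/4. -/
theorem linHeat_one (α γ : ℝ) {s : ℝ} (hs : 0 < s) (z : ℝ) :
    linHeat α γ (fun _ => 1) z s = Real.exp (-(α * s * z) - γ * s + α ^ 2 * s ^ 3 / 12) := by
  have h : ∀ y, linKernel α γ s z y * 1 = Real.exp (-(α * s * z) - γ * s + α ^ 2 * s ^ 3 / 12) *
      ((√(Real.pi * s))⁻¹ * Real.exp (-(((z - α * s ^ 2 / 4) - y) ^ 2 / s))) := by
    intro y
    rw [linKernel, mul_one, mul_left_comm, ← Real.exp_add]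
    congr 2
    field_simp; ring
  simp_rw [linHeat, h, integral_const_mul, integral_exp_neg_sq_div _ hs]
  have : 0 < √(Real.pi * s) := by positivity
  field_simp

theorem abs_exp_sub_one_le_mul_exp (g : ℝ) : |Real.exp g - 1| ≤ |g| * Real.exp |g| := by
  have h1 := Real.add_one_le_exp g
  have h2 := Real.add_one_le_exp (-g)
  have h3 : Real.exp g * Real.exp (-g) = 1 := by rw [← Real.exp_add]; simp
  have h4 : Real.exp g ≤ Real.exp |g| := Real.exp_le_exp.2 (le_abs_self g)
  have h5 : (1 : ℝ) ≤ Real.exp |g| := Real.one_le_exp (abs_nonneg g)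
  have h6 := Real.exp_pos g
  rw [abs_le]
  constructor
  · have := neg_abs_le g
    nlinarith [abs_nonneg g]
  · have : Real.exp g - 1 ≤ g * Real.exp g := by nlinarith
    refine this.trans ?_
    calc g * Real.exp g ≤ |g| * Real.exp g := by gcongr; exact le_abs_self g
      _ ≤ _ := by gcongr

/-- Because of the potential the kernel does not have mass one, so ψ − ψ(z) and the constant ψ(z)
are treated separately, the latter through `linHeat_one`. The rate √s is what later makes singular
weights in s integrable at 0. -/
theorem abs_linHeat_sub_le {ψ : ℝ → ℝ} (hψ : GaussTame ψ) (α γ z : ℝ) {S δ L : ℝ} (hS : 0 < S)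
    (hδ : 0 < δ) (hL : 0 ≤ L) (hψL : ∀ y, |y - z| ≤ δ → |ψ y - ψ z| ≤ L * |y - z|) :
    ∃ B : ℝ, 0 ≤ B ∧ ∀ s : ℝ, 0 < s → s ≤ S → |linHeat α γ ψ z s - ψ z| ≤ B * √s := by
  obtain ⟨C, hC, hH⟩ := abs_linHeat_le α γ |z| hS hδ
  have hd : GaussTame fun y => ψ y - ψ z := hψ.sub (gaussTame_const _)
  set I := ∫ y, |Real.exp (-(1 / (8 * S) * y ^ 2)) * (ψ y - ψ z)| with hI
  have hI0 : 0 ≤ I := integral_nonneg fun y => abs_nonneg _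
  set G := |α * z| + |γ| + α ^ 2 * S ^ 2 / 12 with hG
  have hG0 : 0 ≤ G := by positivity
  refine ⟨C * (2 * L + I) + |ψ z| * (√S * G * Real.exp (S * G)), by positivity,
    fun s hs hsS => ?_⟩
  have e : linHeat α γ ψ z s - ψ z = linHeat α γ (fun y => ψ y - ψ z) z s
      + ψ z * (linHeat α γ (fun _ => 1) z s - 1) := by
    have i1 := hψ.integrable_linKernel_mul α γ hs z
    have i2 := (gaussTame_const 1).integrable_linKernel_mul α γ hs z
    simp only [linHeat, mul_sub, mul_one] at i2 ⊢
    rw [integral_sub i1 (i2.mul_const _), integral_mul_const]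
    ring
  have h1 := hH _ hd z s 0 L le_rfl hs hsS le_rfl hL (by simpa using hψL)
  have h2 : |linHeat α γ (fun _ => 1) z s - 1| ≤ √s * (√S * G * Real.exp (S * G)) := by
    rw [linHeat_one α γ hs]
    refine (abs_exp_sub_one_le_mul_exp _).trans ?_
    have hg : |-(α * s * z) - γ * s + α ^ 2 * s ^ 3 / 12| ≤ s * G := by
      calc _ = |s * (-(α * z) - γ + α ^ 2 * s ^ 2 / 12)| := by congr 1; ring
        _ = s * |-(α * z) - γ + α ^ 2 * s ^ 2 / 12| := by rw [abs_mul, abs_of_pos hs]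
        _ ≤ s * G := by
          gcongr
          refine (abs_add_le _ _).trans ?_
          rw [abs_of_nonneg (by positivity : 0 ≤ α ^ 2 * s ^ 2 / 12)]
          have := abs_sub (-(α * z)) γ
          rw [abs_neg] at this
          have h3 : α ^ 2 * s ^ 2 / 12 ≤ α ^ 2 * S ^ 2 / 12 := by gcongr
          linarith
    have hss : s = √s * √s := (Real.mul_self_sqrt hs.le).symm
    calc _ ≤ (s * G) * Real.exp (S * G) := by
          gcongr
          exact hg.trans (by gcongr)
      _ = √s * (√s * G * Real.exp (S * G)) := by nth_rewrite 1 [hss]; ring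
      _ ≤ _ := by gcongr
  rw [e]
  refine (abs_add_le _ _).trans ?_
  rw [abs_mul]
  calc _ ≤ C * (0 + 2 * L * √s + √s * I) + |ψ z| * (√s * (√S * G * Real.exp (S * G))) := by gcongr
    _ = _ := by ring

end

end FracPDE

/-! ### The stationary equation h'' = (q₁ z + q₀) h: global solutions and growth -/

namespace FracPDE

open Set Filter Topology MeasureTheory

noncomputable section

/-- `|c n| R ^ n` is bounded for every `R`, so that `∑ c n z ^ n` is entire. -/
def EntireCoeff (c : ℕ → ℝ) : Prop := ∀ R : ℝ, 0 < R → ∃ C : ℝ, ∀ n, |c n| * R ^ n ≤ C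

theorem EntireCoeff.bound {c : ℕ → ℝ} (hc : EntireCoeff c) {R : ℝ} (hR : 0 < R) :
    ∃ C : ℝ, ∀ n, |c n| * R ^ n ≤ C * (1 / 2) ^ n := by
  obtain ⟨C, hC⟩ := hc (2 * R) (by positivity)
  refine ⟨C, fun n => ?_⟩
  have := hC n
  rw [mul_pow] at this
  rw [one_div, inv_pow, ← div_eq_mul_inv, le_div_iff₀ (by positivity)]
  linarith

theorem EntireCoeff.summable {c : ℕ → ℝ} (hc : EntireCoeff c) (z : ℝ) :
    Summable fun n => c n * z ^ n := by
  obtain ⟨C, hC⟩ := hc.bound (by positivity : 0 < |z| + 1)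
  refine Summable.of_norm_bounded ((summable_geometric_of_lt_one (by norm_num)
    (by norm_num : (1 / 2 : ℝ) < 1)).mul_left C) fun n => ?_
  rw [norm_mul, norm_pow, Real.norm_eq_abs, Real.norm_eq_abs]
  exact le_trans (by gcongr; linarith) (hC n)

theorem EntireCoeff.deriv {c : ℕ → ℝ} (hc : EntireCoeff c) :
    EntireCoeff fun n => (n + 1) * c (n + 1) := by
  intro R hR
  obtain ⟨C, hC⟩ := hc.bound hR
  refine ⟨C / R, fun n => ?_⟩
  have h := hC (n + 1)
  have h2 : ((n : ℝ) + 1) ≤ 2 ^ (n + 1) := by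
    exact_mod_cast (Nat.lt_two_pow_self (n := n + 1)).le
  rw [le_div_iff₀ hR, abs_mul, abs_of_pos (by positivity : (0 : ℝ) < n + 1)]
  have h3 : (n + 1 : ℝ) * (1 / 2) ^ (n + 1) ≤ 1 := by
    rw [one_div, inv_pow, ← div_eq_mul_inv, div_le_one (by positivity)]; exact h2
  have hC0 : 0 ≤ C := by
    have := hC 0; simp at this; exact (abs_nonneg _).trans this
  calc (n + 1 : ℝ) * |c (n + 1)| * R ^ n * R = (n + 1) * (|c (n + 1)| * R ^ (n + 1)) := by ring
    _ ≤ (n + 1) * (C * (1 / 2) ^ (n + 1)) := by gcongr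
    _ = C * ((n + 1) * (1 / 2) ^ (n + 1)) := by ring
    _ ≤ C * 1 := by gcongr
    _ = C := mul_one C

theorem EntireCoeff.hasDerivAt {c : ℕ → ℝ} (hc : EntireCoeff c) (z : ℝ) :
    HasDerivAt (fun z => ∑' n, c n * z ^ n) (∑' n : ℕ, (n + 1) * c (n + 1) * z ^ n) z := by
  set R := |z| + 1 with hR
  have hR0 : 0 < R := by positivity
  obtain ⟨C, hC⟩ := hc.bound hR0
  have h2 : ‖(1 / 2 : ℝ)‖ < 1 := by rw [Real.norm_eq_abs, abs_of_pos] <;> norm_num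
  have hu : Summable fun n : ℕ => C / R * ((n : ℝ) ^ 1 * (1 / 2 : ℝ) ^ n) :=
    Summable.mul_left _ (summable_pow_mul_geometric_of_norm_lt_one 1 h2)
  have hd : ∀ (n : ℕ) (y : ℝ), y ∈ Ioo (-R) R →
      HasDerivAt (fun z => c n * z ^ n) (c n * (n * y ^ (n - 1))) y :=
    fun n y _ => (hasDerivAt_pow n y).const_mul (c n)
  have hb : ∀ (n : ℕ) (y : ℝ), y ∈ Ioo (-R) R →
      ‖c n * (n * y ^ (n - 1))‖ ≤ C / R * ((n : ℝ) ^ 1 * (1 / 2 : ℝ) ^ n) := by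
    intro n y hy
    have hy' : |y| ≤ R := abs_le.2 ⟨hy.1.le, hy.2.le⟩
    rcases n with _ | n
    · simp
    · rw [norm_mul, norm_mul, norm_pow, Real.norm_eq_abs, Real.norm_eq_abs, Real.norm_eq_abs,
        Nat.abs_cast, add_tsub_cancel_right, div_mul_eq_mul_div, le_div_iff₀ hR0]
      calc |c (n + 1)| * ((n + 1 : ℕ) * |y| ^ n) * R ≤ |c (n + 1)| * ((n + 1 : ℕ) * R ^ n) * R := by
            gcongr
        _ = (n + 1 : ℕ) * (|c (n + 1)| * R ^ (n + 1)) := by ring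
        _ ≤ (n + 1 : ℕ) * (C * (1 / 2) ^ (n + 1)) :=
          mul_le_mul_of_nonneg_left (hC _) (by positivity)
        _ = _ := by ring
  have hz : z ∈ Ioo (-R) R := abs_lt.1 (by rw [hR]; linarith)
  have key := hasDerivAt_tsum_of_isPreconnected hu isOpen_Ioo isPreconnected_Ioo hd hb
    (⟨by linarith, hR0⟩ : (0 : ℝ) ∈ Ioo (-R) R) (hc.summable 0) hz
  refine key.congr_deriv ?_
  have hs : Summable fun n : ℕ => c n * (n * z ^ (n - 1)) := by
    rw [← summable_nat_add_iff 1]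
    refine (hc.deriv.summable z).congr fun n => ?_
    simp; ring
  rw [hs.tsum_eq_zero_add]
  simp only [Nat.cast_zero, zero_mul, mul_zero, zero_add, add_tsub_cancel_right, Nat.cast_add,
    Nat.cast_one]
  congr 1; funext n; ring

/-- The Taylor coefficients of the solution of `h'' = (q₁ z + q₀) h` with `h 0 = a₀`,
`h' 0 = a₁`. -/
def airyCoeff (q₁ q₀ a₀ a₁ : ℝ) : ℕ → ℝ
  | 0 => a₀
  | 1 => a₁
  | 2 => q₀ * a₀ / 2
  | (n + 3) => (q₀ * airyCoeff q₁ q₀ a₀ a₁ (n + 1) + q₁ * airyCoeff q₁ q₀ a₀ a₁ n) /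
      ((n + 3) * (n + 2))

/-- Once (n+3)(n+2) exceeds |q₀|R² + |q₁|R³, the recursion cannot increase the bound on |c n| Rⁿ, so
the finitely many earlier terms bound all of them. -/
theorem entireCoeff_airyCoeff (q₁ q₀ a₀ a₁ : ℝ) : EntireCoeff (airyCoeff q₁ q₀ a₀ a₁) := by
  intro R hR
  set c := airyCoeff q₁ q₀ a₀ a₁ with hc
  set D := |q₀| * R ^ 2 + |q₁| * R ^ 3 with hD
  obtain ⟨n₀, hn₀⟩ := exists_nat_ge D
  refine ⟨∑ k ∈ Finset.range (n₀ + 3), |c k| * R ^ k, fun n => ?_⟩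
  set C := ∑ k ∈ Finset.range (n₀ + 3), |c k| * R ^ k with hC
  have hC0 : 0 ≤ C := Finset.sum_nonneg fun k _ => by positivity
  induction n using Nat.strong_induction_on with
  | _ n ih =>
    rcases lt_or_ge n (n₀ + 3) with hn | hn
    · exact Finset.single_le_sum (f := fun k => |c k| * R ^ k) (fun k _ => by positivity)
        (Finset.mem_range.2 hn)
    · obtain ⟨m, rfl⟩ : ∃ m, n = m + 3 := ⟨n - 3, by omega⟩
      have h0 := ih m (by omega)
      have h1 := ih (m + 1) (by omega)
      have hm : (n₀ : ℝ) ≤ m := by exact_mod_cast (by omega : n₀ ≤ m)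
      have e : c (m + 3) = (q₀ * c (m + 1) + q₁ * c m) / ((m + 3) * (m + 2)) := by
        rw [hc, airyCoeff]
      rw [e, abs_div, abs_of_pos (by positivity : (0 : ℝ) < (m + 3) * (m + 2)), div_mul_eq_mul_div,
        div_le_iff₀ (by positivity)]
      have h2 : |q₀ * c (m + 1) + q₁ * c m| ≤ |q₀| * |c (m + 1)| + |q₁| * |c m| := by
        rw [← abs_mul, ← abs_mul]; exact abs_add_le _ _
      calc |q₀ * c (m + 1) + q₁ * c m| * R ^ (m + 3)
          ≤ (|q₀| * |c (m + 1)| + |q₁| * |c m|) * R ^ (m + 3) := by gcongr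
        _ = |q₀| * R ^ 2 * (|c (m + 1)| * R ^ (m + 1)) + |q₁| * R ^ 3 * (|c m| * R ^ m) := by ring
        _ ≤ |q₀| * R ^ 2 * C + |q₁| * R ^ 3 * C := by gcongr
        _ = C * D := by rw [hD]; ring
        _ ≤ C * ((m + 3) * (m + 2)) := by
          gcongr
          nlinarith [(by positivity : (0 : ℝ) ≤ m)]

/-- `h` solves `h'' = (q₁ z + q₀) h` on the line, with derivative `h'`. -/
def AirySol (q₁ q₀ : ℝ) (h h' : ℝ → ℝ) : Prop :=
  ∀ z, HasDerivAt h (h' z) z ∧ HasDerivAt h' ((q₁ * z + q₀) * h z) z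

theorem exists_airySol (q₁ q₀ a₀ a₁ : ℝ) :
    ∃ h h' : ℝ → ℝ, AirySol q₁ q₀ h h' ∧ h 0 = a₀ ∧ h' 0 = a₁ := by
  set c := airyCoeff q₁ q₀ a₀ a₁ with hc
  have h0 : EntireCoeff c := entireCoeff_airyCoeff q₁ q₀ a₀ a₁
  have h1 := h0.deriv
  have h2 := h1.deriv
  refine ⟨fun z => ∑' n, c n * z ^ n, fun z => ∑' n : ℕ, (n + 1) * c (n + 1) * z ^ n,
    fun z => ⟨h0.hasDerivAt z, (h1.hasDerivAt z).congr_deriv ?_⟩, ?_, ?_⟩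
  · rw [(h2.summable z).tsum_eq_zero_add]
    have e : ∀ n : ℕ, ((n + 1 : ℕ) + 1 : ℝ) * (((n + 1 + 1 : ℕ) + 1) * c (n + 1 + 1 + 1)) *
        z ^ (n + 1) = q₀ * (c (n + 1) * z ^ (n + 1)) + q₁ * z * (c n * z ^ n) := by
      intro n
      have : c (n + 3) = (q₀ * c (n + 1) + q₁ * c n) / ((n + 3) * (n + 2)) := by
        rw [hc, airyCoeff]
      rw [this]
      push_cast
      field_simp
      ring
    have s1 : Summable fun n => c (n + 1) * z ^ (n + 1) :=
      (summable_nat_add_iff 1).2 (h0.summable z)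
    have c2 : c 2 = q₀ * c 0 / 2 := by simp [hc, airyCoeff]
    push_cast at e ⊢
    simp_rw [e]
    rw [(s1.mul_left q₀).tsum_add ((h0.summable z).mul_left _), tsum_mul_left, tsum_mul_left,
      add_mul, (h0.summable z).tsum_eq_zero_add]
    simp only [pow_zero, mul_one]
    norm_num only
    rw [c2]
    ring
  · simp only
    rw [tsum_eq_single 0 (fun n hn => by simp [hn])]
    simp [hc, airyCoeff]
  · simp only
    rw [tsum_eq_single 0 (fun n hn => by simp [hn])]
    simp [hc, airyCoeff]

/-- The Wronskians of k with two global solutions are constant on (0, ∞). The Wronskian of these two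
is 1, so k is a fixed linear combination of them, and the combination makes sense on the whole line.
-/
theorem exists_airySol_extension (q₁ q₀ : ℝ) {k k' : ℝ → ℝ}
    (hk : ∀ z, 0 < z → HasDerivAt k (k' z) z)
    (hk' : ∀ z, 0 < z → HasDerivAt k' ((q₁ * z + q₀) * k z) z) :
    ∃ h h' : ℝ → ℝ, AirySol q₁ q₀ h h' ∧ ∀ z, 0 < z → h z = k z := by
  obtain ⟨e₁, f₁, hs₁, a1, b1⟩ := exists_airySol q₁ q₀ 1 0
  obtain ⟨e₂, f₂, hs₂, a2, b2⟩ := exists_airySol q₁ q₀ 0 1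
  have hW : ∀ z, e₁ z * f₂ z - f₁ z * e₂ z = 1 := by
    intro z
    have hd : ∀ z, HasDerivAt (fun z => e₁ z * f₂ z - f₁ z * e₂ z) 0 z := fun z =>
      (((hs₁ z).1.mul (hs₂ z).2).sub ((hs₁ z).2.mul (hs₂ z).1)).congr_deriv (by ring)
    have := is_const_of_deriv_eq_zero (fun z => (hd z).differentiableAt) (fun z => (hd z).deriv) z 0
    simpa [a1, b1, a2, b2] using this
  have hconst : ∀ e f : ℝ → ℝ, AirySol q₁ q₀ e f → ∀ z, 0 < z →
      k z * f z - k' z * e z = k 1 * f 1 - k' 1 * e 1 := by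
    intro e f hs z hz
    have hd : ∀ z ∈ Ioi (0 : ℝ), HasDerivAt (fun z => k z * f z - k' z * e z) 0 z := fun z hz =>
      (((hk z hz).mul (hs z).2).sub ((hk' z hz).mul (hs z).1)).congr_deriv (by ring)
    exact isOpen_Ioi.is_const_of_deriv_eq_zero isPreconnected_Ioi
      (fun z hz => (hd z hz).differentiableAt.differentiableWithinAt) (fun z hz => (hd z hz).deriv)
      hz (by simp : (1 : ℝ) ∈ Ioi 0)
  set A := k 1 * f₂ 1 - k' 1 * e₂ 1 with hA
  set B := k 1 * f₁ 1 - k' 1 * e₁ 1 with hB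
  refine ⟨fun z => A * e₁ z - B * e₂ z, fun z => A * f₁ z - B * f₂ z, fun z => ⟨?_, ?_⟩,
    fun z hz => ?_⟩
  · exact ((hs₁ z).1.const_mul A).sub ((hs₂ z).1.const_mul B)
  · exact (((hs₁ z).2.const_mul A).sub ((hs₂ z).2.const_mul B)).congr_deriv (by ring)
  · rw [hA, hB, ← hconst e₂ f₂ hs₂ z hz, ← hconst e₁ f₁ hs₁ z hz]
    linear_combination (k z) * hW z

theorem AirySol.comp_neg {q₁ q₀ : ℝ} {h h' : ℝ → ℝ} (hs : AirySol q₁ q₀ h h') :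
    AirySol (-q₁) q₀ (fun z => h (-z)) fun z => -h' (-z) := fun z => by
  have h1 := (hs (-z)).1.comp z (hasDerivAt_neg z)
  have h2 := ((hs (-z)).2.comp z (hasDerivAt_neg z)).neg
  exact ⟨h1.congr_deriv (by ring), h2.congr_deriv (by ring)⟩

/-- The growth rate of solutions of `h'' = (q₁ z + q₀) h`. -/
def airyRate (q₁ q₀ z : ℝ) : ℝ := √(|q₁| * |z| + |q₀| + 1)

/-- With ω the rate at the endpoint Z, |q₁z + q₀| ≤ ω² on [0, Z], and therefore (ω²h² + h'²)
exp(−2ωz) is nonincreasing there. -/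
theorem AirySol.energy_le {q₁ q₀ : ℝ} {h h' : ℝ → ℝ} (hs : AirySol q₁ q₀ h h') {Z : ℝ}
    (hZ : 0 ≤ Z) :
    airyRate q₁ q₀ Z ^ 2 * h Z ^ 2 + h' Z ^ 2 ≤
      (airyRate q₁ q₀ Z ^ 2 * h 0 ^ 2 + h' 0 ^ 2) * Real.exp (2 * (airyRate q₁ q₀ Z * Z)) := by
  set ω := airyRate q₁ q₀ Z with hω
  have hω2 : ω ^ 2 = |q₁| * Z + |q₀| + 1 := by
    rw [hω, airyRate, Real.sq_sqrt (by positivity), abs_of_nonneg hZ]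
  have hω0 : 0 ≤ ω := Real.sqrt_nonneg _
  set E : ℝ → ℝ := fun z => (ω ^ 2 * h z ^ 2 + h' z ^ 2) * Real.exp (-(2 * ω * z)) with hE
  have hd : ∀ z, HasDerivAt E ((2 * ω ^ 2 * h z * h' z + 2 * h' z * ((q₁ * z + q₀) * h z)
      - 2 * ω * (ω ^ 2 * h z ^ 2 + h' z ^ 2)) * Real.exp (-(2 * ω * z))) z := by
    intro z
    have h1 := (((hs z).1.pow 2).const_mul (ω ^ 2)).add ((hs z).2.pow 2)
    have h2 := ((hasDerivAt_id z).const_mul (2 * ω)).neg.exp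
    refine (h1.mul h2).congr_deriv ?_
    simp; ring
  have hanti : AntitoneOn E (Icc 0 Z) := by
    refine antitoneOn_of_deriv_nonpos (convex_Icc _ _)
      (fun z _ => (hd z).continuousAt.continuousWithinAt)
      (fun z _ => (hd z).differentiableAt.differentiableWithinAt) fun z hz => ?_
    rw [interior_Icc] at hz
    rw [(hd z).deriv]
    refine mul_nonpos_of_nonpos_of_nonneg ?_ (Real.exp_pos _).le
    have hq : |q₁ * z + q₀| ≤ ω ^ 2 := by
      rw [hω2]
      refine (abs_add_le _ _).trans ?_
      rw [abs_mul, abs_of_pos hz.1]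
      have : |q₁| * z ≤ |q₁| * Z := by gcongr; exact hz.2.le
      linarith
    have h1 : 2 * h' z * ((q₁ * z + q₀) * h z) ≤ 2 * ω ^ 2 * (|h z| * |h' z|) := by
      calc _ ≤ |2 * h' z * ((q₁ * z + q₀) * h z)| := le_abs_self _
        _ = 2 * |q₁ * z + q₀| * (|h z| * |h' z|) := by
          rw [abs_mul, abs_mul, abs_mul, abs_of_pos (by norm_num : (0 : ℝ) < 2)]; ring
        _ ≤ _ := by gcongr
    have h2 : 2 * ω ^ 2 * h z * h' z ≤ 2 * ω ^ 2 * (|h z| * |h' z|) := by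
      rw [mul_assoc, ← abs_mul]; gcongr; exact le_abs_self _
    have h3 : 4 * ω ^ 2 * (|h z| * |h' z|) ≤ 2 * ω * (ω ^ 2 * h z ^ 2 + h' z ^ 2) := by
      have := mul_nonneg hω0 (sq_nonneg (ω * |h z| - |h' z|))
      rw [← sq_abs (h z), ← sq_abs (h' z)]
      nlinarith
    linarith
  have := hanti (left_mem_Icc.2 hZ) (right_mem_Icc.2 hZ) hZ
  simp only [hE, mul_zero, neg_zero, Real.exp_zero, mul_one] at this
  rw [Real.exp_neg, ← div_eq_mul_inv, div_le_iff₀ (Real.exp_pos _)] at this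
  rwa [← mul_assoc]

theorem AirySol.abs_le {q₁ q₀ : ℝ} {h h' : ℝ → ℝ} (hs : AirySol q₁ q₀ h h') (z : ℝ) :
    |h z| ≤ (|h 0| + |h' 0|) * Real.exp (airyRate q₁ q₀ z * |z|) ∧
    |h' z| ≤ airyRate q₁ q₀ z * ((|h 0| + |h' 0|) * Real.exp (airyRate q₁ q₀ z * |z|)) := by
  -- Reflection changes the sign of q₁, on which the rate depends only through |q₁|.
  wlog hz : 0 ≤ z generalizing q₁ h h' z
  · have := this hs.comp_neg (-z) (by linarith)
    simpa [airyRate] using this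
  have hE := hs.energy_le hz
  set ω := airyRate q₁ q₀ z with hω
  have hω1 : 1 ≤ ω := by
    rw [hω, airyRate, Real.one_le_sqrt]
    have : 0 ≤ |q₁| * |z| + |q₀| := by positivity
    linarith
  rw [abs_of_nonneg hz]
  have h1 : (ω ^ 2 * h 0 ^ 2 + h' 0 ^ 2) * Real.exp (2 * (ω * z)) ≤
      (ω * ((|h 0| + |h' 0|) * Real.exp (ω * z))) ^ 2 := by
    rw [mul_pow, mul_pow, ← Real.exp_nat_mul, ← mul_assoc]
    push_cast
    rw [← mul_assoc (ω ^ 2), ← mul_assoc 2 ω z]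
    refine mul_le_mul_of_nonneg_right ?_ (Real.exp_pos _).le
    rw [← sq_abs (h 0), ← sq_abs (h' 0)]
    have : |h' 0| ^ 2 ≤ ω ^ 2 * |h' 0| ^ 2 := le_mul_of_one_le_left (by positivity) (by nlinarith)
    have : 0 ≤ ω ^ 2 * (2 * |h 0| * |h' 0|) := by positivity
    nlinarith
  have h0 : 0 ≤ (|h 0| + |h' 0|) * Real.exp (ω * z) := by positivity
  constructor
  · refine abs_le_of_sq_le_sq ?_ h0
    have : ω ^ 2 * h z ^ 2 ≤ ω ^ 2 * ((|h 0| + |h' 0|) * Real.exp (ω * z)) ^ 2 := by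
      rw [← mul_pow ω]
      linarith [sq_nonneg (h' z)]
    exact le_of_mul_le_mul_left this (by positivity)
  · refine abs_le_of_sq_le_sq ?_ (by positivity)
    have : 0 ≤ ω ^ 2 * h z ^ 2 := by positivity
    linarith

/-- Young's inequality with a free parameter s: growth of order |z|^{3/2} is below any Gaussian
z²/(4s), at a cost cubic in s. With s the time, this cost is one source of the s³ in the growth of
the evolution. -/
theorem airyRate_mul_le (q₁ q₀ z : ℝ) {s : ℝ} (hs : 0 < s) :
    airyRate q₁ q₀ z * |z| ≤ |z| ^ 2 / (4 * s) + (2 * (|q₀| + 1) * s + 8 * q₁ ^ 2 * s ^ 3) := by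
  set ω := airyRate q₁ q₀ z with hω
  have hω2 : ω ^ 2 = |q₁| * |z| + |q₀| + 1 := by
    rw [hω, airyRate, Real.sq_sqrt (by positivity)]
  have h1 : ω * |z| ≤ |z| ^ 2 / (8 * s) + 2 * s * ω ^ 2 := by
    have : 0 ≤ (|z| - 4 * s * ω) ^ 2 / (8 * s) := by positivity
    have e : (|z| - 4 * s * ω) ^ 2 / (8 * s) = |z| ^ 2 / (8 * s) + 2 * s * ω ^ 2 - ω * |z| := by
      field_simp; ring
    linarith
  have h2 : 2 * s * (|q₁| * |z|) ≤ |z| ^ 2 / (4 * s) - |z| ^ 2 / (8 * s) + 8 * q₁ ^ 2 * s ^ 3 := by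
    have : 0 ≤ (|z| - 8 * s ^ 2 * |q₁|) ^ 2 / (8 * s) := by positivity
    have e : (|z| - 8 * s ^ 2 * |q₁|) ^ 2 / (8 * s) =
        |z| ^ 2 / (4 * s) - |z| ^ 2 / (8 * s) + 8 * |q₁| ^ 2 * s ^ 3 - 2 * s * (|q₁| * |z|) := by
      field_simp; ring
    rw [e, sq_abs q₁] at this
    linarith
  rw [hω2] at h1
  linarith

end

end FracPDE

/-! ### Stationary solutions under the heat kernel -/

namespace FracPDE

open Set Filter Topology MeasureTheory

noncomputable section

theorem gaussTame_of_le {ψ : ℝ → ℝ} (hm : AEStronglyMeasurable ψ)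
    (hψ : ∀ δ : ℝ, 0 < δ → ∃ D : ℝ, ∀ y, |ψ y| ≤ D * Real.exp (δ * y ^ 2)) : GaussTame ψ := by
  intro ε hε
  obtain ⟨D, hD⟩ := hψ (ε / 2) (by positivity)
  refine ((integrable_exp_neg_mul_sq (by positivity : 0 < ε / 2)).const_mul D).mono'
    ((by fun_prop : Continuous fun y : ℝ => Real.exp (-(ε * y ^ 2))).aestronglyMeasurable.mul hm)
    (.of_forall fun y => ?_)
  rw [norm_mul, Real.norm_eq_abs, Real.norm_eq_abs, Real.abs_exp]
  calc Real.exp (-(ε * y ^ 2)) * |ψ y|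
      ≤ Real.exp (-(ε * y ^ 2)) * (D * Real.exp (ε / 2 * y ^ 2)) := by gcongr; exact hD y
    _ = D * (Real.exp (-(ε * y ^ 2)) * Real.exp (ε / 2 * y ^ 2)) := by ring
    _ = D * Real.exp (-(ε / 2) * y ^ 2) := by rw [← Real.exp_add]; ring_nf

theorem AirySol.continuous {q₁ q₀ : ℝ} {h h' : ℝ → ℝ} (hs : AirySol q₁ q₀ h h') :
    Continuous h ∧ Continuous h' :=
  ⟨continuous_iff_continuousAt.2 fun z => (hs z).1.continuousAt,
    continuous_iff_continuousAt.2 fun z => (hs z).2.continuousAt⟩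

theorem exists_exp_airyRate_le (q₁ q₀ : ℝ) {δ : ℝ} (hδ : 0 < δ) :
    ∃ D : ℝ, 0 ≤ D ∧ ∀ z, Real.exp (airyRate q₁ q₀ z * |z|) ≤ D * Real.exp (δ * z ^ 2) := by
  -- The parameter s = 1/(4δ) turns z²/(4s) into δz².
  refine ⟨_, (Real.exp_pos (2 * (|q₀| + 1) * (1 / (4 * δ)) + 8 * q₁ ^ 2 * (1 / (4 * δ)) ^ 3)).le,
    fun z => ?_⟩
  rw [← Real.exp_add]
  refine Real.exp_le_exp.2 ((airyRate_mul_le q₁ q₀ z (by positivity : 0 < 1 / (4 * δ))).trans ?_)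
  rw [sq_abs]
  have : z ^ 2 / (4 * (1 / (4 * δ))) = δ * z ^ 2 := by field_simp
  linarith

theorem AirySol.exists_abs_le {q₁ q₀ : ℝ} {h h' : ℝ → ℝ} (hs : AirySol q₁ q₀ h h') {δ : ℝ}
    (hδ : 0 < δ) : ∃ D : ℝ, 0 ≤ D ∧ ∀ z, |h z| ≤ D * Real.exp (δ * z ^ 2) := by
  obtain ⟨D, hD, hDz⟩ := exists_exp_airyRate_le q₁ q₀ hδ
  refine ⟨(|h 0| + |h' 0|) * D, by positivity, fun z => (hs.abs_le z).1.trans ?_⟩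
  rw [mul_assoc]
  gcongr
  exact hDz z

theorem AirySol.exists_abs_deriv_le {q₁ q₀ : ℝ} {h h' : ℝ → ℝ} (hs : AirySol q₁ q₀ h h') {δ : ℝ}
    (hδ : 0 < δ) : ∃ D : ℝ, 0 ≤ D ∧ ∀ z, |h' z| ≤ D * Real.exp (δ * z ^ 2) := by
  obtain ⟨D, hD, hDz⟩ := exists_exp_airyRate_le q₁ q₀ (half_pos hδ)
  set E := (|q₁| + |q₀| + 1) * (1 + 2 / δ) with hE
  have hω : ∀ z, airyRate q₁ q₀ z ≤ E * Real.exp (δ / 2 * z ^ 2) := by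
    intro z
    have h1 : airyRate q₁ q₀ z ≤ |q₁| * |z| + |q₀| + 1 := by
      rw [airyRate, Real.sqrt_le_left (by positivity)]
      have : 0 ≤ |q₁| * |z| + |q₀| := by positivity
      nlinarith
    have h2 : |z| ≤ 1 + z ^ 2 := by nlinarith [sq_nonneg (|z| - 1), sq_abs z]
    have h3 := Real.add_one_le_exp (δ / 2 * z ^ 2)
    have h4 : 1 + z ^ 2 ≤ (1 + 2 / δ) * Real.exp (δ / 2 * z ^ 2) := by
      calc 1 + z ^ 2 ≤ (1 + 2 / δ) * (δ / 2 * z ^ 2 + 1) := by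
            have : (1 + 2 / δ) * (δ / 2 * z ^ 2 + 1) = 1 + z ^ 2 + (2 / δ + δ / 2 * z ^ 2) := by
              field_simp; ring
            rw [this]; have : 0 ≤ 2 / δ + δ / 2 * z ^ 2 := by positivity
            linarith
        _ ≤ _ := by gcongr
    calc airyRate q₁ q₀ z ≤ |q₁| * |z| + |q₀| + 1 := h1
      _ ≤ (|q₁| + |q₀| + 1) * (1 + z ^ 2) := by
        nlinarith [abs_nonneg q₁, abs_nonneg q₀, sq_nonneg z, mul_le_mul_of_nonneg_left h2
          (abs_nonneg q₁), mul_nonneg (abs_nonneg q₀) (sq_nonneg z)]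
      _ ≤ (|q₁| + |q₀| + 1) * ((1 + 2 / δ) * Real.exp (δ / 2 * z ^ 2)) := by gcongr
      _ = _ := by rw [hE]; ring
  have hE0 : 0 ≤ E := by positivity
  refine ⟨E * ((|h 0| + |h' 0|) * D), by positivity, fun z => (hs.abs_le z).2.trans ?_⟩
  calc airyRate q₁ q₀ z * ((|h 0| + |h' 0|) * Real.exp (airyRate q₁ q₀ z * |z|))
      ≤ (E * Real.exp (δ / 2 * z ^ 2)) *
        ((|h 0| + |h' 0|) * (D * Real.exp (δ / 2 * z ^ 2))) := by
        gcongr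
        · exact hω z
        · exact hDz z
    _ = E * ((|h 0| + |h' 0|) * D) * (Real.exp (δ / 2 * z ^ 2) * Real.exp (δ / 2 * z ^ 2)) := by
        ring
    _ = _ := by rw [← Real.exp_add]; ring_nf

theorem AirySol.gaussTame {q₁ q₀ : ℝ} {h h' : ℝ → ℝ} (hs : AirySol q₁ q₀ h h') :
    GaussTame h ∧ GaussTame h' :=
  ⟨gaussTame_of_le hs.continuous.1.aestronglyMeasurable fun _ hδ =>
    (hs.exists_abs_le hδ).imp fun _ h => h.2,
  gaussTame_of_le hs.continuous.2.aestronglyMeasurable fun _ hδ =>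
    (hs.exists_abs_deriv_le hδ).imp fun _ h => h.2⟩

/-- This is ∫ (e''h − e h'') = 0 for the Gaussian e, the integrand being the derivative of the
integrable function e'h − e h', with h'' replaced by means of the equation. -/
theorem AirySol.gMoment_relation {q₁ q₀ : ℝ} {h h' : ℝ → ℝ} (hs : AirySol q₁ q₀ h h') (p : ℝ)
    {q : ℝ} (hq : 0 < q) :
    (p ^ 2 - 2 * q - q₀) * gMoment h 0 p q - (4 * p * q + q₁) * gMoment h 1 p q
      + 4 * q ^ 2 * gMoment h 2 p q = 0 := by
  obtain ⟨th, th'⟩ := hs.gaussTame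
  set e : ℝ → ℝ := fun y => Real.exp (p * y - q * y ^ 2) with he
  have hde : ∀ y, HasDerivAt e ((p - 2 * q * y) * e y) y := by
    intro y
    have := (((hasDerivAt_id y).const_mul p).sub ((hasDerivAt_pow 2 y).const_mul q)).exp
    refine this.congr_deriv ?_
    simp [he]; ring
  have i0 := th.integrable_moment 0 p hq
  have i1 := th.integrable_moment 1 p hq
  have i2 := th.integrable_moment 2 p hq
  have j0 := th'.integrable_moment 0 p hq
  have hB : ∀ y, HasDerivAt (fun y => (p - 2 * q * y) * e y * h y - e y * h' y)
      ((p ^ 2 - 2 * q - q₀) * (y ^ 0 * e y * h y) - (4 * p * q + q₁) * (y ^ 1 * e y * h y)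
        + 4 * q ^ 2 * (y ^ 2 * e y * h y)) y := by
    intro y
    have hl : HasDerivAt (fun y => p - 2 * q * y) (-(2 * q)) y := by
      simpa using ((hasDerivAt_id y).const_mul (2 * q)).const_sub p
    refine (((hl.mul (hde y)).mul (hs y).1).sub ((hde y).mul (hs y).2)).congr_deriv ?_
    simp only [Pi.mul_apply]
    ring
  have k0 := i0.const_mul (p ^ 2 - 2 * q - q₀)
  have k1 := i1.const_mul (4 * p * q + q₁)
  have k2 := i2.const_mul (4 * q ^ 2)
  have hBi : Integrable fun y => (p - 2 * q * y) * e y * h y - e y * h' y := by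
    refine (((i0.const_mul p).sub (i1.const_mul (2 * q))).sub j0).congr (.of_forall fun y => ?_)
    simp only [Pi.sub_apply, he]; ring
  have key := integral_eq_zero_of_hasDerivAt_of_integrable hB ((k0.sub k1).add k2) hBi
  have e1 := (integral_add (k0.sub k1) k2).trans (congrArg (· + _) (integral_sub k0 k1))
  simp only [integral_const_mul] at e1
  exact e1.symm.trans key

theorem exists_lipschitz_near {h h' : ℝ → ℝ} {z δ : ℝ}
    (hd : ∀ y ∈ Icc (z - δ) (z + δ), HasDerivAt h (h' y) y)
    (hc : ContinuousOn h' (Icc (z - δ) (z + δ))) :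
    ∃ L : ℝ, 0 ≤ L ∧ ∀ y, |y - z| ≤ δ → |h y - h z| ≤ L * |y - z| := by
  obtain ⟨L, hL⟩ := isCompact_Icc.exists_bound_of_continuousOn hc
  refine ⟨|L|, abs_nonneg L, fun y hy => ?_⟩
  have hy' : y ∈ Icc (z - δ) (z + δ) := by
    rw [abs_le] at hy; exact ⟨by linarith, by linarith⟩
  have hδ : 0 ≤ δ := (abs_nonneg _).trans hy
  have := (convex_Icc (z - δ) (z + δ)).norm_image_sub_le_of_norm_hasDerivWithin_le
    (fun x hx => (hd x hx).hasDerivWithinAt) (fun x hx => (hL x hx).trans (le_abs_self L))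
    (⟨by linarith, by linarith⟩ : z ∈ Icc (z - δ) (z + δ)) hy'
  simpa [Real.norm_eq_abs] using this

/-- Stationary solutions are reproduced by the heat kernel. -/
theorem AirySol.linHeat_eq_self {α γ : ℝ} {h h' : ℝ → ℝ} (hs : AirySol (4 * α) (4 * γ) h h')
    (z : ℝ) {t : ℝ} (ht : 0 < t) : linHeat α γ h z t = h z := by
  have th := hs.gaussTame.1
  -- The right-hand side of the evolution equation is a multiple of the moment relation at p = 2z/s
  -- − αs/2, q = 1/s, hence zero.
  have hd : ∀ s ∈ Ioi (0 : ℝ), HasDerivAt (fun s => linHeat α γ h z s) 0 s := by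
    intro s (hs0 : 0 < s)
    refine (hasDerivAt_linHeat_time th α γ z hs0).congr_deriv ?_
    have h1 := hs.gMoment_relation (2 * z / s - α * s / 2) (by positivity : 0 < 1 / s)
    rw [linHeatXX, FracPDE.linHeat_eq α γ h hs0]
    have : ∀ m : ℕ, gMoment h m (2 * z / s - α * s / 2) (1 / s) = linMoment α h m z s :=
      fun m => rfl
    rw [this, this, this] at h1
    have h2 : linFactor α γ z s * (((-(2 * z / s) - α * s / 2) ^ 2 - 2 / s) * linMoment α h 0 z s
        + 2 * (-(2 * z / s) - α * s / 2) * (2 / s) * linMoment α h 1 z s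
        + 4 / s ^ 2 * linMoment α h 2 z s) / 4
        - (α * z + γ) * (linFactor α γ z s * linMoment α h 0 z s) = linFactor α γ z s / 4 *
      (((2 * z / s - α * s / 2) ^ 2 - 2 * (1 / s) - 4 * γ) * linMoment α h 0 z s -
        (4 * (2 * z / s - α * s / 2) * (1 / s) + 4 * α) * linMoment α h 1 z s +
        4 * (1 / s) ^ 2 * linMoment α h 2 z s) := by
      field_simp; ring
    rw [h2, h1, mul_zero]
  have hconst : ∀ s ∈ Ioi (0 : ℝ), linHeat α γ h z s = linHeat α γ h z t := fun s hs0 =>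
    isOpen_Ioi.is_const_of_deriv_eq_zero isPreconnected_Ioi
      (fun s hs => (hd s hs).differentiableAt.differentiableWithinAt) (fun s hs => (hd s hs).deriv)
      hs0 ht
  -- The constant value is identified by letting s → 0.
  obtain ⟨L, hL, hLip⟩ := exists_lipschitz_near (z := z) (δ := 1) (fun y _ => (hs y).1)
    hs.continuous.2.continuousOn
  obtain ⟨B, hB, hsmall⟩ := abs_linHeat_sub_le th α γ z one_pos one_pos hL hLip
  have hlim : Tendsto (fun s : ℝ => B * √s) (𝓝[>] 0) (𝓝 0) := by
    have : Continuous fun s : ℝ => B * √s := by fun_prop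
    simpa using (this.tendsto 0).mono_left nhdsWithin_le_nhds
  have hle : |linHeat α γ h z t - h z| ≤ 0 := by
    refine ge_of_tendsto hlim ?_
    filter_upwards [Ioc_mem_nhdsGT (zero_lt_one' ℝ)] with s hs
    rw [← hconst s hs.1]
    exact hsmall s hs.1 hs.2
  exact sub_eq_zero.1 (abs_eq_zero.1 (le_antisymm hle (abs_nonneg _)))

/-- The point at which the stationary solution is evaluated in `laplaceU`. -/
def footPoint (A l z t : ℝ) : ℝ := z / (1 + l * t) - A * l * t ^ 3 / (12 * (1 + l * t) ^ 2)

/-- Adding l to the coefficient 1/t of y² gives (1 + lt)/t, so the new time is t/(1 + lt). The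
coefficient of y then determines the base point, and what is left is free of y: this is the origin
of the exponent S. -/
theorem linKernel_mul_exp_neg_sq (A C : ℝ) {l z t : ℝ} (hz : 0 < z) (ht : 0 < t) (hl : 0 ≤ l)
    (y : ℝ) :
    linKernel (A / 3) (C / 2) t z y * Real.exp (-(l * y ^ 2)) =
      (√(1 + l * t))⁻¹ * Real.exp (exponentS A C l (z ^ 2) t) *
        linKernel (A / 3) (C / 2) (t / (1 + l * t)) (footPoint A l z t) y := by
  have hD : 0 < 1 + l * t := by positivity
  have hs : √(Real.pi * (t / (1 + l * t))) = √(Real.pi * t) / √(1 + l * t) := by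
    rw [← mul_div_assoc, Real.sqrt_div (by positivity)]
  have hp : 0 < √(1 + l * t) := by positivity
  rw [linKernel, linKernel, hs, mul_assoc, ← Real.exp_add, inv_div,
    show ∀ a b c e : ℝ, a⁻¹ * b * (a / c * e) = (a⁻¹ * a) * (c⁻¹ * (b * e)) by intros; ring,
    inv_mul_cancel₀ hp.ne', one_mul, ← Real.exp_add, exponentS, footPoint, Real.sqrt_sq hz.le]
  congr 2
  field_simp
  ring

theorem AirySol.integral_linKernel_mul_exp {A C : ℝ} {h h' : ℝ → ℝ}
    (hs : AirySol (4 * (A / 3)) (4 * (C / 2)) h h') {l z t : ℝ} (hz : 0 < z) (ht : 0 < t)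
    (hl : 0 ≤ l) :
    ∫ y, linKernel (A / 3) (C / 2) t z y * (Real.exp (-(l * y ^ 2)) * h y) =
      (√(1 + l * t))⁻¹ * Real.exp (exponentS A C l (z ^ 2) t) * h (footPoint A l z t) := by
  have hD : 0 < 1 + l * t := by positivity
  simp_rw [← mul_assoc, linKernel_mul_exp_neg_sq A C hz ht hl, mul_assoc, integral_const_mul]
  congr 2
  exact hs.linHeat_eq_self _ (by positivity)

end

end FracPDE

/-! ### Pointwise Fourier and Laplace inversion -/

namespace FracPDE

open Set Filter Topology MeasureTheory

noncomputable section

/-- The Riemann–Lebesgue lemma, with the factor −2π of the Fourier character absorbed into the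
frequency. -/
theorem tendsto_integral_cexp_mul_zero (f : ℝ → ℂ) {c : ℝ} (hc : c ≠ 0) :
    Tendsto (fun R : ℝ => ∫ v : ℝ, Complex.exp (Complex.I * (c * R) * v) * f v) atTop (𝓝 0) := by
  have h := Real.tendsto_integral_exp_smul_cocompact f
  have h2 : Tendsto (fun R : ℝ => -(c / (2 * Real.pi)) * R) atTop (cocompact ℝ) :=
    (Homeomorph.mulLeft₀ (-(c / (2 * Real.pi)))
      (by simp [hc, Real.pi_ne_zero])).isClosedEmbedding.tendsto_cocompact.comp
      (atTop_le_cocompact (α := ℝ))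
  refine (h.comp h2).congr fun R => ?_
  simp only [Function.comp_apply]
  congr 1
  funext v
  rw [Circle.smul_def, smul_eq_mul, Real.fourierChar_apply]
  congr 2
  push_cast
  have : (Real.pi : ℂ) ≠ 0 := by exact_mod_cast Real.pi_ne_zero
  field_simp

/-- The truncated Fourier inversion integral at `y`, up to the factor `2 π`. -/
def fourierTrunc (g : ℝ → ℂ) (y R : ℝ) : ℂ :=
  ∫ ω in (-R)..R, ∫ v : ℝ, Complex.exp (Complex.I * ω * (y - v)) * g v

theorem norm_cexp_I_mul_mul (ω x : ℝ) : ‖Complex.exp (Complex.I * ω * x)‖ = 1 := by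
  rw [Complex.norm_exp]; simp

/-- Fubini is available on the bounded frequency interval, and the inner integral is elementary away
from the null set v = y. -/
theorem fourierTrunc_eq {g : ℝ → ℂ} (hg : Integrable g) (y : ℝ) {R : ℝ} (hR : 0 ≤ R) :
    fourierTrunc g y R = ∫ v : ℝ, (Complex.exp (Complex.I * R * (y - v)) -
      Complex.exp (-(Complex.I * R * (y - v)))) * (g v / (Complex.I * (y - v))) := by
  rw [fourierTrunc, intervalIntegral.integral_of_le (by linarith)]
  have hfin : Integrable (fun _ : ℝ => (1 : ℝ)) (volume.restrict (Ioc (-R) R)) :=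
    integrable_const_iff.2 (Or.inr ⟨by simp⟩)
  have hi : Integrable (Function.uncurry fun (ω v : ℝ) =>
      Complex.exp (Complex.I * ω * (y - v)) * g v)
      ((volume.restrict (Ioc (-R) R)).prod volume) := by
    refine (hfin.mul_prod hg.norm).mono' ?_ (.of_forall fun x => ?_)
    · refine (Continuous.aestronglyMeasurable ?_).mul hg.aestronglyMeasurable.comp_snd
      fun_prop
    · simp only [Function.uncurry, one_mul]
      rw [norm_mul]
      have := norm_cexp_I_mul_mul x.1 (y - x.2)
      push_cast at this
      rw [this, one_mul]
  rw [integral_integral_swap hi]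
  refine integral_congr_ae ?_
  have hne : ∀ᵐ v : ℝ, v ≠ y := by simp [ae_iff, measure_singleton]
  filter_upwards [hne] with v hv
  have hv' : (y - v : ℂ) ≠ 0 := by
    rw [sub_ne_zero]; exact_mod_cast hv.symm
  rw [integral_mul_const, ← intervalIntegral.integral_of_le (by linarith)]
  have e : ∀ ω : ℝ, Complex.exp (Complex.I * ω * (y - v)) =
      Complex.exp (Complex.I * (y - v) * ω) := fun ω => by congr 1; ring
  simp_rw [e]
  rw [integral_exp_mul_complex (mul_ne_zero Complex.I_ne_zero hv')]
  push_cast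
  rw [show Complex.I * (y - v) * -R = -(Complex.I * R * (y - v)) by ring,
    show Complex.I * (y - v) * R = (Complex.I * R * (y - v)) by ring]
  ring

/-- A Dini condition: when g(v)/(y − v) is integrable, the truncated integral is a difference of two
oscillatory integrals, each of which vanishes by Riemann–Lebesgue. -/
theorem tendsto_fourierTrunc_zero {g : ℝ → ℂ} (hg : Integrable g) {y : ℝ}
    (hk : Integrable fun v : ℝ => g v / (Complex.I * (y - v))) :
    Tendsto (fourierTrunc g y) atTop (𝓝 0) := by
  set k : ℝ → ℂ := fun v : ℝ => g v / (Complex.I * (y - v)) with hkd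
  have h1 := (tendsto_integral_cexp_mul_zero (fun v => k v) (c := -1) (by norm_num))
  have h2 := (tendsto_integral_cexp_mul_zero (fun v => k v) (c := 1) (by norm_num))
  have h3 : Tendsto (fun R : ℝ => ‖∫ v : ℝ, Complex.exp (Complex.I * ((-1 : ℝ) * R) * v) * k v‖ +
      ‖∫ v : ℝ, Complex.exp (Complex.I * ((1 : ℝ) * R) * v) * k v‖) atTop (𝓝 0) := by
    simpa using h1.norm.add h2.norm
  refine squeeze_zero_norm' ?_ h3
  filter_upwards [eventually_ge_atTop 0] with R hR
  rw [fourierTrunc_eq hg y hR]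
  have hb : ∀ c : ℝ, Integrable fun v : ℝ => Complex.exp (Complex.I * ((c : ℝ) * R) * v) * k v := by
    intro c
    refine hk.norm.mono' ((Continuous.aestronglyMeasurable (by fun_prop)).mul
      hk.aestronglyMeasurable) (.of_forall fun v => ?_)
    rw [norm_mul]
    have := norm_cexp_I_mul_mul (c * R) v
    push_cast at this
    rw [this, one_mul]
  have e : ∀ v : ℝ, (Complex.exp (Complex.I * R * (y - v)) -
      Complex.exp (-(Complex.I * R * (y - v)))) * k v =
      Complex.exp (Complex.I * R * y) * (Complex.exp (Complex.I * ((-1 : ℝ) * R) * v) * k v) -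
      Complex.exp (Complex.I * (-R : ℝ) * y) *
        (Complex.exp (Complex.I * ((1 : ℝ) * R) * v) * k v) := by
    intro v
    have E1 : Complex.exp (Complex.I * R * (y - v)) = Complex.exp (Complex.I * R * y) *
        Complex.exp (Complex.I * ((-1 : ℝ) * R) * v) := by
      rw [← Complex.exp_add]; congr 1; push_cast; ring
    have E2 : Complex.exp (-(Complex.I * R * (y - v))) = Complex.exp (Complex.I * (-R : ℝ) * y) *
        Complex.exp (Complex.I * ((1 : ℝ) * R) * v) := by
      rw [← Complex.exp_add]; congr 1; push_cast; ring
    rw [E1, E2]; ring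
  refine (congrArg norm (integral_congr_ae (.of_forall e))).trans_le ?_
  rw [integral_sub ((hb _).const_mul _) ((hb _).const_mul _), integral_const_mul,
    integral_const_mul]
  refine (norm_sub_le _ _).trans (le_of_eq ?_)
  rw [norm_mul, norm_mul, norm_cexp_I_mul_mul, norm_cexp_I_mul_mul, one_mul, one_mul]

theorem integrable_gaussian_shift (y : ℝ) :
    Integrable fun v : ℝ => (Real.exp (-(v - y) ^ 2) : ℂ) := by
  have := (integrable_exp_neg_mul_sq one_pos).comp_sub_right y
  refine this.ofReal.congr (.of_forall fun v => ?_)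
  simp

/-- The one function for which inversion is computed by hand; it serves to remove the value at y in
the general case. -/
theorem tendsto_fourierTrunc_gaussian (y : ℝ) :
    Tendsto (fun R => fourierTrunc (fun v => (Real.exp (-(v - y) ^ 2) : ℂ)) y R) atTop
      (𝓝 (2 * Real.pi)) := by
  have hin : ∀ ω : ℝ, ∫ v : ℝ, Complex.exp (Complex.I * ω * (y - v)) *
      (Real.exp (-(v - y) ^ 2) : ℂ) = (Real.pi : ℂ) ^ (1 / 2 : ℂ) *
        Complex.exp (-(1 / 4 : ℝ) * (ω : ℂ) ^ 2) := by
    intro ω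
    have h := fourierIntegral_gaussian (b := 1) (by simp) (-(ω : ℂ))
    have h2 := integral_sub_right_eq_self (fun x : ℝ =>
      Complex.exp (Complex.I * (-(ω : ℂ)) * x) * Complex.exp (-1 * x ^ 2)) (μ := volume) y
    rw [h] at h2
    calc _ = _ := by
          congr 1; funext v
          push_cast
          congr 2 <;> ring
      _ = _ := h2
      _ = _ := by congr 2 <;> push_cast <;> ring
  have hG := integrable_cexp_neg_mul_sq (b := (1 / 4 : ℝ)) (by norm_num)
  have hlim := intervalIntegral_tendsto_integral (hG.const_mul ((Real.pi : ℂ) ^ (1 / 2 : ℂ)))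
    tendsto_neg_atTop_atBot (tendsto_id (α := ℝ))
  rw [integral_const_mul, integral_gaussian_complex (by norm_num)] at hlim
  convert hlim using 2
  · rw [fourierTrunc]
    exact intervalIntegral.integral_congr fun ω _ => hin ω
  · have h2 : (2 : ℂ) = ((4 : ℝ) : ℂ) ^ (1 / 2 : ℂ) := by
      rw [show (1 / 2 : ℂ) = ((1 / 2 : ℝ) : ℂ) by push_cast; ring,
        ← Complex.ofReal_cpow (by norm_num), ← Real.sqrt_eq_rpow,
        show (4 : ℝ) = 2 ^ 2 by norm_num, Real.sqrt_sq (by norm_num)]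
      norm_num
    have h3 : ((Real.pi : ℂ) / ((1 / 4 : ℝ) : ℂ)) = ((4 : ℝ) : ℂ) * (Real.pi : ℂ) := by
      push_cast; field_simp
    rw [h3, Complex.mul_cpow_ofReal_nonneg (by norm_num) Real.pi_pos.le, ← h2,
      mul_left_comm, ← Complex.cpow_add _ _ (by exact_mod_cast Real.pi_ne_zero)]
    norm_num

/-- Pointwise Fourier inversion, as a principal value, at points of differentiability. -/
theorem tendsto_fourierTrunc {g : ℝ → ℂ} (hg : Integrable g) {y : ℝ}
    (hd : DifferentiableAt ℝ g y) :
    Tendsto (fun R => (2 * Real.pi : ℂ)⁻¹ * fourierTrunc g y R) atTop (𝓝 (g y)) := by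
  set Φ : ℝ → ℂ := fun v => (Real.exp (-(v - y) ^ 2) : ℂ) with hΦ
  have hΦi : Integrable Φ := integrable_gaussian_shift y
  -- The difference vanishes at y, so differentiability bounds d(v)/(y − v) near y; away from y it
  -- is dominated by ‖d‖/ε. Thus d satisfies the Dini condition.
  set d : ℝ → ℂ := fun v => g v - g y * Φ v with hdd
  have hdi : Integrable d := hg.sub (hΦi.const_mul _)
  have hΦd : DifferentiableAt ℝ Φ y := by
    have : DifferentiableAt ℝ (fun v : ℝ => Real.exp (-(v - y) ^ 2)) y := by fun_prop
    exact Complex.ofRealCLM.differentiableAt.comp y this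
  have hddiff : DifferentiableAt ℝ d y := hd.sub (hΦd.const_mul _)
  have hdy : d y = 0 := by simp [hdd, hΦ]
  have hO := hddiff.isBigO_sub
  obtain ⟨c, hc⟩ := hO.bound
  rw [Metric.eventually_nhds_iff] at hc
  obtain ⟨ε, hε, hc⟩ := hc
  have hk : Integrable fun v : ℝ => d v / (Complex.I * (y - v)) := by
    have hbd : Integrable (fun v : ℝ => (Ioo (y - ε) (y + ε)).indicator (fun _ => |c|) v +
        ‖d v‖ / ε) := by
      refine Integrable.add ?_ (hdi.norm.div_const _)
      refine (integrable_indicator_iff measurableSet_Ioo).2 ?_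
      exact integrableOn_const (by simp) 
    refine hbd.mono' ?_ (.of_forall fun v => ?_)
    · exact (hdi.aemeasurable.div (by fun_prop : Continuous fun v : ℝ =>
        Complex.I * ((y : ℂ) - v)).measurable.aemeasurable).aestronglyMeasurable
    · have hn : ‖(Complex.I * ((y : ℂ) - v))‖ = |v - y| := by
        rw [norm_mul, Complex.norm_I, one_mul, ← Complex.ofReal_sub, Complex.norm_real,
          Real.norm_eq_abs, abs_sub_comm]
      rw [norm_div, hn]
      by_cases hv : v ∈ Ioo (y - ε) (y + ε)
      · rw [indicator_of_mem hv]
        have hv' : dist v y < ε := by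
          rw [Real.dist_eq, abs_lt]; exact ⟨by linarith [hv.1], by linarith [hv.2]⟩
        have h1 := hc hv'
        rw [hdy, sub_zero, Real.norm_eq_abs] at h1
        have h2 : ‖d v‖ / |v - y| ≤ |c| := by
          rcases eq_or_ne v y with rfl | hne
          · simp
          · rw [div_le_iff₀ (abs_pos.2 (sub_ne_zero.2 hne))]
            exact h1.trans (by gcongr; exact le_abs_self c)
        have : 0 ≤ ‖d v‖ / ε := by positivity
        linarith
      · rw [indicator_of_notMem hv, zero_add]
        have : ε ≤ |v - y| := by
          by_contra hcon
          rw [not_le, abs_lt] at hcon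
          exact hv ⟨by linarith [hcon.1], by linarith [hcon.2]⟩
        gcongr
  have h1 := tendsto_fourierTrunc_zero hdi hk
  have h2 := (tendsto_fourierTrunc_gaussian y).const_mul (g y)
  have h3 := (h1.add h2).const_mul (2 * Real.pi : ℂ)⁻¹
  have hpi : (Real.pi : ℂ) ≠ 0 := by exact_mod_cast Real.pi_ne_zero
  have e : (2 * Real.pi : ℂ)⁻¹ * (0 + g y * (2 * Real.pi)) = g y := by field_simp; ring
  rw [e] at h3
  refine h3.congr' ?_
  filter_upwards [eventually_ge_atTop 0] with R hR
  congr 1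
  have hb : ∀ f : ℝ → ℂ, Integrable f → ∀ ω : ℝ,
      Integrable fun v : ℝ => Complex.exp (Complex.I * ω * (y - v)) * f v := by
    intro f hf ω
    refine hf.norm.mono' ((Continuous.aestronglyMeasurable (by fun_prop)).mul
      hf.aestronglyMeasurable) (.of_forall fun v => ?_)
    rw [norm_mul]
    have := norm_cexp_I_mul_mul ω (y - v)
    push_cast at this
    rw [this, one_mul]
  have hc : ∀ f : ℝ → ℂ, Integrable f →
      Continuous fun ω : ℝ => ∫ v : ℝ, Complex.exp (Complex.I * ω * (y - v)) * f v := by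
    intro f hf
    refine continuous_of_dominated (fun ω => (hb f hf ω).aestronglyMeasurable)
      (bound := fun v => ‖f v‖) (fun ω => .of_forall fun v => ?_) hf.norm
      (.of_forall fun v => by fun_prop)
    rw [norm_mul]
    have := norm_cexp_I_mul_mul ω (y - v)
    push_cast at this
    rw [this, one_mul]
  rw [fourierTrunc, fourierTrunc, fourierTrunc, ← intervalIntegral.integral_const_mul,
    ← intervalIntegral.integral_add ((hc d hdi).intervalIntegrable _ _)
      (((hc Φ hΦi).intervalIntegrable _ _).const_mul _)]
  refine intervalIntegral.integral_congr fun ω _ => ?_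
  rw [← integral_const_mul, ← integral_add (hb d hdi ω) ((hb Φ hΦi ω).const_mul _)]
  congr 1; funext v
  simp only [hdd]; ring

/-- The Laplace transform on `(0, ∞)`. -/
def laplaceHalf (q : ℝ → ℝ) (z : ℂ) : ℂ := ∫ y in Ioi (0 : ℝ), Complex.exp (-(z * y)) * q y

theorem integrableOn_cexp_mul {q : ℝ → ℝ}
    (hq : ∀ ε : ℝ, 0 < ε → IntegrableOn (fun y => Real.exp (-(ε * y)) * q y) (Ioi 0)) {z : ℂ}
    (hz : 0 < z.re) : IntegrableOn (fun y : ℝ => Complex.exp (-(z * y)) * q y) (Ioi 0) := by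
  have hm : AEStronglyMeasurable q (volume.restrict (Ioi 0)) := by
    have h2 : AEStronglyMeasurable (fun y : ℝ => Real.exp (1 * y)) (volume.restrict (Ioi 0)) :=
      (by fun_prop : Continuous fun y : ℝ => Real.exp (1 * y)).aestronglyMeasurable
    refine (h2.mul (hq 1 one_pos).aestronglyMeasurable).congr (.of_forall fun y => ?_)
    simp only [Pi.mul_apply]
    rw [← mul_assoc, ← Real.exp_add]; simp
  refine (hq z.re hz).norm.mono' ((Continuous.aestronglyMeasurable (by fun_prop)).mul
    (Complex.continuous_ofReal.comp_aestronglyMeasurable hm)) (.of_forall fun y => le_of_eq ?_)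
  rw [norm_mul, norm_mul, Complex.norm_exp, Complex.norm_real, Real.norm_eq_abs, Real.norm_eq_abs,
    Real.abs_exp]
  simp

theorem differentiableOn_laplaceHalf {q : ℝ → ℝ}
    (hq : ∀ ε : ℝ, 0 < ε → IntegrableOn (fun y => Real.exp (-(ε * y)) * q y) (Ioi 0)) :
    DifferentiableOn ℂ (laplaceHalf q) {z : ℂ | 0 < z.re} := by
  intro z hz
  have hz : 0 < z.re := hz
  refine DifferentiableAt.differentiableWithinAt ?_
  set δ := z.re / 4 with hδ
  have hδ0 : 0 < δ := by positivity
  have hs : {w : ℂ | 2 * δ < w.re} ∈ 𝓝 z :=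
    (isOpen_lt continuous_const Complex.continuous_re).mem_nhds (by
      show 2 * δ < z.re; rw [hδ]; linarith)
  have key := hasDerivAt_integral_of_dominated_loc_of_deriv_le
    (μ := volume.restrict (Ioi (0 : ℝ))) (𝕜 := ℂ)
    (F := fun (w : ℂ) (y : ℝ) => Complex.exp (-(w * y)) * q y)
    (F' := fun (w : ℂ) (y : ℝ) => -(y : ℂ) * (Complex.exp (-(w * y)) * q y)) (x₀ := z)
    (bound := fun y => δ⁻¹ * ‖Real.exp (-(δ * y)) * q y‖) hs
    (by
      filter_upwards [hs] with w hw
      exact (integrableOn_cexp_mul hq (by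
        have : 2 * δ < w.re := hw
        linarith)).aestronglyMeasurable)
    (integrableOn_cexp_mul hq hz)
    ((Continuous.aestronglyMeasurable (by fun_prop)).mul
      (integrableOn_cexp_mul hq hz).aestronglyMeasurable) ?_ ((hq δ hδ0).norm.const_mul _) ?_
  · exact key.2.differentiableAt
  · refine (ae_restrict_iff' measurableSet_Ioi).2 (.of_forall fun y hy w hw => ?_)
    have hy : 0 < y := hy
    have hw : 2 * δ < w.re := hw
    rw [norm_mul, norm_mul, norm_mul, Complex.norm_exp, norm_neg, Complex.norm_real,
      Complex.norm_real, Real.norm_eq_abs, Real.norm_eq_abs, Real.norm_eq_abs, Real.abs_exp,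
      abs_of_pos hy, ← mul_assoc, ← mul_assoc]
    refine mul_le_mul_of_nonneg_right ?_ (abs_nonneg _)
    have h1 : (-(w * y)).re = -(w.re * y) := by simp
    rw [h1]
    have h2 := Real.add_one_le_exp (δ * y)
    have h3 : y ≤ δ⁻¹ * Real.exp (δ * y) := by
      rw [inv_mul_eq_div, le_div_iff₀ hδ0]; linarith
    calc y * Real.exp (-(w.re * y)) ≤ δ⁻¹ * Real.exp (δ * y) * Real.exp (-(2 * δ * y)) := by gcongr
      _ = δ⁻¹ * Real.exp (-(δ * y)) := by rw [mul_assoc, ← Real.exp_add]; ring_nf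
  · refine .of_forall fun y w _ => ?_
    have h1 : HasDerivAt (fun w : ℂ => -(w * y)) (-(y : ℂ)) w := by
      exact ((hasDerivAt_id w).mul_const (y : ℂ)).neg.congr_deriv (by simp)
    refine (h1.cexp.mul_const (q y : ℂ)).congr_deriv ?_
    ring

/-- On the line Re z = c the Laplace transform is the Fourier transform of exp(−cv) q(v) cut off to
v > 0. -/
theorem tendsto_laplaceHalf_inverse {q : ℝ → ℝ}
    (hq : ∀ ε : ℝ, 0 < ε → IntegrableOn (fun y => Real.exp (-(ε * y)) * q y) (Ioi 0))
    {c y : ℝ} (hc : 0 < c) (hy : 0 < y) (hd : DifferentiableAt ℝ q y) :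
    Tendsto (fun R : ℝ => ((2 * Real.pi)⁻¹ : ℂ) *
        ∫ ω in (-R)..R, Complex.exp ((c + ω * Complex.I) * y) * laplaceHalf q (c + ω * Complex.I))
        atTop (𝓝 (q y : ℂ)) := by
  set g : ℝ → ℂ := (Ioi (0 : ℝ)).indicator fun v => Complex.exp (-((c : ℂ) * v)) * q v with hg
  have hgi : Integrable g := (integrable_indicator_iff measurableSet_Ioi).2
    (integrableOn_cexp_mul hq (by simpa using hc))
  have hgd : DifferentiableAt ℝ g y := by
    have h1 : DifferentiableAt ℝ (fun v : ℝ => Complex.exp (-((c : ℂ) * v)) * q v) y := by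
      have a : DifferentiableAt ℝ (fun v : ℝ => Real.exp (-(c * v)) * q v) y :=
        (by fun_prop : DifferentiableAt ℝ (fun v : ℝ => Real.exp (-(c * v))) y).mul hd
      refine (Complex.ofRealCLM.differentiableAt.comp y a).congr_of_eventuallyEq (.of_forall fun v => ?_)
      simp
    refine h1.congr_of_eventuallyEq ?_
    filter_upwards [lt_mem_nhds hy] with v hv
    exact indicator_of_mem (show v ∈ Ioi (0 : ℝ) from hv) _
  have h := (tendsto_fourierTrunc hgi hgd).const_mul (Complex.exp ((c : ℂ) * y))
  have e1 : Complex.exp ((c : ℂ) * y) * g y = q y := by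
    rw [hg, indicator_of_mem (show y ∈ Ioi (0 : ℝ) from hy), ← mul_assoc, ← Complex.exp_add]
    simp
  rw [e1] at h
  refine h.congr fun R => ?_
  rw [mul_left_comm, fourierTrunc, ← intervalIntegral.integral_const_mul]
  congr 1
  refine intervalIntegral.integral_congr fun ω _ => ?_
  simp only [laplaceHalf]
  rw [← integral_const_mul, ← integral_const_mul, ← integral_indicator measurableSet_Ioi]
  congr 1; funext v
  by_cases hv : v ∈ Ioi (0 : ℝ)
  · rw [hg, indicator_of_mem hv, indicator_of_mem hv, ← mul_assoc, ← mul_assoc, ← mul_assoc,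
      ← Complex.exp_add, ← Complex.exp_add, ← Complex.exp_add]
    congr 2; ring
  · rw [hg, indicator_of_notMem hv, indicator_of_notMem hv]; simp

theorem isInverseLaplaceOn_of_differentiable {q G : ℝ → ℝ} {S : Set ℝ}
    (hq : ∀ ε : ℝ, 0 < ε → IntegrableOn (fun y => Real.exp (-(ε * y)) * q y) (Ioi 0))
    (hd : ∀ y : ℝ, 0 < y → DifferentiableAt ℝ q y)
    (hG : ∀ l ∈ S, 0 < l → ∫ y in Ioi (0 : ℝ), Real.exp (-(l * y)) * q y = G l) :
    IsInverseLaplaceOn S G q := by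
  refine ⟨laplaceHalf q, differentiableOn_laplaceHalf hq, fun l hl hl0 => ?_,
    fun c y hc hy => tendsto_laplaceHalf_inverse hq hc hy (hd y hy)⟩
  rw [← hG l hl hl0, laplaceHalf, ← integral_complex_ofReal]
  congr 1; funext y; push_cast; rfl

end

end FracPDE

/-! ### The gauge function, the kernel p and its Laplace transform -/

namespace FracPDE

open Set Filter Topology MeasureTheory

noncomputable section

theorem rpow_half_eq (y : ℝ) : y ^ (1 / 2 : ℝ) = √y := (Real.sqrt_eq_rpow y).symm

theorem half_mul_rpow_eq {y : ℝ} (hy : 0 < y) :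
    (1 / 2 : ℝ) * y ^ ((1 / 2 : ℝ) - 1) = (2 * √y)⁻¹ := by
  rw [Real.rpow_sub_one hy.ne', rpow_half_eq]
  have h := Real.sq_sqrt hy.le
  have : 0 < √y := by positivity
  field_simp
  rw [h]

/-- The substitution y = z² on each half of the line, with Jacobian 1/(2√y). -/
theorem integrableOn_fold {Ψ : ℝ → ℝ} (hΨ : Integrable Ψ) :
    IntegrableOn (fun y => (Ψ √y + Ψ (-√y)) / (2 * √y)) (Ioi 0) ∧
      ∫ y in Ioi (0 : ℝ), (Ψ √y + Ψ (-√y)) / (2 * √y) = ∫ z, Ψ z := by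
  have hi : IntegrableOn (fun z => Ψ z + Ψ (-z)) (Ioi 0) :=
    (hΨ.add hΨ.comp_neg).integrableOn
  have e : ∀ y ∈ Ioi (0 : ℝ), |(1 / 2 : ℝ)| * y ^ ((1 / 2 : ℝ) - 1) *
      (Ψ (y ^ (1 / 2 : ℝ)) + Ψ (-y ^ (1 / 2 : ℝ))) = (Ψ √y + Ψ (-√y)) / (2 * √y) := by
    intro y hy
    rw [abs_of_pos (by norm_num), half_mul_rpow_eq hy, rpow_half_eq, div_eq_inv_mul]
  constructor
  · have := (integrableOn_Ioi_comp_rpow_iff (fun z => Ψ z + Ψ (-z))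
      (by norm_num : (1 / 2 : ℝ) ≠ 0)).2 hi
    exact this.congr_fun e measurableSet_Ioi
  · have h := integral_comp_rpow_Ioi (fun z => Ψ z + Ψ (-z)) (by norm_num : (1 / 2 : ℝ) ≠ 0)
    simp only [smul_eq_mul] at h
    rw [setIntegral_congr_fun measurableSet_Ioi e] at h
    rw [h, integral_add hΨ.integrableOn hΨ.comp_neg.integrableOn, integral_comp_neg_Ioi, neg_zero,
      add_comm]
    exact intervalIntegral.integral_Iic_add_Ioi hΨ.integrableOn hΨ.integrableOn

theorem integrable_comp_sq {g : ℝ → ℝ}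
    (hg : IntegrableOn (fun y => (√y)⁻¹ * g y) (Ioi 0)) : Integrable fun z => g (z ^ 2) := by
  have h1 : IntegrableOn (fun z => g (z ^ 2)) (Ioi 0) := by
    rw [← integrableOn_Ioi_comp_rpow_iff _ (by norm_num : (1 / 2 : ℝ) ≠ 0)]
    refine IntegrableOn.congr_fun (hg.const_mul (1 / 2)) (fun y (hy : 0 < y) => ?_)
      measurableSet_Ioi
    simp only [smul_eq_mul]
    rw [abs_of_pos (by norm_num), half_mul_rpow_eq hy, rpow_half_eq, Real.sq_sqrt hy.le]
    ring
  have h2 : IntegrableOn (fun z => g (z ^ 2)) (Iic 0) := by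
    have : IntegrableOn (fun z => g ((-z) ^ 2)) (Iic 0) := by
      rw [integrableOn_Iic_iff_integrableOn_Iio]
      have h3 : IntegrableOn (fun z => g (z ^ 2)) (Ioi (-0)) := by rwa [neg_zero]
      exact h3.comp_neg_Iio 
    simpa using this
  rw [← integrableOn_univ, ← Iic_union_Ioi (a := (0 : ℝ))]
  exact h2.union h1

/-- `h` is the solution of `h'' = 4 (A z / 3 + C / 2) h` on the line which on `(0, ∞)` is
`exp (F (z ^ 2) / 2) / √z`. -/
structure Gauge (A C : ℝ) (F h h' : ℝ → ℝ) : Prop where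
  sol : AirySol (4 * (A / 3)) (4 * (C / 2)) h h'
  eq : ∀ z, 0 < z → h z = Real.exp (F (z ^ 2) / 2) * (√z)⁻¹

theorem Gauge.pos {A C : ℝ} {F h h' : ℝ → ℝ} (hg : Gauge A C F h h') {z : ℝ} (hz : 0 < z) :
    0 < h z := by
  rw [hg.eq z hz]; positivity

/-- The classical linearisation of a Riccati equation: the function on z > 0 with logarithmic
derivative (f(z²) − 1/2)/z satisfies a linear second-order equation, and by the Riccati equation its
potential is affine in z. It can therefore be continued across 0. -/
theorem exists_gauge {A C : ℝ} {f F : ℝ → ℝ} (hf : ∀ x : ℝ, 0 < x → DifferentiableAt ℝ f x)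
    (hRiccati : ∀ x : ℝ, 0 < x →
      x * deriv f x - f x + f x ^ 2 / 2 = 2 / 3 * A * x ^ (3 / 2 : ℝ) + C * x - 3 / 8)
    (hF : ∀ x : ℝ, 0 < x → HasDerivAt F (f x / x) x) :
    ∃ h h' : ℝ → ℝ, Gauge A C F h h' ∧ ∀ z, 0 < z → h' z = h z * ((f (z ^ 2) - 1 / 2) / z) := by
  set k : ℝ → ℝ := fun z => Real.exp (F (z ^ 2) / 2) * (√z)⁻¹ with hk
  have hk1 : ∀ z, 0 < z → HasDerivAt k (k z * ((f (z ^ 2) - 1 / 2) / z)) z := by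
    intro z hz
    have h1 : HasDerivAt (fun z => F (z ^ 2)) (f (z ^ 2) / z ^ 2 * (2 * z)) z := by
      have := (hF (z ^ 2) (by positivity)).comp z (hasDerivAt_pow 2 z)
      refine this.congr_deriv ?_
      simp
    have h2 := (h1.div_const 2).exp.mul ((Real.hasDerivAt_sqrt hz.ne').inv (by positivity))
    refine h2.congr_deriv ?_
    have hs := Real.sq_sqrt hz.le
    have hp : 0 < √z := by positivity
    simp only [hk, hs, Pi.inv_apply]
    field_simp
    ring
  have hk2 : ∀ z, 0 < z → HasDerivAt (fun z => k z * ((f (z ^ 2) - 1 / 2) / z))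
      ((4 * (A / 3) * z + 4 * (C / 2)) * k z) z := by
    intro z hz
    have hz2 : 0 < z ^ 2 := by positivity
    have h1 : HasDerivAt (fun z => f (z ^ 2)) (deriv f (z ^ 2) * (2 * z)) z := by
      have := HasDerivAt.comp (h₂ := f) (h := fun z : ℝ => z ^ 2) z (hf (z ^ 2) hz2).hasDerivAt
        (hasDerivAt_pow 2 z)
      refine this.congr_deriv ?_
      simp
    refine ((hk1 z hz).mul ((h1.sub_const (1 / 2)).div (hasDerivAt_id z) hz.ne')).congr_deriv ?_
    have hR := hRiccati (z ^ 2) hz2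
    have hpow : (z ^ 2) ^ (3 / 2 : ℝ) = z ^ 3 := by
      rw [← Real.rpow_natCast, ← Real.rpow_mul hz.le, ← Real.rpow_natCast]; norm_num
    rw [hpow] at hR
    simp only [id, Pi.div_apply]
    field_simp
    linear_combination (24 * k z) * hR
  obtain ⟨h, h', hs, he⟩ := exists_airySol_extension _ _ hk1 hk2
  refine ⟨h, h', ⟨hs, he⟩, fun z hz => ?_⟩
  have e : h =ᶠ[𝓝 z] k := by
    filter_upwards [lt_mem_nhds hz] with w hw using he w hw
  rw [he z hz]
  exact (hs z).1.unique ((hk1 z hz).congr_of_eventuallyEq e)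

/-- The kernel `p(x, y, t)`. -/
def spaceKernel (A C : ℝ) (h : ℝ → ℝ) (x y t : ℝ) : ℝ :=
  (linKernel (A / 3) (C / 2) t √x √y * h √y + linKernel (A / 3) (C / 2) t √x (-√y) * h (-√y)) /
    (2 * √y) / h √x

/-- Since g(y) = g((±√y)²), the integrand has the folded form, and integrals against p become
integrals over the whole line against `linKernel`. -/
theorem spaceKernel_mul_eq (A C : ℝ) (h g : ℝ → ℝ) (x t : ℝ) {y : ℝ} (hy : 0 < y) :
    spaceKernel A C h x y t * g y =
      ((linKernel (A / 3) (C / 2) t √x √y * (h √y * g (√y ^ 2)) +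
        linKernel (A / 3) (C / 2) t √x (-√y) * (h (-√y) * g ((-√y) ^ 2))) / (2 * √y)) / h √x := by
  rw [spaceKernel, neg_sq, Real.sq_sqrt hy.le]
  ring

theorem integrableOn_spaceKernel_mul (A C : ℝ) {h g : ℝ → ℝ}
    (hg : GaussTame fun z => h z * g (z ^ 2)) (x : ℝ) {t : ℝ} (ht : 0 < t) :
    IntegrableOn (fun y => spaceKernel A C h x y t * g y) (Ioi 0) := by
  have := (integrableOn_fold (hg.integrable_linKernel_mul (A / 3) (C / 2) ht √x)).1.div_const
    (h √x)
  exact IntegrableOn.congr_fun this (fun y hy => (spaceKernel_mul_eq A C h g x t hy).symm)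
    measurableSet_Ioi

theorem kernelSolution_spaceKernel (A C : ℝ) {h g : ℝ → ℝ}
    (hg : GaussTame fun z => h z * g (z ^ 2)) (x : ℝ) {t : ℝ} (ht : 0 < t) :
    kernelSolution (spaceKernel A C h) g x t =
      linHeat (A / 3) (C / 2) (fun z => h z * g (z ^ 2)) √x t / h √x := by
  rw [kernelSolution, setIntegral_congr_fun measurableSet_Ioi
    (fun y hy => spaceKernel_mul_eq A C h g x t hy), integral_div,
    (integrableOn_fold (hg.integrable_linKernel_mul (A / 3) (C / 2) ht √x)).2]
  rfl

/-- After y = z² the hypothesis is Gaussian integrability of φ(z²); half of ε is spent on the growth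
of h. -/
theorem AirySol.gaussTame_mul {q₁ q₀ : ℝ} {h h' : ℝ → ℝ} (hs : AirySol q₁ q₀ h h') {φ : ℝ → ℝ}
    (hφ : ∀ ε : ℝ, 0 < ε → IntegrableOn
      (fun y => Real.exp (-(ε * y)) * (√y)⁻¹ * φ y) (Ioi 0)) :
    GaussTame fun z => h z * φ (z ^ 2) := by
  have hg : GaussTame fun z => φ (z ^ 2) := fun ε hε => by
    refine integrable_comp_sq (g := fun y => Real.exp (-(ε * y)) * φ y) ?_
    refine (hφ ε hε).congr_fun (fun y _ => ?_) measurableSet_Ioi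
    simp only; ring
  intro ε hε
  obtain ⟨D, hD, hDz⟩ := hs.exists_abs_le (half_pos hε)
  refine ((hg (ε / 2) (half_pos hε)).norm.const_mul D).mono' ?_ (.of_forall fun z => ?_)
  · exact (by fun_prop : Continuous fun y : ℝ => Real.exp (-(ε * y ^ 2))).aestronglyMeasurable.mul
      (hs.continuous.1.aestronglyMeasurable.mul hg.aestronglyMeasurable)
  · rw [norm_mul, norm_mul, norm_mul, Real.norm_eq_abs, Real.norm_eq_abs, Real.norm_eq_abs,
      Real.norm_eq_abs, Real.abs_exp, Real.abs_exp]
    calc Real.exp (-(ε * z ^ 2)) * (|h z| * |φ (z ^ 2)|)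
        ≤ Real.exp (-(ε * z ^ 2)) * ((D * Real.exp (ε / 2 * z ^ 2)) * |φ (z ^ 2)|) := by
          gcongr; exact hDz z
      _ = D * ((Real.exp (-(ε * z ^ 2)) * Real.exp (ε / 2 * z ^ 2)) * |φ (z ^ 2)|) := by ring
      _ = _ := by rw [← Real.exp_add]; ring_nf

theorem AirySol.gaussTame_mul_exp {q₁ q₀ : ℝ} {h h' : ℝ → ℝ} (hs : AirySol q₁ q₀ h h') {l : ℝ}
    (hl : 0 ≤ l) : GaussTame fun z => h z * Real.exp (-(l * z ^ 2)) := by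
  refine gaussTame_of_le (hs.continuous.1.mul (by fun_prop)).aestronglyMeasurable fun δ hδ => ?_
  obtain ⟨D, _, hDz⟩ := hs.exists_abs_le hδ
  refine ⟨D, fun z => ?_⟩
  rw [abs_mul, Real.abs_exp]
  refine (mul_le_of_le_one_right (abs_nonneg _) ?_).trans (hDz z)
  rw [Real.exp_le_one_iff]
  have : 0 ≤ l * z ^ 2 := by positivity
  linarith

/-- Unfolded, the integral is h(w)/h(√x) times the exponential factor, where w is the base point.
Admissibility is equivalent to w > 0, and only there is h given by its formula in terms of F; the
radicand of U_λ is √x/(w(1 + lt)). -/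
theorem Gauge.integral_exp_mul_spaceKernel {A C : ℝ} {F h h' : ℝ → ℝ} (hg : Gauge A C F h h')
    {x t l : ℝ} (hx : 0 < x) (ht : 0 < t) (hl : l ∈ admissible A x t) :
    ∫ y in Ioi (0 : ℝ), Real.exp (-(l * y)) * spaceKernel A C h x y t = laplaceU A C F l x t := by
  obtain ⟨hl0, hadm⟩ := hl
  have hz : 0 < √x := by positivity
  have hD : 0 < 1 + l * t := by positivity
  have h1 := kernelSolution_spaceKernel A C (g := fun y => Real.exp (-(l * y)))
    (hg.sol.gaussTame_mul_exp hl0) x ht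
  have h2 := hg.sol.integral_linKernel_mul_exp hz ht hl0
  simp_rw [mul_comm (Real.exp _) (spaceKernel _ _ _ _ _ _)]
  rw [kernelSolution] at h1
  rw [h1]
  simp_rw [linHeat, mul_comm (h _)]
  rw [h2, Real.sq_sqrt hx.le, laplaceU]
  set w := footPoint A l √x t with hw
  have hw1 : √x * (1 + l * t) - A * l * t ^ 3 / 12 = w * (1 + l * t) ^ 2 := by
    rw [hw, footPoint]; field_simp
  have hw0 : 0 < w := by
    rw [hw1] at hadm
    exact (pos_iff_pos_of_mul_pos hadm).2 (by positivity)
  have hw2 : (12 * (1 + l * t) * √x - A * l * t ^ 3) ^ 2 / (144 * (1 + l * t) ^ 4) = w ^ 2 := by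
    rw [hw, footPoint]; field_simp; ring
  rw [hw1, hw2, hg.eq w hw0, hg.eq √x hz, Real.sq_sqrt hx.le,
    show √x * (1 + l * t) / (w * (1 + l * t) ^ 2) = √x / (w * (1 + l * t)) by field_simp,
    Real.sqrt_div hz.le, Real.sqrt_mul hw0.le,
    show -(1 / 2) * (F x - F (w ^ 2)) = F (w ^ 2) / 2 - F x / 2 by ring, Real.exp_sub]
  have a1 : 0 < √w := by positivity
  have a2 : 0 < √√x := by positivity
  have a3 : 0 < √(1 + l * t) := by positivity
  field_simp

theorem Gauge.integrableOn_exp_mul_spaceKernel {A C : ℝ} {F h h' : ℝ → ℝ}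
    (hg : Gauge A C F h h') (x : ℝ) {t l : ℝ} (ht : 0 < t) (hl : 0 ≤ l) :
    IntegrableOn (fun y => Real.exp (-(l * y)) * spaceKernel A C h x y t) (Ioi 0) := by
  have := integrableOn_spaceKernel_mul A C (g := fun y => Real.exp (-(l * y)))
    (hg.sol.gaussTame_mul_exp hl) x ht
  simpa only [mul_comm] using this

theorem Gauge.isInverseLaplaceOn {A C : ℝ} {F h h' : ℝ → ℝ} (hg : Gauge A C F h h')
    {x t : ℝ} (hx : 0 < x) (ht : 0 < t) :
    IsInverseLaplaceOn (admissible A x t) (fun l => laplaceU A C F l x t)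
      (fun y => spaceKernel A C h x y t) := by
  refine isInverseLaplaceOn_of_differentiable
    (fun ε hε => hg.integrableOn_exp_mul_spaceKernel x ht hε.le) (fun y hy => ?_)
    (fun l hl _ => hg.integral_exp_mul_spaceKernel hx ht hl)
  have hh : Differentiable ℝ h := fun z => (hg.sol z).1.differentiableAt
  have hs : DifferentiableAt ℝ (fun y => √y) y := (Real.hasDerivAt_sqrt hy.ne').differentiableAt
  have h1 : DifferentiableAt ℝ (fun y => h √y) y := hh.differentiableAt.comp y hs
  have h2 : DifferentiableAt ℝ (fun y => h (-√y)) y := hh.differentiableAt.comp y hs.neg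
  have h3 : 2 * √y ≠ 0 := by positivity
  unfold spaceKernel linKernel
  fun_prop (disch := assumption)

end

end FracPDE

/-! ### Bromwich integrals of exp(σt − sσ^β) σ^{a−1} -/

namespace FracPDE

open Set Filter Topology MeasureTheory

noncomputable section

theorem cos_half_pi_mul_pos {β : ℝ} (hβ : 0 < β) (hβ1 : β < 1) : 0 < Real.cos (Real.pi / 2 * β) := by
  have := Real.pi_pos
  apply Real.cos_pos_of_mem_Ioo
  constructor <;> nlinarith

/-- In the right half-plane |arg σ| ≤ π/2, so σ^β stays in a sector strictly inside it. This is the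
source of all decay of exp(−sσ^β) on vertical lines. -/
theorem re_cpow_ge {β : ℝ} (hβ : 0 < β) (hβ1 : β < 1) {σ : ℂ} (hσ : 0 ≤ σ.re) :
    Real.cos (Real.pi / 2 * β) * ‖σ‖ ^ β ≤ (σ ^ (β : ℂ)).re := by
  rw [Complex.cpow_ofReal_re, mul_comm]
  refine mul_le_mul_of_nonneg_left ?_ (by positivity)
  have h := Complex.abs_arg_le_pi_div_two_iff.2 hσ
  rw [← Real.cos_abs (σ.arg * β), abs_mul, abs_of_pos hβ]
  have hpi := Real.pi_pos
  apply Real.cos_le_cos_of_nonneg_of_le_pi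
  · positivity
  · nlinarith
  · gcongr

theorem exists_rpow_mul_exp_neg_rpow_le {β : ℝ} (hβ : 0 < β) (b : ℝ) {s₀ c₀ : ℝ} (hs : 0 < s₀)
    (hc : 0 < c₀) :
    ∃ C : ℝ, 0 ≤ C ∧ ∀ u, c₀ ≤ u → u ^ b * Real.exp (-(s₀ * u ^ β)) ≤ C := by
  have h1 : Tendsto (fun u : ℝ => u ^ b * Real.exp (-(s₀ * u ^ β))) atTop (𝓝 0) := by
    have h := (tendsto_rpow_mul_exp_neg_mul_atTop_nhds_zero (b / β) s₀ hs).comp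
      (tendsto_rpow_atTop hβ)
    refine h.congr' ?_
    filter_upwards [eventually_gt_atTop 0] with u hu
    simp only [Function.comp_apply]
    rw [← Real.rpow_mul hu.le, mul_div_cancel₀ _ hβ.ne', neg_mul]
  obtain ⟨U, hU⟩ := eventually_atTop.1 (h1.eventually (gt_mem_nhds one_pos))
  have hcont : ContinuousOn (fun u : ℝ => u ^ b * Real.exp (-(s₀ * u ^ β))) (Icc c₀ U) := by
    have h0 : ∀ u ∈ Icc c₀ U, u ≠ 0 ∨ 0 ≤ b := fun u hu => Or.inl (hc.trans_le hu.1).ne'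
    have h0' : ∀ u ∈ Icc c₀ U, u ≠ 0 ∨ 0 ≤ β := fun u hu => Or.inr hβ.le
    exact (continuousOn_id.rpow_const h0).mul
      ((continuousOn_id.rpow_const h0').const_smul s₀).neg.rexp
  obtain ⟨C, hC⟩ := isCompact_Icc.exists_bound_of_continuousOn hcont
  refine ⟨max C 1, by positivity, fun u hu => ?_⟩
  rcases le_total u U with h | h
  · exact (le_abs_self _).trans ((hC u ⟨hu, h⟩).trans (le_max_left _ _))
  · exact (hU u h).le.trans (le_max_right _ _)

/-- The integrand `exp (σ t - s σ ^ β) σ ^ (a - 1)` of the Bromwich integral, at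
`σ = c + i y`. -/
def wrightLine (β a c s t y : ℝ) : ℂ :=
  Complex.exp ((c + y * Complex.I) * t - s * (c + y * Complex.I) ^ (β : ℂ)) *
    (c + y * Complex.I) ^ ((a - 1 : ℝ) : ℂ)

theorem sigma_re (c y : ℝ) : (c + y * Complex.I : ℂ).re = c := by simp

theorem sigma_mem_slitPlane {c : ℝ} (hc : 0 < c) (y : ℝ) :
    (c + y * Complex.I : ℂ) ∈ Complex.slitPlane := Or.inl (by simpa using hc)

theorem sigma_ne_zero {c : ℝ} (hc : 0 < c) (y : ℝ) : (c + y * Complex.I : ℂ) ≠ 0 :=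
  Complex.slitPlane_ne_zero (sigma_mem_slitPlane hc y)

theorem norm_wrightLine (β a c s t y : ℝ) :
    ‖wrightLine β a c s t y‖ =
      Real.exp (c * t - s * ((c + y * Complex.I : ℂ) ^ (β : ℂ)).re) *
        ‖(c + y * Complex.I : ℂ)‖ ^ (a - 1) := by
  rw [wrightLine, norm_mul, Complex.norm_cpow_real, Complex.norm_exp]
  simp

theorem norm_sigma_sq (c y : ℝ) : ‖(c + y * Complex.I : ℂ)‖ ^ 2 = c ^ 2 + y ^ 2 := by
  rw [Complex.sq_norm, Complex.normSq_add_mul_I]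

theorem le_norm_sigma {c : ℝ} (y : ℝ) : c ≤ ‖(c + y * Complex.I : ℂ)‖ := by
  have := Complex.abs_re_le_norm (c + y * Complex.I : ℂ)
  rw [sigma_re] at this
  exact (le_abs_self c).trans this

theorem inv_norm_sigma_sq_le {c c₀ : ℝ} (hc₀ : 0 < c₀) (hc : c₀ ≤ c) (y : ℝ) :
    (‖(c + y * Complex.I : ℂ)‖ ^ 2)⁻¹ ≤ (min (c₀ ^ 2) 1)⁻¹ * (1 + y ^ 2)⁻¹ := by
  have hm : 0 < min (c₀ ^ 2) 1 := by positivity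
  rw [← mul_inv, norm_sigma_sq]
  refine inv_anti₀ (by positivity) ?_
  have h1 : min (c₀ ^ 2) 1 ≤ c ^ 2 := (min_le_left _ _).trans (by gcongr)
  have h2 : min (c₀ ^ 2) 1 * y ^ 2 ≤ 1 * y ^ 2 := by gcongr; exact min_le_right _ _
  linarith

theorem exists_norm_wrightLine_le {β : ℝ} (hβ : 0 < β) (hβ1 : β < 1) (a c₁ T : ℝ) {s₀ c₀ : ℝ}
    (hs₀ : 0 < s₀) (hc₀ : 0 < c₀) :
    ∃ C : ℝ, 0 ≤ C ∧ ∀ c s t y : ℝ, c₀ ≤ c → c ≤ c₁ → s₀ ≤ s → |t| ≤ T →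
      ‖wrightLine β a c s t y‖ ≤ C * (1 + y ^ 2)⁻¹ := by
  set κ := Real.cos (Real.pi / 2 * β) with hκ
  have hκ0 : 0 < κ := cos_half_pi_mul_pos hβ hβ1
  -- Two extra powers of |σ| are bought from the exponential, to be returned as the integrable
  -- factor |σ|⁻².
  obtain ⟨C, hC, hCu⟩ := exists_rpow_mul_exp_neg_rpow_le hβ (a - 1 + 2)
    (by positivity : 0 < s₀ * κ) hc₀
  refine ⟨Real.exp (c₁ * T) * C * (min (c₀ ^ 2) 1)⁻¹, by positivity, fun c s t y h1 h2 h3 h4 => ?_⟩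
  rw [norm_wrightLine]
  set u := ‖(c + y * Complex.I : ℂ)‖ with hu
  have hcu : c₀ ≤ u := h1.trans (le_norm_sigma y)
  have hu0 : 0 < u := hc₀.trans_le hcu
  have hre := re_cpow_ge hβ hβ1 (σ := c + y * Complex.I)
    (by rw [sigma_re]; exact (hc₀.trans_le h1).le)
  rw [← hu, ← hκ] at hre
  have hT : 0 ≤ T := (abs_nonneg t).trans h4
  have hct : c * t ≤ c₁ * T := by
    calc c * t ≤ c * |t| := by
          have := hc₀.trans_le h1
          gcongr; exact le_abs_self t
      _ ≤ c₁ * T := by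
        have := (hc₀.trans_le h1).trans_le h2
        gcongr
  have hsre : s₀ * κ * u ^ β ≤ s * ((c + y * Complex.I : ℂ) ^ (β : ℂ)).re := by
    have hs : 0 ≤ s := hs₀.le.trans h3
    rw [mul_assoc]; gcongr
  calc Real.exp (c * t - s * ((c + y * Complex.I : ℂ) ^ (β : ℂ)).re) * u ^ (a - 1)
      ≤ Real.exp (c₁ * T + -(s₀ * κ * u ^ β)) * u ^ (a - 1) := by gcongr; linarith
    _ = Real.exp (c₁ * T) * (u ^ (a - 1 + 2) * Real.exp (-(s₀ * κ * u ^ β))) * (u ^ 2)⁻¹ := by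
      rw [Real.exp_add, Real.rpow_add hu0, Real.rpow_two]; field_simp
    _ ≤ Real.exp (c₁ * T) * C * ((min (c₀ ^ 2) 1)⁻¹ * (1 + y ^ 2)⁻¹) := by
      gcongr
      · exact hCu u hcu
      · exact inv_norm_sigma_sq_le hc₀ h1 y
    _ = _ := by ring

theorem continuousAt_wrightLine_comp {X : Type*} [TopologicalSpace X] (β a : ℝ)
    {c s t y : X → ℝ} {x : X} (hc0 : 0 < c x) (hc : ContinuousAt c x) (hs : ContinuousAt s x)
    (ht : ContinuousAt t x) (hy : ContinuousAt y x) :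
    ContinuousAt (fun x => wrightLine β a (c x) (s x) (t x) (y x)) x := by
  have hσ : ContinuousAt (fun x => (c x + y x * Complex.I : ℂ)) x := by fun_prop
  have hsl := sigma_mem_slitPlane hc0 (y x)
  have h1 := hσ.cpow (continuousAt_const (y := (β : ℂ))) hsl
  have h2 := hσ.cpow (continuousAt_const (y := ((a - 1 : ℝ) : ℂ))) hsl
  unfold wrightLine
  fun_prop

theorem continuous_wrightLine (β a s t : ℝ) {c : ℝ} (hc : 0 < c) :
    Continuous fun y => wrightLine β a c s t y :=
  continuous_iff_continuousAt.2 fun _ => continuousAt_wrightLine_comp β a hc continuousAt_const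
    continuousAt_const continuousAt_const continuousAt_id

theorem integrable_wrightLine {β : ℝ} (hβ : 0 < β) (hβ1 : β < 1) (a t : ℝ) {c s : ℝ} (hc : 0 < c)
    (hs : 0 < s) : Integrable fun y => wrightLine β a c s t y := by
  obtain ⟨C, _, hC⟩ := exists_norm_wrightLine_le hβ hβ1 a c |t| hs hc
  exact (integrable_inv_one_add_sq.const_mul C).mono'
    (continuous_wrightLine β a s t hc).aestronglyMeasurable
    (.of_forall fun y => hC c s t y le_rfl le_rfl le_rfl le_rfl)

theorem wrightLine_mul_cpow (β a s t b : ℝ) {c : ℝ} (hc : 0 < c) (y : ℝ) :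
    (c + y * Complex.I : ℂ) ^ (b : ℂ) * wrightLine β a c s t y = wrightLine β (a + b) c s t y := by
  rw [wrightLine, wrightLine, mul_left_comm, ← Complex.cpow_add _ _ (sigma_ne_zero hc y)]
  congr 2; push_cast; ring

theorem wrightLine_mul_sigma (β a s t : ℝ) {c : ℝ} (hc : 0 < c) (y : ℝ) :
    (c + y * Complex.I : ℂ) * wrightLine β a c s t y = wrightLine β (a + 1) c s t y := by
  rw [← wrightLine_mul_cpow β a s t 1 hc y]; simp

/-- The complex Bromwich integral `(2 π i)⁻¹ ∫ exp (σ t - s σ ^ β) σ ^ (a - 1) dσ` on `Re σ = c`. -/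
def wrightBromwich (β a c s t : ℝ) : ℂ := (2 * Real.pi : ℂ)⁻¹ * ∫ y, wrightLine β a c s t y

/-- Differentiation in t inserts σ, which raises the index by 1; differentiation in s, likewise,
inserts −σ^β. -/
theorem hasDerivAt_wrightBromwich_time {β : ℝ} (hβ : 0 < β) (hβ1 : β < 1) (a t : ℝ) {c s : ℝ}
    (hc : 0 < c) (hs : 0 < s) :
    HasDerivAt (fun t => wrightBromwich β a c s t) (wrightBromwich β (a + 1) c s t) t := by
  obtain ⟨C, _, hC⟩ := exists_norm_wrightLine_le hβ hβ1 (a + 1) c (|t| + 1) hs hc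
  refine HasDerivAt.const_mul _ (hasDerivAt_integral_of_dominated_loc_of_deriv_le
    (F' := fun t y => wrightLine β (a + 1) c s t y) (s := Metric.ball t 1)
    (bound := fun y => C * (1 + y ^ 2)⁻¹) (Metric.ball_mem_nhds _ one_pos)
    (.of_forall fun t => (continuous_wrightLine β a s t hc).aestronglyMeasurable)
    (integrable_wrightLine hβ hβ1 a t hc hs)
    (continuous_wrightLine β (a + 1) s t hc).aestronglyMeasurable ?_
    (integrable_inv_one_add_sq.const_mul C) ?_).2
  · refine .of_forall fun y t' ht' => hC c s t' y le_rfl le_rfl le_rfl ?_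
    rw [Metric.mem_ball, Real.dist_eq] at ht'
    have := abs_sub_abs_le_abs_sub t' t; linarith
  · refine .of_forall fun y t' _ => ?_
    have h1 : HasDerivAt (fun t : ℝ => (c + y * Complex.I : ℂ) * t -
        s * (c + y * Complex.I : ℂ) ^ (β : ℂ)) (c + y * Complex.I) t' := by
      simpa using ((Complex.ofRealCLM.hasDerivAt (x := t')).const_mul
        (c + y * Complex.I : ℂ)).sub_const (s * (c + y * Complex.I : ℂ) ^ (β : ℂ))
    refine (h1.cexp.mul_const ((c + y * Complex.I : ℂ) ^ ((a - 1 : ℝ) : ℂ))).congr_deriv ?_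
    rw [← wrightLine_mul_sigma β a s t' hc y, wrightLine]; ring

theorem hasDerivAt_wrightBromwich_space {β : ℝ} (hβ : 0 < β) (hβ1 : β < 1) (a t : ℝ) {c s : ℝ}
    (hc : 0 < c) (hs : 0 < s) :
    HasDerivAt (fun s => wrightBromwich β a c s t) (-wrightBromwich β (a + β) c s t) s := by
  obtain ⟨C, _, hC⟩ := exists_norm_wrightLine_le hβ hβ1 (a + β) c |t| (half_pos hs) hc
  rw [wrightBromwich, ← mul_neg, ← integral_neg]
  refine HasDerivAt.const_mul _ (hasDerivAt_integral_of_dominated_loc_of_deriv_le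
    (F' := fun s y => -wrightLine β (a + β) c s t y) (s := Metric.ball s (s / 2))
    (bound := fun y => C * (1 + y ^ 2)⁻¹) (Metric.ball_mem_nhds _ (half_pos hs))
    (.of_forall fun s => (continuous_wrightLine β a s t hc).aestronglyMeasurable)
    (integrable_wrightLine hβ hβ1 a t hc hs)
    (continuous_wrightLine β (a + β) s t hc).aestronglyMeasurable.neg ?_
    (integrable_inv_one_add_sq.const_mul C) ?_).2
  · refine .of_forall fun y s' hs' => ?_
    rw [norm_neg]
    refine hC c s' t y le_rfl le_rfl ?_ le_rfl
    rw [Metric.mem_ball, Real.dist_eq, abs_lt] at hs'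
    linarith [hs'.1]
  · refine .of_forall fun y s' _ => ?_
    have h1 : HasDerivAt (fun s : ℝ => (c + y * Complex.I : ℂ) * t -
        s * (c + y * Complex.I : ℂ) ^ (β : ℂ)) (-(c + y * Complex.I : ℂ) ^ (β : ℂ)) s' := by
      simpa using ((Complex.ofRealCLM.hasDerivAt (x := s')).mul_const
        ((c + y * Complex.I : ℂ) ^ (β : ℂ))).const_sub ((c + y * Complex.I : ℂ) * t)
    refine (h1.cexp.mul_const ((c + y * Complex.I : ℂ) ^ ((a - 1 : ℝ) : ℂ))).congr_deriv ?_
    rw [← wrightLine_mul_cpow β a s' t β hc y, wrightLine]; ring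

/-- The derivative of the Bromwich integrand along the complex variable. -/
def wrightLineDeriv (β a c s t y : ℝ) : ℂ :=
  t * wrightLine β a c s t y - s * β * wrightLine β (a + β - 1) c s t y +
    (a - 1) * wrightLine β (a - 1) c s t y

theorem integrable_wrightLineDeriv {β : ℝ} (hβ : 0 < β) (hβ1 : β < 1) (a t : ℝ) {c s : ℝ}
    (hc : 0 < c) (hs : 0 < s) : Integrable fun y => wrightLineDeriv β a c s t y :=
  (((integrable_wrightLine hβ hβ1 a t hc hs).const_mul _).sub
    ((integrable_wrightLine hβ hβ1 (a + β - 1) t hc hs).const_mul _)).add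
    ((integrable_wrightLine hβ hβ1 (a - 1) t hc hs).const_mul _)

theorem hasDerivAt_wrightIntegrand (β a s t : ℝ) {c : ℝ} (hc : 0 < c) (y : ℝ) :
    HasDerivAt (fun σ : ℂ => Complex.exp (σ * t - s * σ ^ (β : ℂ)) * σ ^ ((a - 1 : ℝ) : ℂ))
      (wrightLineDeriv β a c s t y) (c + y * Complex.I) := by
  have hsl := sigma_mem_slitPlane hc y
  have d1 := (hasDerivAt_id (c + y * Complex.I : ℂ)).cpow_const (c := (β : ℂ)) hsl
  have d2 := (hasDerivAt_id (c + y * Complex.I : ℂ)).cpow_const (c := ((a - 1 : ℝ) : ℂ)) hsl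
  have d3 := ((hasDerivAt_id (c + y * Complex.I : ℂ)).mul_const (t : ℂ)).sub (d1.const_mul (s : ℂ))
  refine (d3.cexp.mul d2).congr_deriv ?_
  have e1 : wrightLine β (a + β - 1) c s t y = (c + y * Complex.I : ℂ) ^ ((β - 1 : ℝ) : ℂ) *
      wrightLine β a c s t y := by
    rw [wrightLine_mul_cpow β a s t _ hc]; congr 1; ring
  have e2 : wrightLine β (a - 1) c s t y =
      Complex.exp ((c + y * Complex.I) * t - s * (c + y * Complex.I) ^ (β : ℂ)) *
      (c + y * Complex.I : ℂ) ^ (((a - 1 : ℝ) : ℂ) - 1) := by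
    rw [wrightLine]; congr 2; push_cast; ring
  rw [wrightLineDeriv, e1, e2, wrightLine]
  simp only [id, Pi.sub_apply]
  push_cast
  ring

theorem integral_wrightLineDeriv {β : ℝ} (hβ : 0 < β) (hβ1 : β < 1) (a t : ℝ) {c s : ℝ}
    (hc : 0 < c) (hs : 0 < s) : ∫ y, wrightLineDeriv β a c s t y = 0 := by
  have h : ∀ y : ℝ, HasDerivAt (fun y => wrightLine β a c s t y)
      (Complex.I * wrightLineDeriv β a c s t y) y := by
    intro y
    have h2 : HasDerivAt (fun y : ℝ => (c + y * Complex.I : ℂ)) Complex.I y := by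
      simpa using ((Complex.ofRealCLM.hasDerivAt (x := y)).mul_const Complex.I).const_add (c : ℂ)
    exact ((hasDerivAt_wrightIntegrand β a s t hc y).comp y h2).congr_deriv (mul_comm _ _)
  have := integral_eq_zero_of_hasDerivAt_of_integrable h
    ((integrable_wrightLineDeriv hβ hβ1 a t hc hs).const_mul _)
    (integrable_wrightLine hβ hβ1 a t hc hs)
  rw [integral_const_mul] at this
  exact (mul_eq_zero.1 this).resolve_left Complex.I_ne_zero

/-- The integral of the σ-derivative of the integrand vanishes. The relation is needed at a = 0,
where it passes to negative indices whose integrals converge absolutely even at s = 0. -/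
theorem wrightBromwich_relation {β : ℝ} (hβ : 0 < β) (hβ1 : β < 1) (a t : ℝ) {c s : ℝ}
    (hc : 0 < c) (hs : 0 < s) :
    t * wrightBromwich β a c s t = s * β * wrightBromwich β (a + β - 1) c s t -
      (a - 1) * wrightBromwich β (a - 1) c s t := by
  have h := integral_wrightLineDeriv hβ hβ1 a t hc hs
  have i1 := (integrable_wrightLine hβ hβ1 a t hc hs).const_mul (t : ℂ)
  have i2 := (integrable_wrightLine hβ hβ1 (a + β - 1) t hc hs).const_mul (s * β : ℂ)
  have i3 := (integrable_wrightLine hβ hβ1 (a - 1) t hc hs).const_mul (a - 1 : ℂ)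
  have e := (integral_add (i1.sub i2) i3).trans (congrArg (· + _) (integral_sub i1 i2))
  have h2 := e.symm.trans h
  simp only [integral_const_mul] at h2
  rw [wrightBromwich, wrightBromwich, wrightBromwich]
  linear_combination (2 * Real.pi : ℂ)⁻¹ * h2

/-- Independence of the line without contours: by holomorphy the derivative in c is the integral of
the σ-derivative along the line, which is zero. -/
theorem wrightBromwich_eq_of_pos {β : ℝ} (hβ : 0 < β) (hβ1 : β < 1) (a t : ℝ) {c c' s : ℝ}
    (hc : 0 < c) (hc' : 0 < c') (hs : 0 < s) :
    wrightBromwich β a c s t = wrightBromwich β a c' s t := by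
  have hd : ∀ c ∈ Ioi (0 : ℝ), HasDerivAt (fun c => wrightBromwich β a c s t) 0 c := by
    intro c (hc : 0 < c)
    obtain ⟨C₁, _, hC₁⟩ := exists_norm_wrightLine_le hβ hβ1 a (c + c / 2) |t| hs (half_pos hc)
    obtain ⟨C₂, _, hC₂⟩ :=
      exists_norm_wrightLine_le hβ hβ1 (a + β - 1) (c + c / 2) |t| hs (half_pos hc)
    obtain ⟨C₃, _, hC₃⟩ :=
      exists_norm_wrightLine_le hβ hβ1 (a - 1) (c + c / 2) |t| hs (half_pos hc)
    have hball : ∀ c' ∈ Metric.ball c (c / 2), c / 2 ≤ c' ∧ c' ≤ c + c / 2 := by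
      intro c' h
      rw [Metric.mem_ball, Real.dist_eq, abs_lt] at h
      exact ⟨by linarith [h.1], by linarith [h.2]⟩
    have key := (hasDerivAt_integral_of_dominated_loc_of_deriv_le (𝕜 := ℝ) (μ := volume)
      (F := fun c y => wrightLine β a c s t y) (x₀ := c)
      (F' := fun c y => wrightLineDeriv β a c s t y) (s := Metric.ball c (c / 2))
      (bound := fun y => (|t| * C₁ + |s| * |β| * C₂ + ‖(a - 1 : ℂ)‖ * C₃) * (1 + y ^ 2)⁻¹)
      (Metric.ball_mem_nhds _ (half_pos hc))
      (by
        filter_upwards [Metric.ball_mem_nhds c (half_pos hc)] with c' hc'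
        exact (continuous_wrightLine β a s t
          ((half_pos hc).trans_le (hball c' hc').1)).aestronglyMeasurable)
      (integrable_wrightLine hβ hβ1 a t hc hs)
      (integrable_wrightLineDeriv hβ hβ1 a t hc hs).aestronglyMeasurable ?_
      (integrable_inv_one_add_sq.const_mul _) ?_).2
    · rw [integral_wrightLineDeriv hβ hβ1 a t hc hs] at key
      exact (key.const_mul (2 * Real.pi : ℂ)⁻¹).congr_deriv (mul_zero _)
    · refine .of_forall fun y c' hc' => ?_
      obtain ⟨h1, h2⟩ := hball c' hc'
      have b1 := hC₁ c' s t y h1 h2 le_rfl le_rfl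
      have b2 := hC₂ c' s t y h1 h2 le_rfl le_rfl
      have b3 := hC₃ c' s t y h1 h2 le_rfl le_rfl
      rw [wrightLineDeriv]
      refine (norm_add_le _ _).trans ((add_le_add (norm_sub_le _ _) le_rfl).trans ?_)
      rw [norm_mul, norm_mul, norm_mul, norm_mul, Complex.norm_real, Complex.norm_real,
        Complex.norm_real, Real.norm_eq_abs, Real.norm_eq_abs, Real.norm_eq_abs]
      calc _ ≤ |t| * (C₁ * (1 + y ^ 2)⁻¹) + |s| * |β| * (C₂ * (1 + y ^ 2)⁻¹) +
            ‖(a - 1 : ℂ)‖ * (C₃ * (1 + y ^ 2)⁻¹) := by gcongr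
        _ = _ := by ring
    · refine .of_forall fun y c' hc' => ?_
      have h2 : HasDerivAt (fun c : ℝ => (c + y * Complex.I : ℂ)) 1 c' := by
        simpa using (Complex.ofRealCLM.hasDerivAt (x := c')).add_const (y * Complex.I : ℂ)
      exact ((hasDerivAt_wrightIntegrand β a s t
        ((half_pos hc).trans_le (hball c' hc').1) y).comp c' h2).congr_deriv (mul_one _)
  exact isOpen_Ioi.is_const_of_deriv_eq_zero isPreconnected_Ioi
    (fun c hc => (hd c hc).differentiableAt.differentiableWithinAt) (fun c hc => (hd c hc).deriv)
    hc hc'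

end

end FracPDE

/-! ### Scaling, vanishing for t ≤ 0, and fractional integration of the Wright-type kernels -/

namespace FracPDE

open Set Filter Topology MeasureTheory

noncomputable section

theorem cpow_ofReal_mul {r : ℝ} (hr : 0 < r) {w : ℂ} (hw : w ≠ 0) (b : ℝ) :
    ((r : ℂ) * w) ^ (b : ℂ) = ((r ^ b : ℝ) : ℂ) * w ^ (b : ℂ) := by
  have hr' : (r : ℂ) ≠ 0 := by exact_mod_cast hr.ne'
  rw [Complex.cpow_def_of_ne_zero (mul_ne_zero hr' hw), Complex.log_ofReal_mul hr hw, add_mul,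
    Complex.exp_add, Complex.cpow_def_of_ne_zero hw, Real.rpow_def_of_pos hr]
  push_cast
  rfl

/-- The Wright-type kernel `(2 π i)⁻¹ ∫ exp (σ t - s σ ^ β) σ ^ (a - 1) dσ`. For `a = β` and
`s, t > 0` it is `wrightDensity β s t`. -/
def wrightG (β a s t : ℝ) : ℝ := (wrightBromwich β a 1 s t).re

theorem hasDerivAt_wrightG_time {β : ℝ} (hβ : 0 < β) (hβ1 : β < 1) (a t : ℝ) {s : ℝ}
    (hs : 0 < s) : HasDerivAt (fun t => wrightG β a s t) (wrightG β (a + 1) s t) t :=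
  Complex.reCLM.hasFDerivAt.comp_hasDerivAt t (hasDerivAt_wrightBromwich_time hβ hβ1 a t one_pos hs)

theorem hasDerivAt_wrightG_space {β : ℝ} (hβ : 0 < β) (hβ1 : β < 1) (a t : ℝ) {s : ℝ}
    (hs : 0 < s) : HasDerivAt (fun s => wrightG β a s t) (-wrightG β (a + β) s t) s := by
  have := Complex.reCLM.hasFDerivAt.comp_hasDerivAt s
    (hasDerivAt_wrightBromwich_space hβ hβ1 a t one_pos hs)
  exact this.congr_deriv (by simp [wrightG])

theorem wrightG_relation {β : ℝ} (hβ : 0 < β) (hβ1 : β < 1) (a t : ℝ) {s : ℝ} (hs : 0 < s) :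
    t * wrightG β a s t = s * β * wrightG β (a + β - 1) s t - (a - 1) * wrightG β (a - 1) s t := by
  have := congrArg Complex.re (wrightBromwich_relation hβ hβ1 a t one_pos hs)
  simpa [wrightG] using this

theorem continuousOn_wrightG {β : ℝ} (hβ : 0 < β) (hβ1 : β < 1) (a : ℝ) :
    ContinuousOn (fun x : ℝ × ℝ => wrightG β a x.1 x.2) (Ioi 0 ×ˢ univ) := by
  rintro ⟨s, t⟩ ⟨hs, -⟩
  have hs : 0 < s := hs
  refine ContinuousAt.continuousWithinAt ?_
  obtain ⟨C, _, hC⟩ := exists_norm_wrightLine_le hβ hβ1 a 1 (|t| + 1) (half_pos hs) one_pos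
  have hnhds : ∀ᶠ x : ℝ × ℝ in 𝓝 (s, t), s / 2 ≤ x.1 ∧ |x.2| ≤ |t| + 1 := by
    refine (((continuous_fst.tendsto (s, t)).eventually (lt_mem_nhds (half_lt_self hs))).and
      ((continuous_snd.abs.tendsto (s, t)).eventually
        (gt_mem_nhds (lt_add_one |t|)))).mono fun x hx => ⟨hx.1.le, hx.2.le⟩
  have key : ContinuousAt (fun x : ℝ × ℝ => ∫ y, wrightLine β a 1 x.1 x.2 y) (s, t) := by
    refine continuousAt_of_dominated (bound := fun y => C * (1 + y ^ 2)⁻¹)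
      (.of_forall fun x => (continuous_wrightLine β a x.1 x.2 one_pos).aestronglyMeasurable)
      ?_ (integrable_inv_one_add_sq.const_mul C) (.of_forall fun y => ?_)
    · filter_upwards [hnhds] with x hx
      exact .of_forall fun y => hC 1 x.1 x.2 y le_rfl le_rfl hx.1 hx.2
    · exact continuousAt_wrightLine_comp β a one_pos continuousAt_const continuous_fst.continuousAt
        continuous_snd.continuousAt continuousAt_const
  exact Complex.continuous_re.continuousAt.comp (continuousAt_const.mul key)

theorem wrightLine_scale (β a s : ℝ) {t : ℝ} (ht : 0 < t) (y : ℝ) :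
    wrightLine β a t⁻¹ s t (y / t) =
      ((t ^ (1 - a) : ℝ) : ℂ) * wrightLine β a 1 (s * t ^ (-β)) 1 y := by
  have e : ((t⁻¹ : ℝ) + (y / t : ℝ) * Complex.I : ℂ) =
      ((t⁻¹ : ℝ) : ℂ) * ((1 : ℝ) + y * Complex.I) := by
    push_cast; ring
  have hne := sigma_ne_zero one_pos y
  have ht' : (t : ℂ) ≠ 0 := by exact_mod_cast ht.ne'
  have p1 : t⁻¹ ^ β = t ^ (-β) := by rw [Real.inv_rpow ht.le, Real.rpow_neg ht.le]
  have p2 : t⁻¹ ^ (a - 1) = t ^ (1 - a) := by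
    rw [Real.inv_rpow ht.le, ← Real.rpow_neg ht.le]; congr 1; ring
  rw [wrightLine, wrightLine, e, cpow_ofReal_mul (inv_pos.2 ht) hne,
    cpow_ofReal_mul (inv_pos.2 ht) hne, p1, p2, mul_left_comm]
  congr 3
  push_cast
  field_simp

/-- The substitution σ ↦ σ/t maps the line Re σ = 1 to Re σ = 1/t, and the integral does not depend
on the line. -/
theorem wrightG_scale {β : ℝ} (hβ : 0 < β) (hβ1 : β < 1) (a : ℝ) {s t : ℝ} (hs : 0 < s)
    (ht : 0 < t) : wrightG β a s t = t ^ (-a) * wrightG β a (s * t ^ (-β)) 1 := by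
  have h1 : ∫ y, wrightLine β a t⁻¹ s t y =
      ((t ^ (-a) : ℝ) : ℂ) * ∫ y, wrightLine β a 1 (s * t ^ (-β)) 1 y := by
    have h := Measure.integral_comp_div (fun y => wrightLine β a t⁻¹ s t y) t
    simp_rw [wrightLine_scale β a s ht, integral_const_mul] at h
    rw [abs_of_pos ht, Complex.real_smul] at h
    have ht' : (t : ℂ) ≠ 0 := by exact_mod_cast ht.ne'
    have e : t ^ (1 - a) = t * t ^ (-a) := by
      rw [sub_eq_add_neg, Real.rpow_add ht, Real.rpow_one]
    rw [e] at h
    push_cast at h ⊢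
    rw [mul_assoc] at h
    exact (mul_left_cancel₀ ht' h).symm
  rw [wrightG, wrightG, wrightBromwich_eq_of_pos hβ hβ1 a t one_pos (inv_pos.2 ht) hs,
    wrightBromwich, wrightBromwich, h1, mul_left_comm, Complex.re_ofReal_mul]

/-- For t ≤ 0 the factor exp(σt) is bounded by 1 in the right half-plane, so moving the line to
infinity makes the integral O(1/c). -/
theorem wrightG_eq_zero_of_nonpos {β : ℝ} (hβ : 0 < β) (hβ1 : β < 1) (a : ℝ) {s t : ℝ}
    (hs : 0 < s) (ht : t ≤ 0) : wrightG β a s t = 0 := by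
  set κ := Real.cos (Real.pi / 2 * β) with hκ
  have hκ0 : 0 < κ := cos_half_pi_mul_pos hβ hβ1
  -- Three powers: two for integrability along the line, one for the factor 1/c.
  obtain ⟨C, hC, hCu⟩ := exists_rpow_mul_exp_neg_rpow_le hβ (a - 1 + 3)
    (by positivity : 0 < s * κ) one_pos
  have hb : ∀ c : ℝ, 1 ≤ c → ∀ y, ‖wrightLine β a c s t y‖ ≤ C / c * (1 + y ^ 2)⁻¹ := by
    intro c hc y
    rw [norm_wrightLine]
    set u := ‖(c + y * Complex.I : ℂ)‖ with hu
    have hcu : c ≤ u := le_norm_sigma y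
    have hu0 : 0 < u := by linarith
    have hre := re_cpow_ge hβ hβ1 (σ := c + y * Complex.I) (by rw [sigma_re]; linarith)
    rw [← hu, ← hκ] at hre
    have h2 : (u ^ 2)⁻¹ ≤ (1 + y ^ 2)⁻¹ := by
      have := inv_norm_sigma_sq_le one_pos hc y
      simpa using this
    have hct : c * t ≤ 0 := by nlinarith
    calc Real.exp (c * t - s * ((c + y * Complex.I : ℂ) ^ (β : ℂ)).re) * u ^ (a - 1)
        ≤ Real.exp (-(s * κ * u ^ β)) * u ^ (a - 1) := by
          gcongr
          have : s * (κ * u ^ β) ≤ s * ((c + y * Complex.I : ℂ) ^ (β : ℂ)).re := by gcongr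
          linarith
      _ = (u ^ (a - 1 + 3) * Real.exp (-(s * κ * u ^ β))) / u * (u ^ 2)⁻¹ := by
        rw [Real.rpow_add hu0, show (3 : ℝ) = ((3 : ℕ) : ℝ) by norm_num, Real.rpow_natCast]
        field_simp
      _ ≤ C / c * (1 + y ^ 2)⁻¹ := by
        gcongr
        exact hCu u (hc.trans hcu)
  have hint : ∀ c : ℝ, 1 ≤ c → ‖wrightBromwich β a 1 s t‖ ≤
      ‖(2 * Real.pi : ℂ)⁻¹‖ * (C * ∫ y : ℝ, (1 + y ^ 2)⁻¹) / c := by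
    intro c hc
    rw [wrightBromwich_eq_of_pos hβ hβ1 a t one_pos (by linarith : 0 < c) hs, wrightBromwich,
      norm_mul, mul_div_assoc]
    gcongr
    refine (norm_integral_le_of_norm_le (integrable_inv_one_add_sq.const_mul (C / c))
      (.of_forall (hb c hc))).trans (le_of_eq ?_)
    rw [integral_const_mul]; ring
  have hlim : Tendsto (fun c : ℝ => ‖(2 * Real.pi : ℂ)⁻¹‖ * (C * ∫ y : ℝ, (1 + y ^ 2)⁻¹) / c)
      atTop (𝓝 0) := tendsto_const_nhds.div_atTop tendsto_id
  have h0 : ‖wrightBromwich β a 1 s t‖ ≤ 0 := by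
    refine ge_of_tendsto hlim ?_
    filter_upwards [eventually_ge_atTop 1] with c hc using hint c hc
  rw [wrightG, norm_le_zero_iff.1 h0, Complex.zero_re]

theorem integrableOn_rpow_mul_exp_neg {α c : ℝ} (hα : 0 < α) (hc : 0 < c) :
    IntegrableOn (fun v : ℝ => v ^ (α - 1) * Real.exp (-(c * v))) (Ioi 0) := by
  have := integrableOn_rpow_mul_exp_neg_mul_rpow (p := 1) (s := α - 1) (by linarith) one_pos hc
  simpa only [Real.rpow_one, neg_mul] using this

/-- The Gamma integral with a complex parameter in the exponential. -/
theorem integral_rpow_mul_cexp_neg_mul {α : ℝ} (hα : 0 < α) {z : ℂ} (hz : 0 < z.re) :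
    ∫ v in Ioi (0 : ℝ), Complex.exp (-(z * v)) * ((v ^ (α - 1) : ℝ) : ℂ) =
      Real.Gamma α * z ^ ((-α : ℝ) : ℂ) := by
  set U : Set ℂ := {z : ℂ | 0 < z.re} with hU
  have hUo : IsOpen U := isOpen_lt continuous_const Complex.continuous_re
  have h1 : DifferentiableOn ℂ (laplaceHalf fun v => v ^ (α - 1)) U :=
    differentiableOn_laplaceHalf fun ε hε => by
      simpa only [mul_comm] using integrableOn_rpow_mul_exp_neg hα hε
  have h2 : DifferentiableOn ℂ (fun z : ℂ => Real.Gamma α * z ^ ((-α : ℝ) : ℂ)) U := fun z hz =>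
    ((differentiableAt_id.cpow_const (Or.inl hz)).const_mul _).differentiableWithinAt
  have hreal : ∀ x : ℝ, 0 < x → laplaceHalf (fun v => v ^ (α - 1)) x =
      Real.Gamma α * (x : ℂ) ^ ((-α : ℝ) : ℂ) := by
    intro x hx
    have h := Complex.integral_cpow_mul_exp_neg_mul_Ioi (a := α) (by simpa using hα) hx
    have harg : (x : ℂ).arg ≠ Real.pi := by
      rw [Complex.arg_ofReal_of_nonneg hx.le]; exact Real.pi_pos.ne
    rw [one_div, Complex.inv_cpow _ _ harg, ← Complex.cpow_neg, Complex.Gamma_ofReal, mul_comm] at h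
    rw [Complex.ofReal_neg, ← h, laplaceHalf]
    refine setIntegral_congr_fun measurableSet_Ioi fun v (hv : 0 < v) => ?_
    rw [Complex.ofReal_cpow hv.le]
    push_cast
    ring
  -- Both sides are analytic in the right half-plane and agree on the positive reals, which
  -- accumulate at 1.
  refine (h1.analyticOnNhd hUo).eqOn_of_preconnected_of_frequently_eq (h2.analyticOnNhd hUo)
    (convex_halfSpace_re_gt 0).isPreconnected (show (1 : ℂ) ∈ U by simp [hU]) ?_ hz
  have ht : Tendsto (fun x : ℝ => (x : ℂ)) (𝓝[≠] 1) (𝓝[≠] 1) := by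
    refine tendsto_nhdsWithin_iff.2 ⟨?_, ?_⟩
    · exact (Complex.continuous_ofReal.tendsto' 1 1 (by simp)).mono_left nhdsWithin_le_nhds
    · filter_upwards [self_mem_nhdsWithin] with x hx
      exact fun h => hx (by simpa using h)
  refine ht.frequently (Eventually.frequently ?_)
  filter_upwards [nhdsWithin_le_nhds (lt_mem_nhds one_pos)] with x hx using hreal x hx

/-- By Fubini the inner integral is a Gamma integral equal to Γ(α) σ^{−α}, which lowers the index by
α. On Re σ = 1 the factor exp(−v) makes the half-line integral absolutely convergent. -/
theorem integral_rpow_mul_wrightG {β : ℝ} (hβ : 0 < β) (hβ1 : β < 1) (a t : ℝ) {α s : ℝ}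
    (hα : 0 < α) (hs : 0 < s) :
    ∫ v in Ioi (0 : ℝ), v ^ (α - 1) * wrightG β a s (t - v) =
      Real.Gamma α * wrightG β (a - α) s t := by
  have e : ∀ v y : ℝ, wrightLine β a 1 s (t - v) y =
      Complex.exp (-((1 : ℝ) + y * Complex.I) * v) * wrightLine β a 1 s t y := by
    intro v y
    rw [wrightLine, wrightLine, ← mul_assoc, ← Complex.exp_add]
    congr 2; push_cast; ring
  set Φ : ℝ → ℝ → ℂ := fun v y => ((v ^ (α - 1) : ℝ) : ℂ) * wrightLine β a 1 s (t - v) y with hΦ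
  have hprod := (integrableOn_rpow_mul_exp_neg hα one_pos).norm.mul_prod
    (integrable_wrightLine hβ hβ1 a t one_pos hs).norm
  have hi : Integrable (Function.uncurry Φ) ((volume.restrict (Ioi 0)).prod volume) := by
    refine hprod.mono' ?_ (.of_forall fun x => ?_)
    · have h1 : Measurable fun x : ℝ × ℝ => ((x.1 ^ (α - 1) : ℝ) : ℂ) := by fun_prop
      have h2 : Continuous fun x : ℝ × ℝ => wrightLine β a 1 s (t - x.1) x.2 :=
        continuous_iff_continuousAt.2 fun x => continuousAt_wrightLine_comp β a one_pos
          continuousAt_const continuousAt_const (by fun_prop) (by fun_prop)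
      exact h1.aestronglyMeasurable.mul h2.aestronglyMeasurable
    · simp only [Function.uncurry, hΦ]
      rw [e, norm_mul, norm_mul, norm_mul, Complex.norm_exp, Complex.norm_real, ← mul_assoc]
      simp
  have hsw := integral_integral_swap hi
  have hL : ∀ v : ℝ, ∫ y, Φ v y = ((v ^ (α - 1) : ℝ) : ℂ) * ∫ y, wrightLine β a 1 s (t - v) y :=
    fun v => integral_const_mul _ _
  have hR : ∀ y : ℝ, ∫ v in Ioi (0 : ℝ), Φ v y =
      Complex.Gamma α * wrightLine β (a - α) 1 s t y := by
    intro y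
    have hσ : 0 < ((1 : ℝ) + y * Complex.I : ℂ).re := by simp
    have h := integral_rpow_mul_cexp_neg_mul hα hσ
    have h2 := wrightLine_mul_cpow β a s t (-α) one_pos y
    rw [← sub_eq_add_neg] at h2
    rw [← h2, ← mul_assoc, Complex.Gamma_ofReal, ← h, ← integral_mul_const]
    refine setIntegral_congr_fun measurableSet_Ioi fun v (hv : 0 < v) => ?_
    simp only [hΦ]
    rw [e]
    ring_nf
  simp_rw [hL, hR, integral_const_mul] at hsw
  have h3 : ∫ v in Ioi (0 : ℝ), ((v ^ (α - 1) : ℝ) : ℂ) * wrightBromwich β a 1 s (t - v) =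
      Complex.Gamma α * wrightBromwich β (a - α) 1 s t := by
    simp_rw [wrightBromwich, mul_left_comm _ (2 * Real.pi : ℂ)⁻¹, integral_const_mul, hsw]
  have hint : IntegrableOn (fun v : ℝ => ((v ^ (α - 1) : ℝ) : ℂ) * wrightBromwich β a 1 s (t - v))
      (Ioi 0) := by
    have := hi.integral_prod_left.const_mul (2 * Real.pi : ℂ)⁻¹
    refine this.congr (.of_forall fun v => ?_)
    simp only [Function.uncurry, wrightBromwich]
    rw [hL]; ring
  have h4 := congrArg Complex.re h3
  have h5 := integral_re (𝕜 := ℂ) hint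
  simp only [RCLike.re_to_complex] at h5
  rw [← h5, Complex.Gamma_ofReal, Complex.re_ofReal_mul] at h4
  rw [wrightG, ← h4]
  congr 1; funext v
  rw [Complex.re_ofReal_mul, wrightG]

/-- The half-line convolution is the Riemann–Liouville integral over (0, t), since the kernel
vanishes at nonpositive times. -/
theorem setIntegral_Ioo_rpow_mul_wrightG {β : ℝ} (hβ : 0 < β) (hβ1 : β < 1) (a : ℝ) {α s t : ℝ}
    (hα : 0 < α) (hs : 0 < s) (ht : 0 < t) :
    ∫ τ in Ioo (0 : ℝ) t, (t - τ) ^ (α - 1) * wrightG β a s τ =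
      Real.Gamma α * wrightG β (a - α) s t := by
  rw [← integral_rpow_mul_wrightG hβ hβ1 a t hα hs, ← integral_Ioc_eq_integral_Ioo,
    ← intervalIntegral.integral_of_le ht.le]
  have h := intervalIntegral.integral_comp_sub_left (a := 0) (b := t)
    (fun τ => (t - τ) ^ (α - 1) * wrightG β a s τ) t
  simp only [sub_sub_cancel, sub_zero, sub_self] at h
  rw [← h, intervalIntegral.integral_of_le ht.le, ← Ioc_union_Ioi_eq_Ioi ht.le]
  symm
  rw [Ioc_union_Ioi_eq_Ioi ht.le]
  refine setIntegral_eq_of_subset_of_forall_sdiff_eq_zero measurableSet_Ioi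
    (fun v hv => hv.1) fun v hv => ?_
  have h1 : 0 < v := hv.1
  have h2 : t ≤ v := by
    by_contra hcon
    exact hv.2 ⟨h1, (not_le.1 hcon).le⟩
  rw [wrightG_eq_zero_of_nonpos hβ hβ1 a hs (by linarith), mul_zero]

end

end FracPDE

/-! ### Identification of the Bromwich integral with the Wright series -/

namespace FracPDE

open Set Filter Topology MeasureTheory

noncomputable section

theorem integrable_comp_abs_of_Ioi {f : ℝ → ℝ} (hf : IntegrableOn f (Ioi 0)) :
    Integrable fun y => f |y| := by
  have h1 : IntegrableOn (fun y => f |y|) (Ioi 0) :=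
    hf.congr_fun (fun y (hy : 0 < y) => by rw [abs_of_pos hy]) measurableSet_Ioi
  have h2 : IntegrableOn (fun y => f |y|) (Iic 0) := by
    rw [integrableOn_Iic_iff_integrableOn_Iio]
    have h3 : IntegrableOn (fun y => f |y|) (Ioi (-0)) := by rwa [neg_zero]
    simpa using h3.comp_neg_Iio
  rw [← integrableOn_univ, ← Iic_union_Ioi (a := (0 : ℝ))]
  exact h2.union h1

theorem exists_mul_rpow_le {β : ℝ} (hβ : 0 < β) (hβ1 : β < 1) {R ε : ℝ} (hR : 0 ≤ R) (hε : 0 < ε) :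
    ∃ K : ℝ, ∀ ρ, 0 ≤ ρ → R * ρ ^ β ≤ ε * ρ + K := by
  have hlim := (tendsto_rpow_neg_atTop (by linarith : 0 < 1 - β)).const_mul R
  rw [mul_zero] at hlim
  obtain ⟨M, hM⟩ := eventually_atTop.1 (hlim.eventually (gt_mem_nhds hε))
  refine ⟨R * (max M 1) ^ β, fun ρ hρ => ?_⟩
  rcases le_total ρ (max M 1) with h | h
  · have : R * ρ ^ β ≤ R * (max M 1) ^ β := by gcongr
    nlinarith [mul_nonneg hε.le hρ]
  · have h1 : M ≤ ρ := (le_max_left _ _).trans h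
    have h0 : 0 < ρ := one_pos.trans_le ((le_max_right _ _).trans h)
    have h2 := (hM ρ h1).le
    have e : ρ ^ β = ρ * ρ ^ (-(1 - β)) := by
      rw [← Real.rpow_one_add' h0.le (by ring_nf; exact hβ.ne')]; ring_nf
    have : R * ρ ^ β ≤ ε * ρ := by
      rw [e]; nlinarith
    have : 0 ≤ R * (max M 1) ^ β := by positivity
    linarith

/-- The integrand on the ray of angle `θ`. -/
def rayIntegrand (β a θ r ρ : ℝ) : ℂ :=
  Complex.exp (ρ * Complex.exp (θ * Complex.I) -
      r * (ρ ^ β : ℝ) * Complex.exp ((β * θ : ℝ) * Complex.I)) *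
    (Complex.exp ((θ * a : ℝ) * Complex.I) * (ρ ^ (a - 1) : ℝ))

theorem norm_rayIntegrand (β a θ r : ℝ) {ρ : ℝ} (hρ : 0 < ρ) :
    ‖rayIntegrand β a θ r ρ‖ =
      Real.exp (ρ * Real.cos θ - r * ρ ^ β * Real.cos (β * θ)) * ρ ^ (a - 1) := by
  rw [rayIntegrand, norm_mul, norm_mul, Complex.norm_exp_ofReal_mul_I, Complex.norm_exp, one_mul,
    Complex.norm_real, Real.norm_eq_abs, abs_of_pos (by positivity)]
  congr 2
  rw [Complex.sub_re, Complex.re_ofReal_mul, ← Complex.ofReal_mul, Complex.re_ofReal_mul,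
    Complex.exp_ofReal_mul_I_re, Complex.exp_ofReal_mul_I_re]

theorem integrableOn_rayMajorant {β : ℝ} (hβ : 0 < β) (hβ1 : β < 1) {a c R : ℝ} (ha : 0 < a)
    (hc : 0 < c) (hR : 0 ≤ R) :
    IntegrableOn (fun ρ : ℝ => Real.exp (-(c * ρ) + R * ρ ^ β) * ρ ^ (a - 1)) (Ioi 0) := by
  obtain ⟨K, hK⟩ := exists_mul_rpow_le hβ hβ1 hR (half_pos hc)
  refine ((integrableOn_rpow_mul_exp_neg ha (half_pos hc)).const_mul (Real.exp K)).mono' ?_ ?_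
  · exact (by fun_prop : Measurable fun ρ : ℝ =>
      Real.exp (-(c * ρ) + R * ρ ^ β) * ρ ^ (a - 1)).aestronglyMeasurable
  · refine (ae_restrict_iff' measurableSet_Ioi).2 (.of_forall fun ρ (hρ : 0 < ρ) => ?_)
    rw [Real.norm_eq_abs, abs_of_pos (by positivity), mul_left_comm, ← Real.exp_add,
      mul_comm (Real.exp _)]
    refine mul_le_mul_of_nonneg_left (Real.exp_le_exp.2 ?_) (by positivity)
    have := hK ρ hρ.le
    linarith

/-- The terms of the expansion of `rayIntegrand`. -/
def rayTerm (β a θ r : ℝ) (k : ℕ) (ρ : ℝ) : ℂ :=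
  Complex.exp (ρ * Complex.exp (θ * Complex.I)) *
    (Complex.exp ((θ * a : ℝ) * Complex.I) * (ρ ^ (a - 1) : ℝ)) *
    ((-(r * (ρ ^ β : ℝ) * Complex.exp ((β * θ : ℝ) * Complex.I))) ^ k / k.factorial)

theorem hasSum_rayTerm (β a θ r ρ : ℝ) :
    HasSum (fun k => rayTerm β a θ r k ρ) (rayIntegrand β a θ r ρ) := by
  have h := (NormedSpace.expSeries_div_hasSum_exp
    (-(r * (ρ ^ β : ℝ) * Complex.exp ((β * θ : ℝ) * Complex.I)) : ℂ)).mul_left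
    (Complex.exp (ρ * Complex.exp (θ * Complex.I)) *
      (Complex.exp ((θ * a : ℝ) * Complex.I) * (ρ ^ (a - 1) : ℝ)))
  rw [← Complex.exp_eq_exp_ℂ] at h
  have e : rayIntegrand β a θ r ρ = Complex.exp (ρ * Complex.exp (θ * Complex.I)) *
      (Complex.exp ((θ * a : ℝ) * Complex.I) * (ρ ^ (a - 1) : ℝ)) *
      Complex.exp (-(r * (ρ ^ β : ℝ) * Complex.exp ((β * θ : ℝ) * Complex.I))) := by
    rw [rayIntegrand, sub_eq_add_neg, Complex.exp_add]; ring
  rw [e]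
  exact h

theorem norm_rayTerm (β a θ r : ℝ) (k : ℕ) {ρ : ℝ} (hρ : 0 < ρ) :
    ‖rayTerm β a θ r k ρ‖ =
      Real.exp (ρ * Real.cos θ) * ρ ^ (a - 1) * ((|r| * ρ ^ β) ^ k / k.factorial) := by
  rw [rayTerm, norm_mul, norm_mul, norm_mul, norm_div, norm_pow, norm_neg, norm_mul, norm_mul,
    Complex.norm_exp_ofReal_mul_I, Complex.norm_exp_ofReal_mul_I, Complex.norm_exp, one_mul,
    mul_one, Complex.norm_real, Complex.norm_real, Complex.norm_real, Real.norm_eq_abs,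
    Real.norm_eq_abs, Real.norm_eq_abs, abs_of_pos (by positivity : 0 < ρ ^ (a - 1)),
    abs_of_pos (by positivity : 0 < ρ ^ β), Complex.norm_natCast, Complex.re_ofReal_mul,
    Complex.exp_ofReal_mul_I_re]

theorem measurable_rayTerm (β a θ r : ℝ) (k : ℕ) : Measurable (rayTerm β a θ r k) := by
  unfold rayTerm; fun_prop

theorem rayTerm_eq (β a θ r : ℝ) (k : ℕ) {ρ : ℝ} (hρ : 0 < ρ) :
    rayTerm β a θ r k ρ = (((-r) ^ k / k.factorial : ℝ) : ℂ) *
      Complex.exp ((θ * (a + β * k) : ℝ) * Complex.I) *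
      (Complex.exp (-(-Complex.exp (θ * Complex.I) * ρ)) * ((ρ ^ (a + β * k - 1) : ℝ) : ℂ)) := by
  have e1 : ρ ^ (a + β * k - 1) = ρ ^ (a - 1) * (ρ ^ β) ^ k := by
    rw [← Real.rpow_natCast, ← Real.rpow_mul hρ.le, ← Real.rpow_add hρ]; congr 1; ring
  have e2 : Complex.exp ((θ * (a + β * k) : ℝ) * Complex.I) =
      Complex.exp ((θ * a : ℝ) * Complex.I) * Complex.exp ((β * θ : ℝ) * Complex.I) ^ k := by
    rw [← Complex.exp_nat_mul, ← Complex.exp_add]; congr 1; push_cast; ring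
  rw [rayTerm, e1, e2, show -(-Complex.exp (θ * Complex.I) * ρ) =
    ρ * Complex.exp (θ * Complex.I) by ring, neg_pow, mul_pow, mul_pow]
  push_cast
  rw [neg_pow (r : ℂ)]
  ring

/-- With b = a + βk the Gamma integral along the ray has phase exp(iπb), whatever θ is. The
reflection formula turns Γ(b) sin(πb) into π/Γ(1 − b); at the poles both are 0. -/
theorem im_integral_rayTerm {β a θ : ℝ} (hβ : 0 < β) (ha : 0 < a) (hθ : Real.pi / 2 < θ)
    (hθ1 : θ < Real.pi) (r : ℝ) (k : ℕ) :
    (∫ ρ in Ioi (0 : ℝ), rayTerm β a θ r k ρ).im = Real.pi *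
      ((-r) ^ k * (k.factorial : ℝ)⁻¹ * (Real.Gamma (-β * k + (1 - a)))⁻¹) := by
  set b := a + β * k with hb
  have hb0 : 0 < b := by positivity
  have hcos : Real.cos θ < 0 := Real.cos_neg_of_pi_div_two_lt_of_lt hθ (by linarith)
  set z : ℂ := -Complex.exp (θ * Complex.I) with hz
  have hzre : 0 < z.re := by
    rw [hz, Complex.neg_re, Complex.exp_ofReal_mul_I_re]; linarith
  have hz2 : z = Complex.exp (((θ - Real.pi : ℝ) : ℂ) * Complex.I) := by
    rw [Complex.ofReal_sub, sub_mul, Complex.exp_sub, Complex.exp_pi_mul_I, hz, div_neg,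
      div_one]
  have hzne : z ≠ 0 := fun h => by simp [h] at hzre
  have hlog : Complex.log z = ((θ - Real.pi : ℝ) : ℂ) * Complex.I := by
    have him : (((θ - Real.pi : ℝ) : ℂ) * Complex.I).im = θ - Real.pi := by
      rw [Complex.im_ofReal_mul, Complex.I_im, mul_one]
    rw [hz2, Complex.log_exp (by rw [him]; linarith) (by rw [him]; linarith [Real.pi_pos])]
  have hpow : z ^ ((-b : ℝ) : ℂ) = Complex.exp (((Real.pi - θ) * b : ℝ) * Complex.I) := by
    rw [Complex.cpow_def_of_ne_zero hzne, hlog]; congr 1; push_cast; ring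
  rw [setIntegral_congr_fun measurableSet_Ioi fun ρ hρ => rayTerm_eq β a θ r k hρ,
    integral_const_mul, ← hb, ← hz, integral_rpow_mul_cexp_neg_mul hb0 hzre, hpow, mul_assoc,
    mul_left_comm (Complex.exp _) (Real.Gamma b : ℂ), ← Complex.exp_add, Complex.im_ofReal_mul,
    Complex.im_ofReal_mul, ← add_mul, ← Complex.ofReal_add, Complex.exp_ofReal_mul_I_im]
  have e : θ * b + (Real.pi - θ) * b = Real.pi * b := by ring
  rw [e]
  have hG := Real.Gamma_mul_Gamma_one_sub b
  have hGb : Real.Gamma b ≠ 0 := (Real.Gamma_pos_of_pos hb0).ne'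
  have hG2 : Real.Gamma (1 - b) = Real.pi / Real.sin (Real.pi * b) / Real.Gamma b := by
    rw [← hG]; field_simp
  have e2 : -β * k + (1 - a) = 1 - b := by rw [hb]; ring
  rw [e2, hG2, inv_div, div_div_eq_mul_div]
  have := Real.pi_ne_zero
  field_simp

/-- For θ > π/2 the factor exp(ρ cos θ) decays and beats exp(|r|ρ^β), so the exponential series may
be integrated termwise. -/
theorem im_integral_rayIntegrand {β a θ : ℝ} (hβ : 0 < β) (hβ1 : β < 1) (ha : 0 < a)
    (hθ : Real.pi / 2 < θ) (hθ1 : θ < Real.pi) (r : ℝ) :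
    (∫ ρ in Ioi (0 : ℝ), rayIntegrand β a θ r ρ).im = Real.pi * wrightW (-β) (1 - a) (-r) := by
  have hcos : Real.cos θ < 0 := Real.cos_neg_of_pi_div_two_lt_of_lt hθ (by linarith)
  have hmaj := integrableOn_rayMajorant hβ hβ1 ha (neg_pos.2 hcos) (abs_nonneg r)
  have hsum_le : ∀ (u : Finset ℕ) (ρ : ℝ), 0 < ρ → ∑ k ∈ u, ‖rayTerm β a θ r k ρ‖ ≤
      Real.exp (-(-Real.cos θ * ρ) + |r| * ρ ^ β) * ρ ^ (a - 1) := by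
    intro u ρ hρ
    simp_rw [norm_rayTerm β a θ r _ hρ, ← Finset.mul_sum]
    have h1 : ∑ k ∈ u, (|r| * ρ ^ β) ^ k / k.factorial ≤ Real.exp (|r| * ρ ^ β) := by
      have h := NormedSpace.expSeries_div_hasSum_exp (|r| * ρ ^ β)
      rw [← Real.exp_eq_exp_ℝ] at h
      exact sum_le_hasSum u (fun k _ => by positivity) h
    calc _ ≤ Real.exp (ρ * Real.cos θ) * ρ ^ (a - 1) * Real.exp (|r| * ρ ^ β) := by gcongr
      _ = _ := by rw [Real.exp_add]; ring_nf
  have hint : ∀ k, IntegrableOn (rayTerm β a θ r k) (Ioi 0) := fun k => by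
    refine hmaj.mono' (measurable_rayTerm β a θ r k).aestronglyMeasurable ?_
    refine (ae_restrict_iff' measurableSet_Ioi).2 (.of_forall fun ρ hρ => ?_)
    simpa using hsum_le {k} ρ hρ
  have hsummable : Summable fun k => ∫ ρ in Ioi (0 : ℝ), ‖rayTerm β a θ r k ρ‖ := by
    refine summable_of_sum_le (fun k => integral_nonneg fun ρ => norm_nonneg _)
      (c := ∫ ρ in Ioi (0 : ℝ), Real.exp (-(-Real.cos θ * ρ) + |r| * ρ ^ β) * ρ ^ (a - 1))
      fun u => ?_
    rw [← integral_finsetSum _ fun k _ => (hint k).norm]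
    exact setIntegral_mono_on (integrable_finsetSum _ fun k _ => (hint k).norm) hmaj
      measurableSet_Ioi fun ρ hρ => hsum_le u ρ hρ
  have h := hasSum_integral_of_summable_integral_norm hint hsummable
  simp_rw [fun ρ => (hasSum_rayTerm β a θ r ρ).tsum_eq] at h
  have h2 := (Complex.hasSum_iff _ _).1 h |>.2
  rw [← h2.tsum_eq, wrightW, ← tsum_mul_left]
  congr 1; funext k
  exact im_integral_rayTerm hβ ha hθ hθ1 r k

theorem measurable_rayIntegrand (β a θ r : ℝ) : Measurable (rayIntegrand β a θ r) := by
  unfold rayIntegrand; fun_prop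

/-- At θ = π/2 termwise integration fails, so the value is reached as θ decreases to π/2; the
domination now comes from exp(−rρ^β cos βθ), with cos βθ bounded below. -/
theorem im_integral_rayIntegrand_pi_div_two {β a : ℝ} (hβ : 0 < β) (hβ1 : β < 1) (ha : 0 < a)
    {r : ℝ} (hr : 0 < r) :
    (∫ ρ in Ioi (0 : ℝ), rayIntegrand β a (Real.pi / 2) r ρ).im =
      Real.pi * wrightW (-β) (1 - a) (-r) := by
  set κ := Real.cos (Real.pi / 2 * β) with hκ
  have hκ0 : 0 < κ := cos_half_pi_mul_pos hβ hβ1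
  have hlt : Real.pi / 2 < Real.pi := by linarith [Real.pi_pos]
  have hev : ∀ᶠ θ in 𝓝[>] (Real.pi / 2), κ / 2 < Real.cos (β * θ) := by
    have hc : Continuous fun θ => Real.cos (β * θ) := by fun_prop
    have : κ / 2 < Real.cos (β * (Real.pi / 2)) := by
      rw [mul_comm β, ← hκ]; linarith
    exact nhdsWithin_le_nhds ((hc.tendsto _).eventually (lt_mem_nhds this))
  have hIoo : ∀ᶠ θ in 𝓝[>] (Real.pi / 2), θ ∈ Ioo (Real.pi / 2) Real.pi :=
    Ioo_mem_nhdsGT hlt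
  have hmaj : IntegrableOn (fun ρ : ℝ => ρ ^ (a - 1) * Real.exp (-(r * (κ / 2)) * ρ ^ β))
      (Ioi 0) :=
    integrableOn_rpow_mul_exp_neg_mul_rpow (by linarith) hβ (by positivity)
  have hlim := tendsto_integral_filter_of_dominated_convergence
    (μ := volume.restrict (Ioi (0 : ℝ))) (l := 𝓝[>] (Real.pi / 2))
    (F := fun θ ρ => rayIntegrand β a θ r ρ) (f := rayIntegrand β a (Real.pi / 2) r)
    (fun ρ : ℝ => ρ ^ (a - 1) * Real.exp (-(r * (κ / 2)) * ρ ^ β))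
    (.of_forall fun θ => (measurable_rayIntegrand β a θ r).aestronglyMeasurable) ?_ hmaj ?_
  · have h1 := (Complex.continuous_im.tendsto _).comp hlim
    refine tendsto_nhds_unique h1 (tendsto_const_nhds.congr' ?_)
    filter_upwards [hIoo] with θ hθ
    exact (im_integral_rayIntegrand hβ hβ1 ha hθ.1 hθ.2 r).symm
  · filter_upwards [hev, hIoo] with θ hθ hθ2
    refine (ae_restrict_iff' measurableSet_Ioi).2 (.of_forall fun ρ (hρ : 0 < ρ) => ?_)
    rw [norm_rayIntegrand β a θ r hρ, mul_comm]
    refine mul_le_mul_of_nonneg_left (Real.exp_le_exp.2 ?_) (by positivity)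
    have hcos : Real.cos θ < 0 :=
      Real.cos_neg_of_pi_div_two_lt_of_lt hθ2.1 (by linarith [hθ2.2])
    have h2 : 0 < r * ρ ^ β := by positivity
    nlinarith [mul_pos_of_neg_of_neg (neg_lt_zero.2 hρ) hcos]
  · refine .of_forall fun ρ => ?_
    have : Continuous fun θ => rayIntegrand β a θ r ρ := by unfold rayIntegrand; fun_prop
    exact (this.tendsto _).mono_left nhdsWithin_le_nhds

theorem I_mul_cpow {y : ℝ} (hy : 0 < y) (b : ℝ) :
    (y * Complex.I : ℂ) ^ (b : ℂ) =
      ((y ^ b : ℝ) : ℂ) * Complex.exp ((b * (Real.pi / 2) : ℝ) * Complex.I) := by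
  rw [cpow_ofReal_mul hy Complex.I_ne_zero, Complex.cpow_def_of_ne_zero Complex.I_ne_zero,
    Complex.log_I]
  congr 2; push_cast; ring

theorem wrightLine_zero_re (β a r : ℝ) {y : ℝ} (hy : 0 < y) :
    (wrightLine β a 0 r 1 y).re = (rayIntegrand β a (Real.pi / 2) r y).im := by
  have e : wrightLine β a 0 r 1 y = -Complex.I * rayIntegrand β a (Real.pi / 2) r y := by
    have e1 : Complex.exp ((((a - 1) * (Real.pi / 2) : ℝ) : ℂ) * Complex.I) =
        -Complex.I * Complex.exp ((Real.pi / 2 * a : ℝ) * Complex.I) := by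
      rw [show (((a - 1) * (Real.pi / 2) : ℝ) * Complex.I : ℂ) =
        (Real.pi / 2 * a : ℝ) * Complex.I - Real.pi / 2 * Complex.I by push_cast; ring,
        Complex.exp_sub, Complex.exp_pi_div_two_mul_I, Complex.div_I]
      ring
    have e2 : Complex.exp ((Real.pi / 2 : ℝ) * Complex.I) = Complex.I := by
      push_cast; exact Complex.exp_pi_div_two_mul_I
    rw [wrightLine, rayIntegrand, Complex.ofReal_zero, zero_add, I_mul_cpow hy, I_mul_cpow hy, e1,
      e2, Complex.ofReal_one, mul_one]
    ring_nf
  rw [e]; simp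

theorem wrightLine_zero_neg_re (β a r : ℝ) {y : ℝ} (hy : 0 < y) :
    (wrightLine β a 0 r 1 (-y)).re = (wrightLine β a 0 r 1 y).re := by
  have hne : (y * Complex.I : ℂ).arg ≠ Real.pi := by
    rw [Complex.arg_real_mul _ hy, Complex.arg_I]; linarith [Real.pi_pos]
  have hc (b : ℝ) : ((-y : ℝ) * Complex.I : ℂ) ^ (b : ℂ) =
      (starRingEnd ℂ) ((y * Complex.I : ℂ) ^ (b : ℂ)) := by
    rw [← Complex.conj_ofReal b, ← Complex.conj_cpow _ _ hne]; simp
  have e : wrightLine β a 0 r 1 (-y) = (starRingEnd ℂ) (wrightLine β a 0 r 1 y) := by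
    rw [wrightLine, wrightLine, Complex.ofReal_zero, zero_add, zero_add, hc, hc, map_mul,
      ← Complex.exp_conj]
    simp
  rw [e, Complex.conj_re]

theorem norm_wrightLine_le_of_le_one {β : ℝ} (hβ : 0 < β) (hβ1 : β < 1) (a : ℝ) {c r y : ℝ}
    (hc : 0 ≤ c) (hc1 : c ≤ 1) (hr : 0 < r) (hy : y ≠ 0) :
    ‖wrightLine β a c r 1 y‖ ≤ Real.exp 1 * 2 ^ |a - 1| *
      ((|y| ^ (a - 1) + 1) * Real.exp (-(r * Real.cos (Real.pi / 2 * β)) * |y| ^ β)) := by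
  have hκ := cos_half_pi_mul_pos hβ hβ1
  have hy0 : 0 < |y| := abs_pos.2 hy
  have hσ := re_cpow_ge hβ hβ1 (σ := c + y * Complex.I) (by simpa using hc)
  have h1 : |y| ≤ ‖(c + y * Complex.I : ℂ)‖ := by
    simpa using Complex.abs_im_le_norm (c + y * Complex.I : ℂ)
  have h2 : ‖(c + y * Complex.I : ℂ)‖ ≤ c + |y| := by
    refine (norm_add_le _ _).trans (le_of_eq ?_)
    rw [norm_mul, Complex.norm_I, mul_one, Complex.norm_real, Complex.norm_real,
      Real.norm_eq_abs, Real.norm_eq_abs, abs_of_nonneg hc]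
  have h3 : ‖(c + y * Complex.I : ℂ)‖ ^ (a - 1) ≤ 2 ^ |a - 1| * (|y| ^ (a - 1) + 1) := by
    have h0 : 0 < |y| ^ (a - 1) := by positivity
    rcases le_total 1 a with ha | ha
    · rw [abs_of_nonneg (by linarith)]
      have h4 : ‖(c + y * Complex.I : ℂ)‖ ≤ 2 * max |y| 1 :=
        h2.trans (by linarith [le_max_left |y| 1, le_max_right |y| 1])
      refine (Real.rpow_le_rpow (norm_nonneg _) h4 (by linarith)).trans ?_
      rw [Real.mul_rpow two_pos.le (by positivity)]
      gcongr
      rcases max_choice |y| 1 with h | h <;> rw [h]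
      · linarith
      · rw [Real.one_rpow]; linarith
    · have h5 : (1 : ℝ) ≤ 2 ^ |a - 1| := Real.one_le_rpow one_le_two (abs_nonneg _)
      have h6 := Real.rpow_le_rpow_of_nonpos hy0 h1 (by linarith : a - 1 ≤ 0)
      nlinarith
  have h4 : |y| ^ β ≤ ‖(c + y * Complex.I : ℂ)‖ ^ β := by gcongr
  rw [norm_wrightLine]
  have h5 : Real.exp (c * 1 - r * ((c + y * Complex.I : ℂ) ^ (β : ℂ)).re) ≤
      Real.exp 1 * Real.exp (-(r * Real.cos (Real.pi / 2 * β)) * |y| ^ β) := by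
    rw [← Real.exp_add]
    refine Real.exp_le_exp.2 ?_
    have h6 : Real.cos (Real.pi / 2 * β) * |y| ^ β ≤ ((c + y * Complex.I : ℂ) ^ (β : ℂ)).re :=
      (mul_le_mul_of_nonneg_left h4 hκ.le).trans hσ
    nlinarith
  calc _ ≤ Real.exp 1 * Real.exp (-(r * Real.cos (Real.pi / 2 * β)) * |y| ^ β) *
        (2 ^ |a - 1| * (|y| ^ (a - 1) + 1)) := by gcongr
    _ = _ := by ring

/-- The line Re σ = c is moved to the imaginary axis, where a > 0 makes |y|^{a−1} integrable at 0.
By conjugation symmetry the real part is even in y, and the upper half of the axis is the ray of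
angle π/2. -/
theorem wrightG_eq_wrightW {β : ℝ} (hβ : 0 < β) (hβ1 : β < 1) {a r : ℝ} (ha : 0 < a) (hr : 0 < r) :
    wrightG β a r 1 = wrightW (-β) (1 - a) (-r) := by
  have hκ := cos_half_pi_mul_pos hβ hβ1
  set κ := Real.cos (Real.pi / 2 * β)
  have hmaj : Integrable fun y : ℝ => Real.exp 1 * 2 ^ |a - 1| *
      ((|y| ^ (a - 1) + 1) * Real.exp (-(r * κ) * |y| ^ β)) := by
    refine (integrable_comp_abs_of_Ioi
      (f := fun y => (y ^ (a - 1) + 1) * Real.exp (-(r * κ) * y ^ β)) ?_).const_mul _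
    have i1 := integrableOn_rpow_mul_exp_neg_mul_rpow (s := a - 1) (by linarith) hβ
      (mul_pos hr hκ)
    have i2 := integrableOn_rpow_mul_exp_neg_mul_rpow (s := 0) (by linarith) hβ (mul_pos hr hκ)
    refine (i1.add i2).congr (.of_forall fun y => ?_)
    simp only [Pi.add_apply, Real.rpow_zero]; ring
  have hae : ∀ᵐ y : ℝ, y ≠ 0 := by simp [ae_iff]
  have hcont (y : ℝ) (hy : y ≠ 0) :
      ContinuousAt (fun c : ℝ => wrightLine β a c r 1 y) 0 := by
    have hsl : ((0 : ℝ) + y * Complex.I : ℂ) ∈ Complex.slitPlane := Or.inr (by simpa using hy)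
    have hσ : ContinuousAt (fun c : ℝ => (c + y * Complex.I : ℂ)) 0 := by fun_prop
    have h1 := hσ.cpow (continuousAt_const (y := (β : ℂ))) hsl
    have h2 := hσ.cpow (continuousAt_const (y := ((a - 1 : ℝ) : ℂ))) hsl
    unfold wrightLine
    exact (((hσ.mul continuousAt_const).sub (continuousAt_const.mul h1)).cexp).mul h2
  have hlim := tendsto_integral_filter_of_dominated_convergence
    (μ := volume) (l := 𝓝[>] (0 : ℝ))
    (F := fun c y => wrightLine β a c r 1 y) (f := fun y => wrightLine β a 0 r 1 y) _
    (eventually_nhdsWithin_of_forall fun c hc =>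
      (continuous_wrightLine β a r 1 hc).aestronglyMeasurable)
    (by
      filter_upwards [Ioc_mem_nhdsGT one_pos] with c hc
      filter_upwards [hae] with y hy
      exact norm_wrightLine_le_of_le_one hβ hβ1 a hc.1.le hc.2 hr hy) hmaj
    (by
      filter_upwards [hae] with y hy
      exact (hcont y hy).tendsto.mono_left nhdsWithin_le_nhds)
  have hint : Integrable fun y => wrightLine β a 0 r 1 y := by
    refine hmaj.mono' ?_ ?_
    · exact (by unfold wrightLine; fun_prop : Measurable fun y =>
        wrightLine β a 0 r 1 y).aestronglyMeasurable
    · filter_upwards [hae] with y hy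
      exact norm_wrightLine_le_of_le_one hβ hβ1 a le_rfl zero_le_one hr hy
  have hval : wrightG β a r 1 = (2 * Real.pi)⁻¹ * (∫ y, wrightLine β a 0 r 1 y).re := by
    have h1 := (((Complex.continuous_re.tendsto _).comp hlim).const_mul (2 * Real.pi)⁻¹)
    refine (tendsto_nhds_unique h1 (tendsto_const_nhds.congr' ?_)).symm
    filter_upwards [self_mem_nhdsWithin] with c hc
    rw [wrightG, wrightBromwich_eq_of_pos hβ hβ1 a 1 one_pos hc hr, wrightBromwich,
      show (2 * Real.pi : ℂ)⁻¹ = (((2 * Real.pi)⁻¹ : ℝ) : ℂ) by push_cast; rfl,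
      Complex.re_ofReal_mul]
    rfl
  have hray : IntegrableOn (rayIntegrand β a (Real.pi / 2) r) (Ioi 0) := by
    refine (integrableOn_rpow_mul_exp_neg_mul_rpow (s := a - 1) (by linarith) hβ
      (mul_pos hr hκ)).mono' (measurable_rayIntegrand _ _ _ _).aestronglyMeasurable ?_
    refine (ae_restrict_iff' measurableSet_Ioi).2 (.of_forall fun ρ (hρ : 0 < ρ) => ?_)
    rw [norm_rayIntegrand _ _ _ _ hρ, Real.cos_pi_div_two, mul_zero, mul_comm, mul_comm β]
    refine (mul_le_mul_of_nonneg_left (Real.exp_le_exp.2 (le_of_eq ?_)) (by positivity))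
    ring
  have heven : ∀ᵐ y : ℝ, (wrightLine β a 0 r 1 y).re =
      (rayIntegrand β a (Real.pi / 2) r |y|).im := by
    filter_upwards [hae] with y hy
    rcases hy.lt_or_gt with h | h
    · rw [abs_of_neg h, ← wrightLine_zero_re β a r (neg_pos.2 h),
        ← wrightLine_zero_neg_re β a r (neg_pos.2 h), neg_neg]
    · rw [abs_of_pos h, ← wrightLine_zero_re β a r h]
  have h1 : (∫ y, wrightLine β a 0 r 1 y).re = 2 * (Real.pi * wrightW (-β) (1 - a) (-r)) := by
    rw [← im_integral_rayIntegrand_pi_div_two hβ hβ1 ha hr]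
    have h2 := (integral_re hint).symm
    have h3 := (integral_im hray)
    simp only [RCLike.re_to_complex, RCLike.im_to_complex] at h2 h3
    rw [h2, ← h3, integral_congr_ae heven,
      integral_comp_abs (f := fun y => (rayIntegrand β a (Real.pi / 2) r y).im)]
  rw [hval, h1]
  have := Real.pi_ne_zero
  field_simp

theorem wrightDensity_eq_wrightG {β : ℝ} (hβ : 0 < β) (hβ1 : β < 1) {s t : ℝ} (hs : 0 < s)
    (ht : 0 < t) : wrightDensity β s t = wrightG β β s t := by
  rw [wrightDensity, wrightG_scale hβ hβ1 β hs ht, wrightG_eq_wrightW hβ hβ1 hβ (by positivity)]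

/-- On a ray with θ > π/2, here 3π/4, the majorant is uniform as r → 0, unlike on vertical lines. -/
theorem exists_abs_wrightG_le_of_le {β : ℝ} (hβ : 0 < β) (hβ1 : β < 1) {a : ℝ} (ha : 0 < a)
    (R : ℝ) : ∃ C, 0 ≤ C ∧ ∀ r, 0 < r → r ≤ R → |wrightG β a r 1| ≤ C := by
  set θ := 3 * Real.pi / 4
  have hθ : Real.pi / 2 < θ := by simp only [θ]; linarith [Real.pi_pos]
  have hθ1 : θ < Real.pi := by simp only [θ]; linarith [Real.pi_pos]
  have hcos : Real.cos θ < 0 := Real.cos_neg_of_pi_div_two_lt_of_lt hθ (by linarith)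
  have hmaj := integrableOn_rayMajorant hβ hβ1 ha (neg_pos.2 hcos) (abs_nonneg R)
  refine ⟨Real.pi⁻¹ * ∫ ρ in Ioi (0 : ℝ),
    Real.exp (-(-Real.cos θ * ρ) + |R| * ρ ^ β) * ρ ^ (a - 1), ?_, fun r hr hrR => ?_⟩
  · exact mul_nonneg (inv_nonneg.2 Real.pi_pos.le) (setIntegral_nonneg measurableSet_Ioi
      fun ρ (hρ : 0 < ρ) => by positivity)
  have h1 : wrightG β a r 1 = Real.pi⁻¹ * (∫ ρ in Ioi (0 : ℝ), rayIntegrand β a θ r ρ).im := by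
    rw [wrightG_eq_wrightW hβ hβ1 ha hr, im_integral_rayIntegrand hβ hβ1 ha hθ hθ1,
      inv_mul_cancel_left₀ Real.pi_ne_zero]
  rw [h1, abs_mul, abs_of_pos (inv_pos.2 Real.pi_pos)]
  refine mul_le_mul_of_nonneg_left ((Complex.abs_im_le_norm _).trans
    (norm_integral_le_of_norm_le hmaj ?_)) (inv_nonneg.2 Real.pi_pos.le)
  refine (ae_restrict_iff' measurableSet_Ioi).2 (.of_forall fun ρ (hρ : 0 < ρ) => ?_)
  rw [norm_rayIntegrand β a θ r hρ]
  refine mul_le_mul_of_nonneg_right (Real.exp_le_exp.2 ?_) (by positivity)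
  have h2 : -(r * ρ ^ β * Real.cos (β * θ)) ≤ |R| * ρ ^ β := by
    have h3 := Real.neg_one_le_cos (β * θ)
    have h4 : 0 < ρ ^ β := by positivity
    have h5 : r * ρ ^ β ≤ |R| * ρ ^ β := by
      gcongr; exact hrR.trans (le_abs_self R)
    nlinarith [mul_pos hr h4]
  linarith

end

end FracPDE

/-! ### Saddle-point upper bound -/

namespace FracPDE

open Set Filter Topology MeasureTheory

noncomputable section

/-- In logarithmic form the derivative is β(tan x − tan βx − (1−β)x). It is nonnegative because tan
x − tan βx = sin((1−β)x)/(cos x cos βx) ≥ tan((1−β)x) ≥ (1−β)x. -/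
theorem cos_rpow_mul_exp_le {β : ℝ} (hβ : 0 < β) (hβ1 : β < 1) {θ : ℝ} (hθ : |θ| < Real.pi / 2) :
    Real.cos θ ^ β * Real.exp (β * (1 - β) / 2 * θ ^ 2) ≤ Real.cos (β * θ) := by
  wlog h0 : 0 ≤ θ generalizing θ
  · have := this (θ := -θ) (by rwa [abs_neg]) (by linarith)
    rwa [Real.cos_neg, mul_neg, Real.cos_neg, neg_sq] at this
  rw [abs_of_nonneg h0] at hθ
  have hcos : ∀ x ∈ Ico 0 (Real.pi / 2), 0 < Real.cos x ∧ 0 < Real.cos (β * x) := by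
    intro x hx
    refine ⟨Real.cos_pos_of_mem_Ioo ⟨by linarith [hx.1, Real.pi_pos], hx.2⟩,
      Real.cos_pos_of_mem_Ioo ⟨?_, ?_⟩⟩
    · have := mul_nonneg hβ.le hx.1; linarith [Real.pi_pos]
    · nlinarith [hx.1, hx.2]
  have hd : ∀ x ∈ Ico 0 (Real.pi / 2), HasDerivAt
      (fun x => Real.log (Real.cos (β * x)) - β * Real.log (Real.cos x) - β * (1 - β) / 2 * x ^ 2)
      (β * (Real.tan x - Real.tan (β * x) - (1 - β) * x)) x := by
    intro x hx
    obtain ⟨h1, h2⟩ := hcos x hx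
    have d0 : HasDerivAt (fun x => β * x) β x := by simpa using (hasDerivAt_id x).const_mul β
    have d1 := (d0.cos).log h2.ne'
    have d2 := (Real.hasDerivAt_cos x).log h1.ne'
    have d3 := ((hasDerivAt_pow 2 x).const_mul (β * (1 - β) / 2))
    refine ((d1.sub (d2.const_mul β)).sub d3).congr_deriv ?_
    rw [Real.tan_eq_sin_div_cos, Real.tan_eq_sin_div_cos]
    push_cast
    ring
  have hmono : MonotoneOn (fun x => Real.log (Real.cos (β * x)) - β * Real.log (Real.cos x) -
      β * (1 - β) / 2 * x ^ 2) (Ico 0 (Real.pi / 2)) := by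
    refine monotoneOn_of_deriv_nonneg (convex_Ico _ _)
      (fun x hx => (hd x hx).continuousAt.continuousWithinAt)
      (fun x hx => (hd x (interior_subset hx)).differentiableAt.differentiableWithinAt)
      fun x hx => ?_
    have hx' := interior_subset hx
    rw [(hd x hx').deriv]
    obtain ⟨h1, h2⟩ := hcos x hx'
    refine mul_nonneg hβ.le ?_
    have hb : 0 ≤ (1 - β) * x := mul_nonneg (by linarith) hx'.1
    have hb2 : (1 - β) * x < Real.pi / 2 := by nlinarith [hx'.1, hx'.2]
    have h3 := Real.le_tan hb hb2
    have hc3 : 0 < Real.cos ((1 - β) * x) :=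
      Real.cos_pos_of_mem_Ioo ⟨by linarith [Real.pi_pos], hb2⟩
    have hs3 : 0 ≤ Real.sin ((1 - β) * x) :=
      Real.sin_nonneg_of_nonneg_of_le_pi hb (by linarith [Real.pi_pos])
    have e : Real.tan x - Real.tan (β * x) =
        Real.sin ((1 - β) * x) / (Real.cos x * Real.cos (β * x)) := by
      rw [Real.tan_eq_sin_div_cos, Real.tan_eq_sin_div_cos,
        show (1 - β) * x = x - β * x by ring, Real.sin_sub]
      field_simp
    have h4 : Real.cos x * Real.cos (β * x) ≤ Real.cos ((1 - β) * x) := by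
      rw [show (1 - β) * x = x - β * x by ring, Real.cos_sub]
      have := mul_nonneg (Real.sin_nonneg_of_nonneg_of_le_pi hx'.1 (by linarith [hx'.2]))
        (Real.sin_nonneg_of_nonneg_of_le_pi (mul_nonneg hβ.le hx'.1)
          (by nlinarith [hx'.1, hx'.2]))
      linarith
    have h5 : Real.tan ((1 - β) * x) ≤ Real.tan x - Real.tan (β * x) := by
      rw [e, Real.tan_eq_sin_div_cos]
      exact div_le_div_of_nonneg_left hs3 (mul_pos h1 h2) h4
    linarith
  have key := hmono ⟨le_rfl, by linarith [Real.pi_pos]⟩ ⟨h0, hθ⟩ h0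
  simp only [mul_zero, Real.cos_zero, Real.log_one, sub_zero, ne_eq, OfNat.ofNat_ne_zero,
    not_false_eq_true, zero_pow] at key
  obtain ⟨h1, h2⟩ := hcos θ ⟨h0, hθ⟩
  rw [Real.rpow_def_of_pos h1, ← Real.exp_add, ← Real.le_log_iff_exp_le h2]
  linarith

/-- The real part of `(1 + iη)^β`. -/
def linePowRe (β η : ℝ) : ℝ := (((1 : ℝ) + η * Complex.I : ℂ) ^ (β : ℂ)).re

/-- On the line Re w = 1 one has cos(arg w) = 1/|w|, so the cosine inequality bounds |w|^β cos(β arg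
w). It shows that the modulus of the exponential is largest at the saddle η = 0. -/
theorem one_add_le_linePowRe {β : ℝ} (hβ : 0 < β) (hβ1 : β < 1) (η : ℝ) :
    1 + β * (1 - β) / 2 * (η ^ 2 / (1 + η ^ 2)) ≤ linePowRe β η := by
  set w : ℂ := (1 : ℝ) + η * Complex.I with hw
  have hre : w.re = 1 := sigma_re 1 η
  have him : w.im = η := by simp [hw]
  have hn0 : 0 < ‖w‖ := norm_pos_iff.2 fun h => by simp [h] at hre
  have hwne : w ≠ 0 := norm_pos_iff.1 hn0
  have hn2 : ‖w‖ ^ 2 = 1 + η ^ 2 := by rw [hw, norm_sigma_sq]; ring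
  have harg : |w.arg| < Real.pi / 2 := Complex.abs_arg_lt_pi_div_two_iff.2 (Or.inl (by rw [hre]; exact one_pos))
  have hcos : Real.cos w.arg = ‖w‖⁻¹ := by rw [Complex.cos_arg hwne, hre, one_div]
  have hsin : Real.sin w.arg = η / ‖w‖ := by rw [Complex.sin_arg, him]
  have h1 := cos_rpow_mul_exp_le hβ hβ1 harg
  rw [hcos, Real.inv_rpow hn0.le] at h1
  have hs : η ^ 2 / (1 + η ^ 2) ≤ w.arg ^ 2 := by
    rw [← hn2, ← div_pow, ← hsin, sq_le_sq]
    exact Real.abs_sin_le_abs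
  have h2 := Real.add_one_le_exp (β * (1 - β) / 2 * w.arg ^ 2)
  have h3 : 0 ≤ β * (1 - β) / 2 := by
    have : 0 < 1 - β := by linarith
    positivity
  have h4 := mul_le_mul_of_nonneg_left hs h3
  rw [linePowRe, ← hw, Complex.cpow_ofReal_re, mul_comm w.arg]
  have hp : 0 < ‖w‖ ^ β := by positivity
  have h5 : Real.exp (β * (1 - β) / 2 * w.arg ^ 2) ≤ ‖w‖ ^ β * Real.cos (β * w.arg) := by
    rwa [inv_mul_le_iff₀ hp] at h1
  linarith

theorem exists_one_add_min_le_linePowRe {β : ℝ} (hβ : 0 < β) (hβ1 : β < 1) :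
    ∃ k, 0 < k ∧ ∀ η : ℝ, 1 + k * min (η ^ 2) (|η| ^ β) ≤ linePowRe β η := by
  have hκ := cos_half_pi_mul_pos hβ hβ1
  set κ := Real.cos (Real.pi / 2 * β) with hκd
  -- Beyond R one has κ|η|^β ≥ 2, so half of the sector bound absorbs the 1; up to R the quadratic
  -- bound is used.
  set R : ℝ := (2 / κ) ^ β⁻¹
  have hR : 0 < R := by positivity
  have hRβ : R ^ β = 2 / κ := Real.rpow_inv_rpow (by positivity) hβ.ne'
  have hb : 0 < β * (1 - β) / 2 := by
    have : 0 < 1 - β := by linarith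
    positivity
  refine ⟨min (β * (1 - β) / 2 / (1 + R ^ 2)) (κ / 2), lt_min (by positivity) (by positivity),
    fun η => ?_⟩
  rcases le_total |η| R with h | h
  · refine le_trans ?_ (one_add_le_linePowRe hβ hβ1 η)
    have h1 : η ^ 2 ≤ R ^ 2 := by rw [← sq_abs]; gcongr
    have h2 : min (β * (1 - β) / 2 / (1 + R ^ 2)) (κ / 2) * min (η ^ 2) (|η| ^ β) ≤
        (β * (1 - β) / 2 / (1 + R ^ 2)) * η ^ 2 := by
      gcongr
      · exact min_le_left _ _
      · exact min_le_left _ _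
    have h3 : (β * (1 - β) / 2 / (1 + R ^ 2)) * η ^ 2 ≤
        β * (1 - β) / 2 * (η ^ 2 / (1 + η ^ 2)) := by
      rw [div_mul_eq_mul_div, mul_div_assoc]
      gcongr
    linarith
  · have h1 := re_cpow_ge hβ hβ1 (σ := (1 : ℝ) + η * Complex.I) (by simp)
    have h2 : |η| ≤ ‖((1 : ℝ) + η * Complex.I : ℂ)‖ := by
      simpa using Complex.abs_im_le_norm ((1 : ℝ) + η * Complex.I : ℂ)
    have h3 : |η| ^ β ≤ ‖((1 : ℝ) + η * Complex.I : ℂ)‖ ^ β := by gcongr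
    have h4 : min (β * (1 - β) / 2 / (1 + R ^ 2)) (κ / 2) * min (η ^ 2) (|η| ^ β) ≤
        κ / 2 * |η| ^ β := by
      gcongr
      · exact min_le_right _ _
      · exact min_le_right _ _
    have h5 : R ^ β ≤ |η| ^ β := by gcongr
    rw [hRβ] at h5
    have h6 : 2 ≤ κ * |η| ^ β := by rwa [div_le_iff₀' hκ] at h5
    have h7 := mul_le_mul_of_nonneg_left h3 hκ.le
    rw [linePowRe]
    linarith

/-- For s = c/β and t = c the exponent is c(σ − σ^β/β), with critical point σ = 1 and critical value
−c(1/β − 1). -/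
theorem norm_wrightLine_saddle {β : ℝ} (hβ : 0 < β) (a c η : ℝ) :
    ‖wrightLine β a 1 (c / β) c η‖ = Real.exp (-(c * (1 / β - 1))) *
      (Real.exp (-(c * ((linePowRe β η - 1) / β))) *
        ‖((1 : ℝ) + η * Complex.I : ℂ)‖ ^ (a - 1)) := by
  rw [norm_wrightLine, ← mul_assoc, ← Real.exp_add, linePowRe]
  congr 2
  field_simp
  ring

theorem wrightG_eq_saddle {β : ℝ} (hβ : 0 < β) (hβ1 : β < 1) (a : ℝ) {c : ℝ} (hc : 0 < c) :
    wrightG β a (c ^ (1 - β) / β) 1 = c ^ a * wrightG β a (c / β) c := by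
  rw [wrightG_scale hβ hβ1 a (div_pos hc hβ) hc, ← mul_assoc, ← Real.rpow_add hc, add_neg_cancel,
    Real.rpow_zero, one_mul, div_mul_eq_mul_div]
  congr 2
  rw [sub_eq_add_neg, Real.rpow_add hc, Real.rpow_one]

/-- The saddle point `c` belonging to `r = c^{1-β} / β`. -/
def saddlePoint (β r : ℝ) : ℝ := (β * r) ^ (1 - β)⁻¹

theorem saddlePoint_pos {β r : ℝ} (hβ : 0 < β) (hr : 0 < r) : 0 < saddlePoint β r := by
  unfold saddlePoint; positivity

theorem saddlePoint_rpow {β r : ℝ} (hβ : 0 < β) (hβ1 : β < 1) (hr : 0 < r) :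
    saddlePoint β r ^ (1 - β) / β = r := by
  rw [saddlePoint, Real.rpow_inv_rpow (by positivity) (by linarith)]
  field_simp

theorem integrable_exp_neg_linePowRe {β : ℝ} (hβ : 0 < β) (hβ1 : β < 1) (a : ℝ) :
    Integrable fun η : ℝ => Real.exp (-((linePowRe β η - 1) / β)) *
        ‖((1 : ℝ) + η * Complex.I : ℂ)‖ ^ (a - 1) := by
  have h := (integrable_wrightLine hβ hβ1 a 1 one_pos (div_pos one_pos hβ)).norm
  simp_rw [norm_wrightLine_saddle hβ a 1, one_mul] at h
  exact (integrable_const_mul_iff (Real.exp_ne_zero _).isUnit _).1 h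

/-- The Wright-type functions decay like `exp (-κ r^γ)`, `γ = 1 / (1 - β)`, as `r → ∞`. -/
theorem exists_abs_wrightG_le {β : ℝ} (hβ : 0 < β) (hβ1 : β < 1) {a : ℝ} (ha : 0 < a) :
    ∃ C κ, 0 ≤ C ∧ 0 < κ ∧ ∀ r, 0 < r →
      |wrightG β a r 1| ≤ C * Real.exp (-(κ * saddlePoint β r)) := by
  have hb : 0 < 1 / β - 1 := by rw [sub_pos, lt_div_iff₀ hβ]; linarith
  obtain ⟨C₁, hC₁, hB₁⟩ := exists_abs_wrightG_le_of_le hβ hβ1 ha β⁻¹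
  -- Half of the saddle rate; the other half absorbs the factor c^a.
  set κ := (1 / β - 1) / 2 with hκ
  set J := ∫ η : ℝ, Real.exp (-((linePowRe β η - 1) / β)) *
        ‖((1 : ℝ) + η * Complex.I : ℂ)‖ ^ (a - 1)
  have hJ : 0 ≤ J := integral_nonneg fun η => by positivity
  obtain ⟨K, hK, hKb⟩ : ∃ K, 0 ≤ K ∧ ∀ c, 1 ≤ c → c ^ a * Real.exp (-(κ * c)) ≤ K := by
    obtain ⟨M, hM⟩ := eventually_atTop.1 ((tendsto_rpow_mul_exp_neg_mul_atTop_nhds_zero a κ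
      (by positivity)).eventually (ge_mem_nhds one_pos))
    refine ⟨max 1 (max M 1 ^ a), by positivity, fun c hc => ?_⟩
    rcases le_total M c with h | h
    · exact le_max_of_le_left (by simpa [neg_mul] using hM c h)
    · refine le_max_of_le_right ?_
      have h1 : Real.exp (-(κ * c)) ≤ 1 := Real.exp_le_one_iff.2 (by
        have : 0 < κ * c := by positivity
        linarith)
      have h2 : c ^ a ≤ max M 1 ^ a := by
        gcongr; exact h.trans (le_max_left _ _)
      have h3 : 0 < c ^ a := by positivity
      nlinarith
  refine ⟨C₁ * Real.exp κ + (2 * Real.pi)⁻¹ * J * K, κ, by positivity, by positivity,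
    fun r hr => ?_⟩
  set c := saddlePoint β r with hcd
  have hc := saddlePoint_pos hβ hr
  rw [← hcd] at hc
  have he := Real.exp_pos (-(κ * c))
  -- For c ≤ 1 the argument r is at most 1/β and the ray bound applies; the saddle estimate handles
  -- c ≥ 1.
  rcases le_total c 1 with h | h
  · have hr1 : r ≤ β⁻¹ := by
      rw [← saddlePoint_rpow hβ hβ1 hr, ← hcd, div_eq_mul_inv]
      have : c ^ (1 - β) ≤ 1 := Real.rpow_le_one hc.le h (by linarith)
      have hi := inv_pos.2 hβ
      nlinarith
    have h1 : 1 ≤ Real.exp κ * Real.exp (-(κ * c)) := by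
      rw [← Real.exp_add, ← Real.exp_zero]
      refine Real.exp_le_exp.2 ?_
      have : 0 < κ := by positivity
      nlinarith
    have h2 := mul_le_mul_of_nonneg_left h1 hC₁
    have h3 : 0 ≤ (2 * Real.pi)⁻¹ * J * K * Real.exp (-(κ * c)) := by positivity
    have := hB₁ r hr hr1
    nlinarith
  · rw [← saddlePoint_rpow hβ hβ1 hr, ← hcd, wrightG_eq_saddle hβ hβ1 a hc, abs_mul,
      abs_of_pos (by positivity : 0 < c ^ a)]
    have h1 : |wrightG β a (c / β) c| ≤
        (2 * Real.pi)⁻¹ * (Real.exp (-(c * (1 / β - 1))) * J) := by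
      refine (Complex.abs_re_le_norm _).trans ?_
      rw [wrightBromwich, norm_mul]
      have e : ‖(2 * Real.pi : ℂ)⁻¹‖ = (2 * Real.pi)⁻¹ := by
        rw [norm_inv, norm_mul, Complex.norm_real, Real.norm_eq_abs, abs_of_pos Real.pi_pos]; simp
      rw [e, ← integral_const_mul]
      refine mul_le_mul_of_nonneg_left (norm_integral_le_of_norm_le
        ((integrable_exp_neg_linePowRe hβ hβ1 a).const_mul _) (.of_forall fun η => ?_))
        (by positivity)
      rw [norm_wrightLine_saddle hβ]
      have h2 : 0 ≤ (linePowRe β η - 1) / β := by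
        refine div_nonneg ?_ hβ.le
        have h3 := one_add_le_linePowRe hβ hβ1 η
        have h4 : 0 ≤ β * (1 - β) / 2 * (η ^ 2 / (1 + η ^ 2)) := by
          have : 0 < 1 - β := by linarith
          positivity
        linarith
      gcongr
      nlinarith
    have h2 : Real.exp (-(c * (1 / β - 1))) = Real.exp (-(κ * c)) * Real.exp (-(κ * c)) := by
      rw [← Real.exp_add, hκ]; congr 1; ring
    have h3 : (2 * Real.pi)⁻¹ * J * (c ^ a * Real.exp (-(κ * c))) * Real.exp (-(κ * c)) ≤
        (2 * Real.pi)⁻¹ * J * K * Real.exp (-(κ * c)) := by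
      gcongr; exact hKb c h
    have h4 : 0 ≤ C₁ * Real.exp κ * Real.exp (-(κ * c)) := by positivity
    calc c ^ a * |wrightG β a (c / β) c| ≤
          c ^ a * ((2 * Real.pi)⁻¹ * (Real.exp (-(c * (1 / β - 1))) * J)) := by gcongr
      _ = (2 * Real.pi)⁻¹ * J * (c ^ a * Real.exp (-(κ * c))) * Real.exp (-(κ * c)) := by
        rw [h2]; ring
      _ ≤ _ := by linarith

end

end FracPDE

/-! ### Saddle-point lower bound by Laplace's method -/

namespace FracPDE

open Set Filter Topology MeasureTheory

noncomputable section

/-- The first-order expansion of (1+u)^{β−1} controls the derivative of the remainder, and the mean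
value inequality on the ball of radius ‖u‖ integrates it. -/
theorem saddle_taylor (β : ℝ) {ε : ℝ} (hε : 0 < ε) :
    ∃ δ, 0 < δ ∧ ∀ u : ℂ, ‖u‖ < δ →
      ‖β * u - ((1 + u) ^ (β : ℂ) - 1) - β * (1 - β) / 2 * u ^ 2‖ ≤ ε * ‖u‖ ^ 2 := by
  have hsl (u : ℂ) (hu : ‖u‖ < 1) : (1 + u : ℂ) ∈ Complex.slitPlane := by
    refine Or.inl ?_
    have := (abs_le.1 (Complex.abs_re_le_norm u)).1
    rw [Complex.add_re, Complex.one_re]; linarith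
  have hcp (b : ℂ) (u : ℂ) (hu : ‖u‖ < 1) :
      HasDerivAt (fun u : ℂ => (1 + u) ^ b) (b * (1 + u) ^ (b - 1)) u := by
    have := ((hasDerivAt_id u).const_add (1 : ℂ)).cpow_const (c := b) (hsl u hu)
    simpa using this
  have h0 : ‖(0 : ℂ)‖ < 1 := by simp
  have hlo := (hcp ((β : ℂ) - 1) 0 h0).isLittleO
  have hε' : 0 < ε / (|β| + 1) := by positivity
  obtain ⟨δ, hδ, hb⟩ := Metric.eventually_nhds_iff.1 (hlo.def hε')
  refine ⟨min δ 1, lt_min hδ one_pos, fun u hu => ?_⟩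
  have hd : ∀ v ∈ Metric.closedBall (0 : ℂ) ‖u‖, HasDerivWithinAt
      (fun u : ℂ => β * u - ((1 + u) ^ (β : ℂ) - 1) - β * (1 - β) / 2 * u ^ 2)
      (-(β * ((1 + v) ^ ((β : ℂ) - 1) - 1 - (β - 1) * v))) (Metric.closedBall (0 : ℂ) ‖u‖) v := by
    intro v hv
    have hv1 : ‖v‖ < 1 := by
      rw [mem_closedBall_zero_iff] at hv
      exact hv.trans_lt (hu.trans_le (min_le_right _ _))
    refine (((((hasDerivAt_id v).const_mul (β : ℂ)).sub ((hcp β v hv1).sub_const 1)).sub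
      ((hasDerivAt_pow 2 v).const_mul ((β : ℂ) * (1 - β) / 2))).congr_deriv ?_).hasDerivWithinAt
    push_cast; ring
  have hbd : ∀ v ∈ Metric.closedBall (0 : ℂ) ‖u‖,
      ‖-(β * ((1 + v) ^ ((β : ℂ) - 1) - 1 - (β - 1) * v))‖ ≤ ε * ‖u‖ := by
    intro v hv
    rw [mem_closedBall_zero_iff] at hv
    have hvδ : dist v 0 < δ := by
      rw [dist_zero_right]; exact hv.trans_lt (hu.trans_le (min_le_left _ _))
    have h1 := hb hvδ
    simp only [add_zero, Complex.one_cpow, mul_one, sub_zero, smul_eq_mul] at h1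
    rw [norm_neg, norm_mul, Complex.norm_real, Real.norm_eq_abs, mul_comm ((β : ℂ) - 1)]
    calc |β| * ‖(1 + v) ^ ((β : ℂ) - 1) - 1 - v * ((β : ℂ) - 1)‖
        ≤ |β| * (ε / (|β| + 1) * ‖u‖) := by
          refine mul_le_mul_of_nonneg_left (h1.trans ?_) (abs_nonneg _)
          gcongr
      _ = (|β| / (|β| + 1)) * (ε * ‖u‖) := by ring
      _ ≤ 1 * (ε * ‖u‖) := by
          gcongr
          rw [div_le_one (by positivity)]; linarith
      _ = ε * ‖u‖ := one_mul _
  have := (convex_closedBall (0 : ℂ) ‖u‖).norm_image_sub_le_of_norm_hasDerivWithin_le hd hbd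
    (x := 0) (y := u) (by simp) (by simp)
  simpa [sq, mul_assoc] using this

theorem tendsto_saddle_exponent {β : ℝ} (hβ : 0 < β) (ξ : ℝ) :
    Tendsto (fun c : ℝ => (c : ℂ) * ((ξ / √c : ℝ) * Complex.I -
        (((1 : ℝ) + (ξ / √c : ℝ) * Complex.I : ℂ) ^ (β : ℂ) - 1) / β)) atTop
      (𝓝 ((-((1 - β) / 2 * ξ ^ 2) : ℝ) : ℂ)) := by
  have hu : Tendsto (fun c : ℝ => ((ξ / √c : ℝ) : ℂ) * Complex.I) atTop (𝓝 0) := by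
    have h1 : Tendsto (fun c : ℝ => ξ / √c) atTop (𝓝 0) :=
      tendsto_const_nhds.div_atTop Real.tendsto_sqrt_atTop
    have h2 := ((Complex.continuous_ofReal.tendsto 0).comp h1).mul_const Complex.I
    simpa using h2
  rw [Metric.tendsto_nhds]
  intro ε hε
  have hε' : 0 < ε * β / (ξ ^ 2 + 1) := by positivity
  obtain ⟨δ, hδ, hb⟩ := saddle_taylor β hε'
  filter_upwards [(Metric.tendsto_nhds.1 hu) δ hδ, eventually_gt_atTop 0] with c h1 hc
  rw [dist_zero_right] at h1
  have h2 := hb _ h1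
  set u : ℂ := ((ξ / √c : ℝ) : ℂ) * Complex.I with hud
  have hsq : (c : ℂ) * u ^ 2 = -(ξ ^ 2 : ℝ) := by
    have h3 : c * (ξ / √c) ^ 2 = ξ ^ 2 := by
      rw [div_pow, Real.sq_sqrt hc.le]; field_simp
    rw [hud, mul_pow, Complex.I_sq, ← Complex.ofReal_pow, ← mul_assoc, ← Complex.ofReal_mul, h3]
    ring
  have hnu : c * ‖u‖ ^ 2 = ξ ^ 2 := by
    have := congrArg norm hsq
    rwa [norm_mul, norm_pow, norm_neg, Complex.norm_real, Complex.norm_real, Real.norm_eq_abs,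
      Real.norm_eq_abs, abs_of_pos hc, abs_of_nonneg (sq_nonneg ξ)] at this
  have hβc : (β : ℂ) ≠ 0 := by exact_mod_cast hβ.ne'
  have e : (c : ℂ) * (u - (((1 : ℝ) + u : ℂ) ^ (β : ℂ) - 1) / β) -
      ((-((1 - β) / 2 * ξ ^ 2) : ℝ) : ℂ) = (c : ℂ) * (β : ℂ)⁻¹ *
        (β * u - ((1 + u) ^ (β : ℂ) - 1) - β * (1 - β) / 2 * u ^ 2) := by
    have h4 : (((ξ ^ 2 : ℝ)) : ℂ) = -((c : ℂ) * u ^ 2) := by rw [hsq, neg_neg]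
    have h5 : ((-((1 - β) / 2 * ξ ^ 2) : ℝ) : ℂ) = -((1 - β) / 2 * (ξ ^ 2 : ℝ)) := by push_cast; ring
    rw [h5, h4, Complex.ofReal_one]
    field_simp
  rw [dist_eq_norm, e, norm_mul, norm_mul, norm_inv, Complex.norm_real, Complex.norm_real,
    Real.norm_eq_abs, Real.norm_eq_abs, abs_of_pos hc, abs_of_pos hβ]
  calc _ ≤ c * β⁻¹ * (ε * β / (ξ ^ 2 + 1) * ‖u‖ ^ 2) := by gcongr
    _ = ε / (ξ ^ 2 + 1) * (c * ‖u‖ ^ 2) := by field_simp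
    _ = ε * (ξ ^ 2 / (ξ ^ 2 + 1)) := by rw [hnu]; ring
    _ < ε * 1 := by
      refine mul_lt_mul_of_pos_left ?_ hε
      rw [div_lt_one (by positivity)]; linarith
    _ = ε := mul_one _

theorem integrable_exp_neg_min {β k : ℝ} (hβ : 0 < β) (hk : 0 < k) :
    Integrable fun ξ : ℝ => Real.exp (-(k * min (ξ ^ 2) (|ξ| ^ β))) := by
  have i1 : Integrable fun ξ : ℝ => Real.exp (-k * ξ ^ 2) := integrable_exp_neg_mul_sq hk
  have i2 : Integrable fun ξ : ℝ => Real.exp (-k * |ξ| ^ β) := by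
    refine integrable_comp_abs_of_Ioi (f := fun y => Real.exp (-k * y ^ β)) ?_
    simpa using integrableOn_rpow_mul_exp_neg_mul_rpow (s := 0) (by norm_num) hβ hk
  refine (i1.add i2).mono' (by fun_prop) (.of_forall fun ξ => ?_)
  rw [Real.norm_eq_abs, abs_of_pos (Real.exp_pos _), Pi.add_apply]
  have h1 := Real.exp_pos (-k * ξ ^ 2)
  have h2 := Real.exp_pos (-k * |ξ| ^ β)
  rcases min_choice (ξ ^ 2) (|ξ| ^ β) with h | h <;> rw [h, ← neg_mul] <;> linarith

/-- On the scale η = ξ/√c the integrand tends to a Gaussian. The lower bound by min(η², |η|^β)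
survives the scaling for c ≥ 1, because √c^β ≤ c, and gives a majorant independent of c; a ≤ 1
bounds the power of |σ| by 1. -/
theorem tendsto_integral_wrightLine_saddle {β : ℝ} (hβ : 0 < β) (hβ1 : β < 1) {a : ℝ}
    (ha : a ≤ 1) :
    Tendsto (fun c : ℝ => ∫ ξ : ℝ, (Real.exp (c * (1 / β - 1)) : ℂ) *
        wrightLine β a 1 (c / β) c (ξ / √c)) atTop
      (𝓝 (∫ ξ : ℝ, (Real.exp (-((1 - β) / 2 * ξ ^ 2)) : ℂ))) := by
  obtain ⟨k, hk, hkb⟩ := exists_one_add_min_le_linePowRe hβ hβ1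
  refine tendsto_integral_filter_of_dominated_convergence
    (fun ξ : ℝ => Real.exp (-(k / β * min (ξ ^ 2) (|ξ| ^ β)))) ?_ ?_
    (integrable_exp_neg_min hβ (by positivity)) ?_
  · refine .of_forall fun c => (Continuous.aestronglyMeasurable ?_)
    exact continuous_const.mul ((continuous_wrightLine β a (c / β) c one_pos).comp
      (continuous_id.div_const _))
  · filter_upwards [eventually_ge_atTop 1] with c hc
    refine .of_forall fun ξ => ?_
    have hc0 : 0 < c := by linarith
    rw [norm_mul, norm_wrightLine_saddle hβ, Complex.norm_real, Real.norm_eq_abs,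
      abs_of_pos (Real.exp_pos _), ← mul_assoc, ← Real.exp_add, add_neg_cancel, Real.exp_zero,
      one_mul]
    have h1 : 1 ≤ ‖((1 : ℝ) + (ξ / √c : ℝ) * Complex.I : ℂ)‖ := by
      have := Complex.re_le_norm ((1 : ℝ) + (ξ / √c : ℝ) * Complex.I : ℂ)
      rwa [sigma_re] at this
    have h2 : ‖((1 : ℝ) + (ξ / √c : ℝ) * Complex.I : ℂ)‖ ^ (a - 1) ≤ 1 :=
      Real.rpow_le_one_of_one_le_of_nonpos h1 (by linarith)
    have h3 := hkb (ξ / √c)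
    have hsc : 1 ≤ √c := Real.one_le_sqrt.2 hc
    have h4 : min (ξ ^ 2) (|ξ| ^ β) ≤ c * min ((ξ / √c) ^ 2) (|ξ / √c| ^ β) := by
      rw [mul_min_of_nonneg _ _ hc0.le]
      refine min_le_min ?_ ?_
      · rw [div_pow, Real.sq_sqrt hc0.le]; apply le_of_eq; field_simp
      · rw [abs_div, abs_of_pos (by linarith : 0 < √c), Real.div_rpow (abs_nonneg _) (by linarith)]
        have h5 : √c ^ β ≤ c := by
          calc √c ^ β ≤ √c ^ (1 : ℝ) := Real.rpow_le_rpow_of_exponent_le hsc hβ1.le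
            _ = √c := Real.rpow_one _
            _ ≤ c := Real.sqrt_le_iff.2 ⟨hc0.le, by nlinarith⟩
        rw [mul_div_assoc', le_div_iff₀ (by positivity), mul_comm]
        gcongr
    have h6 : k / β * min (ξ ^ 2) (|ξ| ^ β) ≤ c * ((linePowRe β (ξ / √c) - 1) / β) := by
      calc k / β * min (ξ ^ 2) (|ξ| ^ β) ≤ k / β * (c * min ((ξ / √c) ^ 2) (|ξ / √c| ^ β)) := by
            gcongr
        _ = c * ((k * min ((ξ / √c) ^ 2) (|ξ / √c| ^ β)) / β) := by ring
        _ ≤ _ := by gcongr; linarith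
    calc _ ≤ Real.exp (-(k / β * min (ξ ^ 2) (|ξ| ^ β))) * 1 := by
          gcongr
      _ = _ := mul_one _
  · refine .of_forall fun ξ => ?_
    have h1 : Tendsto (fun c : ℝ => ((1 : ℝ) + (ξ / √c : ℝ) * Complex.I : ℂ) ^ ((a - 1 : ℝ) : ℂ))
        atTop (𝓝 1) := by
      have h2 : Tendsto (fun c : ℝ => ξ / √c) atTop (𝓝 0) :=
        tendsto_const_nhds.div_atTop Real.tendsto_sqrt_atTop
      have h3 : ContinuousAt (fun x : ℝ => ((1 : ℝ) + x * Complex.I : ℂ) ^ ((a - 1 : ℝ) : ℂ)) 0 := by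
        have hσ : ContinuousAt (fun x : ℝ => ((1 : ℝ) + x * Complex.I : ℂ)) 0 := by fun_prop
        exact hσ.cpow continuousAt_const (sigma_mem_slitPlane one_pos 0)
      have h4 := h3.tendsto.comp h2
      simpa [Function.comp_def] using h4
    have h2 := ((tendsto_saddle_exponent hβ ξ).cexp).mul h1
    rw [mul_one, ← Complex.ofReal_exp] at h2
    refine h2.congr fun c => ?_
    rw [wrightLine, ← mul_assoc, Complex.ofReal_exp, ← Complex.exp_add]
    congr 2
    have hβc : (β : ℂ) ≠ 0 := by exact_mod_cast hβ.ne'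
    push_cast
    field_simp
    ring

/-- The Wright-type functions decay no faster than `exp (-κ r^γ)`, `γ = 1 / (1 - β)`. -/
theorem exists_le_wrightG {β : ℝ} (hβ : 0 < β) (hβ1 : β < 1) {a : ℝ} (ha : 0 < a) (ha1 : a ≤ 1) :
    ∃ m κ c₀, 0 < m ∧ 0 < κ ∧ ∀ r, 0 < r → c₀ ≤ saddlePoint β r →
      m * Real.exp (-(κ * saddlePoint β r)) ≤ wrightG β a r 1 := by
  have hb : 0 < 1 / β - 1 := by rw [sub_pos, lt_div_iff₀ hβ]; linarith
  set L := ∫ ξ : ℝ, Real.exp (-((1 - β) / 2 * ξ ^ 2)) with hL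
  have hLi : Integrable fun ξ : ℝ => Real.exp (-((1 - β) / 2 * ξ ^ 2)) := by
    simpa [neg_mul] using integrable_exp_neg_mul_sq (by linarith : 0 < (1 - β) / 2)
  have hL0 : 0 < L := by
    rw [hL, integral_pos_iff_support_of_nonneg (fun ξ => (Real.exp_pos _).le) hLi]
    have : (Function.support fun ξ : ℝ => Real.exp (-((1 - β) / 2 * ξ ^ 2))) = univ := by
      ext ξ; simp [(Real.exp_pos _).ne']
    rw [this]; simp
  have h1 := (Complex.continuous_re.tendsto _).comp (tendsto_integral_wrightLine_saddle hβ hβ1 ha1)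
  rw [integral_complex_ofReal, Complex.ofReal_re, ← hL] at h1
  obtain ⟨c₁, hc₁⟩ := eventually_atTop.1 (h1.eventually (le_mem_nhds (half_lt_self hL0)))
  -- The exact rate is 1/β − 1; the additional 1 absorbs the factor √c ≤ exp c from the scaling, and
  -- half of the limit L is kept.
  refine ⟨(2 * Real.pi)⁻¹ * (L / 2), 1 / β - 1 + 1, max c₁ 1, by positivity, by positivity,
    fun r hr hcr => ?_⟩
  set c := saddlePoint β r with hcd
  have hc1 : 1 ≤ c := (le_max_right _ _).trans hcr
  have hc : 0 < c := by linarith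
  rw [← saddlePoint_rpow hβ hβ1 hr, ← hcd, wrightG_eq_saddle hβ hβ1 a hc]
  have hsc : 0 < √c := Real.sqrt_pos.2 hc
  have e1 : (∫ ξ : ℝ, (Real.exp (c * (1 / β - 1)) : ℂ) * wrightLine β a 1 (c / β) c (ξ / √c)).re =
      Real.exp (c * (1 / β - 1)) * √c * (2 * Real.pi) * wrightG β a (c / β) c := by
    have e2 := Measure.integral_comp_div (fun η => wrightLine β a 1 (c / β) c η) √c
    rw [integral_const_mul, e2, wrightG, wrightBromwich,
      show (2 * Real.pi : ℂ)⁻¹ = (((2 * Real.pi)⁻¹ : ℝ) : ℂ) by push_cast; rfl,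
      Complex.re_ofReal_mul, abs_of_pos hsc, Complex.real_smul, Complex.re_ofReal_mul,
      Complex.re_ofReal_mul]
    have := Real.pi_ne_zero
    field_simp
  have h2 := hc₁ c ((le_max_left _ _).trans hcr)
  simp only [Function.comp_apply] at h2
  rw [e1] at h2
  have h3 : √c ≤ Real.exp c := by
    calc √c ≤ c := Real.sqrt_le_iff.2 ⟨hc.le, by nlinarith⟩
      _ ≤ Real.exp c := by linarith [Real.add_one_le_exp c]
  have h4 : 1 ≤ c ^ a := Real.one_le_rpow hc1 ha.le
  set G := wrightG β a (c / β) c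
  have hG : 0 < G := by
    by_contra hn
    have : Real.exp (c * (1 / β - 1)) * √c * (2 * Real.pi) * G ≤ 0 :=
      mul_nonpos_of_nonneg_of_nonpos (by positivity) (not_lt.1 hn)
    linarith
  have h5 : Real.exp (-((1 / β - 1 + 1) * c)) =
      (Real.exp (c * (1 / β - 1)) * Real.exp c)⁻¹ := by
    rw [← Real.exp_add, ← Real.exp_neg]; congr 1; ring
  rw [h5, ← div_eq_mul_inv, div_le_iff₀ (by positivity), mul_comm, ← div_eq_mul_inv,
    div_le_iff₀ (by positivity)]
  calc L / 2 ≤ Real.exp (c * (1 / β - 1)) * √c * (2 * Real.pi) * G := h2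
    _ ≤ Real.exp (c * (1 / β - 1)) * Real.exp c * (2 * Real.pi) * (1 * G) := by
      rw [one_mul]; gcongr
    _ ≤ Real.exp (c * (1 / β - 1)) * Real.exp c * (2 * Real.pi) * (c ^ a * G) := by gcongr
    _ = _ := by ring

end

end FracPDE

/-! ### Normalisation of the density and domination over ranges of times -/

namespace FracPDE

open Set Filter Topology MeasureTheory

noncomputable section

theorem norm_wrightLine_one_le {β : ℝ} (hβ : 0 < β) (hβ1 : β < 1) (a : ℝ) {s : ℝ} (hs : 0 ≤ s)
    (y : ℝ) : ‖wrightLine β a 1 s 1 y‖ ≤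
      Real.exp 1 * ((1 : ℝ) + ‖y‖ ^ 2) ^ (-(1 - a) / 2) := by
  have h1 := re_cpow_ge hβ hβ1 (σ := (1 : ℝ) + y * Complex.I) (by simp)
  have h2 := mul_nonneg (cos_half_pi_mul_pos hβ hβ1).le
    (by positivity : 0 ≤ ‖((1 : ℝ) + y * Complex.I : ℂ)‖ ^ β)
  have h3 : ‖((1 : ℝ) + y * Complex.I : ℂ)‖ ^ (a - 1) =
      ((1 : ℝ) + ‖y‖ ^ 2) ^ (-(1 - a) / 2) := by
    have h4 := norm_sigma_sq 1 y
    rw [one_pow, ← sq_abs y, ← Real.norm_eq_abs] at h4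
    rw [← h4, ← Real.rpow_natCast, ← Real.rpow_mul (norm_nonneg _)]
    congr 1; push_cast; ring
  rw [norm_wrightLine, h3]
  gcongr
  nlinarith

theorem continuous_wrightLine_space (β a c t y : ℝ) :
    Continuous fun s : ℝ => wrightLine β a c s t y := by
  unfold wrightLine; fun_prop

/-- For a < 0 the power |σ|^{a−1} is integrable by itself, so s may tend to 0 under the integral. -/
theorem tendsto_integral_wrightLine {β : ℝ} (hβ : 0 < β) (hβ1 : β < 1) {a : ℝ} (ha : a < 0) :
    Integrable (fun y => wrightLine β a 1 0 1 y) ∧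
    Tendsto (fun s => ∫ y, wrightLine β a 1 s 1 y) (𝓝[>] 0) (𝓝 (∫ y, wrightLine β a 1 0 1 y)) := by
  have hmaj : Integrable fun y : ℝ => Real.exp 1 * ((1 : ℝ) + ‖y‖ ^ 2) ^ (-(1 - a) / 2) :=
    (integrable_rpow_neg_one_add_norm_sq (by rw [Module.finrank_self, Nat.cast_one]; linarith)).const_mul _
  refine ⟨hmaj.mono' (continuous_wrightLine β a 0 1 one_pos).aestronglyMeasurable
    (.of_forall (norm_wrightLine_one_le hβ hβ1 a le_rfl)),
    tendsto_integral_filter_of_dominated_convergence _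
    (.of_forall fun s => (continuous_wrightLine β a s 1 one_pos).aestronglyMeasurable)
    (eventually_nhdsWithin_of_forall fun s (hs : 0 < s) =>
      .of_forall (norm_wrightLine_one_le hβ hβ1 a hs.le)) hmaj
    (.of_forall fun y => ?_)⟩
  exact ((continuous_wrightLine_space β a 1 1 y).tendsto 0).mono_left nhdsWithin_le_nhds

/-- At s = 0 this is Laplace inversion of σ⁻², the transform of v, at v = 1. -/
theorem integral_wrightLine_neg_one {β : ℝ} (hβ : 0 < β) (hβ1 : β < 1) :
    (2 * Real.pi : ℂ)⁻¹ * ∫ y, wrightLine β (-1) 1 0 1 y = 1 := by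
  set q : ℝ → ℝ := fun v => v ^ ((2 : ℝ) - 1) with hq
  have hqi : ∀ ε : ℝ, 0 < ε → IntegrableOn (fun y => Real.exp (-(ε * y)) * q y) (Ioi 0) :=
    fun ε hε => (integrableOn_rpow_mul_exp_neg (α := 2) two_pos hε).congr
      (.of_forall fun y => mul_comm _ _)
  have hd : DifferentiableAt ℝ q 1 := by
    have e : q = id := by funext v; simp only [hq]; norm_num
    rw [e]; exact differentiableAt_id
  have h1 := tendsto_laplaceHalf_inverse hqi (c := 1) (y := 1) one_pos one_pos hd
  have e1 : ∀ ω : ℝ, Complex.exp (((1 : ℝ) + ω * Complex.I) * (1 : ℝ)) *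
      laplaceHalf q ((1 : ℝ) + ω * Complex.I) = wrightLine β (-1) 1 0 1 ω := by
    intro ω
    have h2 := integral_rpow_mul_cexp_neg_mul (α := 2) two_pos
      (z := (1 : ℝ) + ω * Complex.I) (by rw [sigma_re]; exact one_pos)
    rw [laplaceHalf, hq, h2, Real.Gamma_two, wrightLine]
    norm_num
  simp_rw [e1] at h1
  have h2 := (intervalIntegral_tendsto_integral
    (tendsto_integral_wrightLine hβ hβ1 (a := -1) (by norm_num)).1
    tendsto_neg_atTop_atBot tendsto_id).const_mul (2 * Real.pi : ℂ)⁻¹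
  have h3 := tendsto_nhds_unique h2 h1
  rw [h3, hq]; norm_num

/-- The index 0 is not absolutely convergent at s = 0. The recurrence writes it as sβ times index β
− 1 plus index −1, both negative. -/
theorem tendsto_wrightG_zero {β : ℝ} (hβ : 0 < β) (hβ1 : β < 1) :
    Tendsto (fun s => wrightG β 0 s 1) (𝓝[>] 0) (𝓝 1) := by
  have h1 := ((tendsto_integral_wrightLine hβ hβ1 (a := -1) (by norm_num)).2).const_mul
    (2 * Real.pi : ℂ)⁻¹
  rw [integral_wrightLine_neg_one hβ hβ1] at h1
  have h2 := ((tendsto_integral_wrightLine hβ hβ1 (a := 0 + β - 1) (by linarith)).2).const_mul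
    (2 * Real.pi : ℂ)⁻¹
  have h3 := (Complex.continuous_re.tendsto _).comp h1
  have h4 := (Complex.continuous_re.tendsto _).comp h2
  have h5 : Tendsto (fun s : ℝ => s * β) (𝓝[>] 0) (𝓝 0) := by
    have : Continuous fun s : ℝ => s * β := by fun_prop
    simpa using (this.tendsto 0).mono_left (nhdsWithin_le_nhds (s := Ioi 0))
  have h6 := (h5.mul h4).add h3
  rw [zero_mul, zero_add (Complex.re 1), Complex.one_re] at h6
  refine h6.congr' (eventually_nhdsWithin_of_forall fun s (hs : 0 < s) => ?_)
  have h7 := wrightG_relation hβ hβ1 0 1 hs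
  rw [one_mul, zero_sub, neg_one_mul, sub_neg_eq_add] at h7
  exact h7.symm

theorem integrableOn_exp_neg_saddlePoint {β κ : ℝ} (hβ : 0 < β) (hβ1 : β < 1) (hκ : 0 < κ) :
    IntegrableOn (fun r => Real.exp (-(κ * saddlePoint β r))) (Ioi 0) := by
  have h1 := integrableOn_rpow_mul_exp_neg_mul_rpow (s := 0) (p := (1 - β)⁻¹)
    (b := κ * β ^ (1 - β)⁻¹) (by norm_num) (inv_pos.2 (by linarith)) (by positivity)
  refine h1.congr_fun (fun r (hr : 0 < r) => ?_) measurableSet_Ioi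
  simp only [Real.rpow_zero, one_mul, saddlePoint, Real.mul_rpow hβ.le hr.le]
  congr 1; ring

theorem measurable_wrightG {β : ℝ} (hβ : 0 < β) (hβ1 : β < 1) (a t : ℝ) :
    AEStronglyMeasurable (fun s => wrightG β a s t) (volume.restrict (Ioi 0)) :=
  ContinuousOn.aestronglyMeasurable (fun _ hs =>
    (hasDerivAt_wrightG_space hβ hβ1 a t hs).continuousAt.continuousWithinAt) measurableSet_Ioi

theorem integrableOn_wrightG_one {β : ℝ} (hβ : 0 < β) (hβ1 : β < 1) {a : ℝ} (ha : 0 < a) :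
    IntegrableOn (fun r => wrightG β a r 1) (Ioi 0) := by
  obtain ⟨C, κ, _, hκ, hb⟩ := exists_abs_wrightG_le hβ hβ1 ha
  exact ((integrableOn_exp_neg_saddlePoint hβ hβ1 hκ).const_mul C).mono'
    (measurable_wrightG hβ hβ1 a 1)
    ((ae_restrict_iff' measurableSet_Ioi).2 (.of_forall hb))

theorem tendsto_saddlePoint {β : ℝ} (hβ : 0 < β) (hβ1 : β < 1) :
    Tendsto (saddlePoint β) atTop atTop :=
  (tendsto_rpow_atTop (inv_pos.2 (by linarith))).comp (tendsto_id.const_mul_atTop hβ)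

theorem tendsto_wrightG_atTop {β : ℝ} (hβ : 0 < β) (hβ1 : β < 1) :
    Tendsto (fun r => wrightG β 0 r 1) atTop (𝓝 0) := by
  obtain ⟨C, _, hC⟩ := exists_norm_wrightLine_le hβ hβ1 0 1 1 one_pos one_pos
  have h1 : Tendsto (fun r => ∫ y, wrightLine β 0 1 r 1 y) atTop (𝓝 (∫ _ : ℝ, (0 : ℂ))) := by
    refine tendsto_integral_filter_of_dominated_convergence (fun y => C * (1 + y ^ 2)⁻¹)
      (.of_forall fun r => (continuous_wrightLine β 0 r 1 one_pos).aestronglyMeasurable) ?_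
      (integrable_inv_one_add_sq.const_mul C) (.of_forall fun y => ?_)
    · filter_upwards [eventually_ge_atTop 1] with r hr
      exact .of_forall fun y => hC 1 r 1 y le_rfl le_rfl hr (by simp)
    · rw [tendsto_zero_iff_norm_tendsto_zero]
      simp_rw [norm_wrightLine]
      have h2 : 0 < (((1 : ℝ) + y * Complex.I : ℂ) ^ (β : ℂ)).re := by
        have h3 := one_add_le_linePowRe hβ hβ1 y
        have h4 : 0 ≤ β * (1 - β) / 2 * (y ^ 2 / (1 + y ^ 2)) := by
          have : 0 < 1 - β := by linarith
          positivity
        rw [linePowRe] at h3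
        linarith
      have h5 : Tendsto (fun r : ℝ => (1 : ℝ) * 1 -
          r * (((1 : ℝ) + y * Complex.I : ℂ) ^ (β : ℂ)).re) atTop atBot :=
        tendsto_atBot_add_const_left _ _
          (tendsto_neg_atTop_atBot.comp (tendsto_id.atTop_mul_const h2))
      simpa using (Real.tendsto_exp_atBot.comp h5).mul_const
        (‖((1 : ℝ) + y * Complex.I : ℂ)‖ ^ ((0 : ℝ) - 1))
  have h2 := (Complex.continuous_re.tendsto _).comp (h1.const_mul (2 * Real.pi : ℂ)⁻¹)
  rw [integral_zero, mul_zero, Complex.zero_re] at h2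
  exact h2

/-- The kernel of index β is −∂_s of the kernel of index 0, which runs from 1 at s = 0 to 0 at
infinity. -/
theorem integral_wrightG_one {β : ℝ} (hβ : 0 < β) (hβ1 : β < 1) :
    ∫ r in Ioi (0 : ℝ), wrightG β β r 1 = 1 := by
  -- The value at 0 is set to the limit, to make the primitive continuous up to the endpoint.
  set Φ : ℝ → ℝ := fun r => if r = 0 then -1 else -wrightG β 0 r 1 with hΦ
  have h0 : Φ 0 = -1 := if_pos rfl
  have he : EqOn Φ (fun r => -wrightG β 0 r 1) (Ioi 0) := fun r hr => if_neg (ne_of_gt hr)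
  have h := integral_Ioi_of_hasDerivAt_of_tendsto (f := Φ) (f' := fun r => wrightG β β r 1)
    (a := 0) (m := 0) ?_ (fun r hr => ?_) (integrableOn_wrightG_one hβ hβ1 hβ) ?_
  · rw [h, h0]; norm_num
  · rw [← continuousWithinAt_Ioi_iff_Ici, ContinuousWithinAt, h0]
    exact ((tendsto_wrightG_zero hβ hβ1).neg).congr' (he.symm.eventuallyEq_of_mem self_mem_nhdsWithin)
  · have h1 := (hasDerivAt_wrightG_space hβ hβ1 0 1 hr).neg
    rw [neg_neg, zero_add] at h1
    exact h1.congr_of_eventuallyEq (he.eventuallyEq_of_mem (Ioi_mem_nhds hr))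
  · have h1 := (tendsto_wrightG_atTop hβ hβ1).neg
    rw [neg_zero] at h1
    exact h1.congr' (he.symm.eventuallyEq_of_mem (Ioi_mem_atTop 0))

theorem integral_wrightG_density {β : ℝ} (hβ : 0 < β) (hβ1 : β < 1) {t : ℝ} (ht : 0 < t) :
    ∫ s in Ioi (0 : ℝ), wrightG β β s t = 1 := by
  have ht' : 0 < t ^ (-β) := by positivity
  rw [setIntegral_congr_fun measurableSet_Ioi
    (g := fun s => t ^ (-β) * wrightG β β (s * t ^ (-β)) 1)
    fun s (hs : 0 < s) => wrightG_scale hβ hβ1 β hs ht, integral_const_mul,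
    integral_comp_mul_right_Ioi (fun r => wrightG β β r 1) 0 ht', zero_mul,
    integral_wrightG_one hβ hβ1, smul_eq_mul, mul_one, mul_inv_cancel₀ ht'.ne']

theorem integrableOn_wrightG {β : ℝ} (hβ : 0 < β) (hβ1 : β < 1) {a : ℝ} (ha : 0 < a) {t : ℝ}
    (ht : 0 < t) : IntegrableOn (fun s => wrightG β a s t) (Ioi 0) := by
  have ht' : 0 < t ^ (-β) := by positivity
  have h1 := ((integrableOn_Ioi_comp_mul_right_iff (fun r => wrightG β a r 1) 0 ht').2
    (by rw [zero_mul]; exact integrableOn_wrightG_one hβ hβ1 ha)).const_mul (t ^ (-a))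
  exact IntegrableOn.congr_fun h1 (fun s (hs : 0 < s) => (wrightG_scale hβ hβ1 a hs ht).symm)
    measurableSet_Ioi

theorem saddlePoint_mul {β : ℝ} (hβ : 0 < β) {r l : ℝ} (hr : 0 < r) (hl : 0 < l) :
    saddlePoint β (r * l) = saddlePoint β r * l ^ (1 - β)⁻¹ := by
  rw [saddlePoint, saddlePoint, ← mul_assoc, Real.mul_rpow (by positivity) hl.le]

/-- A function of `s` alone that dominates the Wright-type functions for all small times. -/
def domKernel (β S T s : ℝ) : ℝ :=
  if s ≤ S then s ^ (-(5 / 4) : ℝ) else |wrightG β β s T|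

theorem exists_exp_neg_le_rpow {κ p : ℝ} (hκ : 0 < κ) (hp : 0 < p) :
    ∃ K, 0 < K ∧ ∀ c, 0 < c → Real.exp (-(κ * c)) ≤ K * c ^ (-p) := by
  obtain ⟨M, hM⟩ := eventually_atTop.1 ((tendsto_rpow_mul_exp_neg_mul_atTop_nhds_zero p κ
    hκ).eventually (ge_mem_nhds one_pos))
  refine ⟨max 1 (max M 1 ^ p), by positivity, fun c hc => ?_⟩
  rw [Real.rpow_neg hc.le, ← div_eq_mul_inv, le_div_iff₀ (by positivity), mul_comm]
  rcases le_total M c with h | h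
  · exact le_max_of_le_left (by simpa [neg_mul] using hM c h)
  · refine le_max_of_le_right ?_
    have h1 : Real.exp (-(κ * c)) ≤ 1 := Real.exp_le_one_iff.2 (by
      have : 0 < κ * c := by positivity
      linarith)
    have h2 : c ^ p ≤ max M 1 ^ p := by
      gcongr; exact h.trans (le_max_left _ _)
    have h3 : 0 < c ^ p := by positivity
    nlinarith

/-- For large s the upper bound at all times τ ≤ T lies below the lower bound for the density at one
later time T', so integrability against that density covers every index and every τ ≤ T. For small s
a power is used: s^{−5/4} times √s is integrable at 0, and the accompanying τ^{5β/4−a} has exponent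
above −1 for a = β + 1. -/
theorem exists_abs_wrightG_le_domKernel {β : ℝ} (hβ : 0 < β) (hβ1 : β < 1) {a : ℝ} (ha : 0 < a)
    {T : ℝ} (hT : 0 < T) : ∃ C S T', 0 ≤ C ∧ 0 < S ∧ 0 < T' ∧ ∀ s τ, 0 < s → 0 < τ → τ ≤ T →
      |wrightG β a s τ| ≤ C * τ ^ (5 * β / 4 - a) * domKernel β S T' s := by
  obtain ⟨C, κ, hC, hκ, hup⟩ := exists_abs_wrightG_le hβ hβ1 ha
  obtain ⟨m, κ', c₀, hm, hκ', hlow⟩ := exists_le_wrightG hβ hβ1 hβ hβ1.le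
  have hγ : 0 < (1 - β)⁻¹ := inv_pos.2 (by linarith)
  -- The saddle point is (βr)^{1/(1−β)}, so its power −(1−β)·5/4 is (βr)^{−5/4}.
  obtain ⟨K₀, hK₀, hexp⟩ := exists_exp_neg_le_rpow (half_pos hκ)
    (mul_pos (by linarith : 0 < 1 - β) (by norm_num : (0 : ℝ) < 5 / 4))
  set K := K₀ * β ^ (-(5 / 4) : ℝ) with hK
  have hK0 : 0 < K := by positivity
  have hexp' : ∀ r, 0 < r → Real.exp (-(κ / 2 * saddlePoint β r)) ≤ K * r ^ (-(5 / 4) : ℝ) := by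
    intro r hr
    refine (hexp _ (saddlePoint_pos hβ hr)).trans (le_of_eq ?_)
    rw [saddlePoint, ← Real.rpow_mul (by positivity), hK, mul_assoc,
      ← Real.mul_rpow hβ.le hr.le]
    congr 2
    have : (1 - β) ≠ 0 := by linarith
    field_simp
  -- The rate in s at time τ is proportional to τ^{−β/(1−β)}, so a large T' makes the lower-bound
  -- rate at T' at most half of the upper-bound rate at T.
  obtain ⟨T', hT', hT'κ⟩ : ∃ T', 0 < T' ∧
      κ' * (T' ^ (-β)) ^ (1 - β)⁻¹ ≤ κ / 2 * (T ^ (-β)) ^ (1 - β)⁻¹ := by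
    have h1 : Tendsto (fun x : ℝ => κ' * (x ^ (-β)) ^ (1 - β)⁻¹) atTop (𝓝 (κ' * 0)) := by
      refine Tendsto.const_mul _ ?_
      have h2 : Tendsto (fun x : ℝ => x ^ (-(β * (1 - β)⁻¹))) atTop (𝓝 0) :=
        tendsto_rpow_neg_atTop (by positivity)
      refine h2.congr' ?_
      filter_upwards [eventually_gt_atTop 0] with x hx
      rw [← Real.rpow_mul hx.le]; ring_nf
    rw [mul_zero] at h1
    have h3 : 0 < κ / 2 * (T ^ (-β)) ^ (1 - β)⁻¹ := by positivity
    obtain ⟨x, h4, h5⟩ := ((h1.eventually (ge_mem_nhds h3)).and (eventually_gt_atTop 0)).exists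
    exact ⟨x, h5, h4⟩
  have hTβ : 0 < T' ^ (-β) := by positivity
  obtain ⟨S, hS, hSc⟩ : ∃ S, 0 < S ∧ ∀ s, S ≤ s → c₀ ≤ saddlePoint β (s * T' ^ (-β)) := by
    have h1 := (tendsto_saddlePoint hβ hβ1).comp (tendsto_id.atTop_mul_const hTβ)
    obtain ⟨M, hM⟩ := eventually_atTop.1 (h1.eventually_ge_atTop c₀)
    exact ⟨max M 1, by positivity, fun s hs => hM s ((le_max_left _ _).trans hs)⟩
  set q := S ^ (-(5 / 4) : ℝ) * (T' ^ (-β) * m)⁻¹ with hq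
  have hq0 : 0 < q := by positivity
  refine ⟨C * K * (1 + q), S, T', by positivity, hS, hT', fun s τ hs hτ hτT => ?_⟩
  have hτβ : 0 < τ ^ (-β) := by positivity
  set r := s * τ ^ (-β) with hr
  have hr0 : 0 < r := by positivity
  have hrp : r ^ (-(5 / 4) : ℝ) = s ^ (-(5 / 4) : ℝ) * τ ^ (5 * β / 4) := by
    rw [hr, Real.mul_rpow hs.le hτβ.le, ← Real.rpow_mul hτ.le]; congr 2; ring
  have hτp : τ ^ (5 * β / 4 - a) = τ ^ (-a) * τ ^ (5 * β / 4) := by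
    rw [← Real.rpow_add hτ]; congr 1; ring
  have hsplit : Real.exp (-(κ * saddlePoint β r)) =
      Real.exp (-(κ / 2 * saddlePoint β r)) * Real.exp (-(κ / 2 * saddlePoint β r)) := by
    rw [← Real.exp_add]; congr 1; ring
  have hle1 : Real.exp (-(κ / 2 * saddlePoint β r)) ≤ 1 := Real.exp_le_one_iff.2 (by
    have := saddlePoint_pos hβ hr0
    have : 0 < κ / 2 * saddlePoint β r := by positivity
    linarith)
  have hG : |wrightG β a s τ| ≤ C * K * (τ ^ (5 * β / 4 - a) * s ^ (-(5 / 4) : ℝ)) *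
      Real.exp (-(κ / 2 * saddlePoint β r)) := by
    rw [wrightG_scale hβ hβ1 a hs hτ, abs_mul, abs_of_pos (by positivity : 0 < τ ^ (-a)), ← hr]
    calc τ ^ (-a) * |wrightG β a r 1| ≤ τ ^ (-a) * (C * (Real.exp (-(κ / 2 * saddlePoint β r)) *
          Real.exp (-(κ / 2 * saddlePoint β r)))) := by
          rw [← hsplit]; gcongr; exact hup r hr0
      _ ≤ τ ^ (-a) * (C * (K * r ^ (-(5 / 4) : ℝ) * Real.exp (-(κ / 2 * saddlePoint β r)))) := by
          gcongr; exact hexp' r hr0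
      _ = _ := by rw [hrp, hτp]; ring
  refine hG.trans ?_
  have hs54 : 0 < s ^ (-(5 / 4) : ℝ) := by positivity
  have hτ54 : 0 < τ ^ (5 * β / 4 - a) := by positivity
  unfold domKernel
  split_ifs with h
  · calc _ ≤ C * K * (τ ^ (5 * β / 4 - a) * s ^ (-(5 / 4) : ℝ)) * 1 := by gcongr
      _ = C * K * 1 * τ ^ (5 * β / 4 - a) * s ^ (-(5 / 4) : ℝ) := by ring
      _ ≤ _ := by gcongr; linarith
  · have hSs : S ≤ s := (not_le.1 h).le
    have h1 : s ^ (-(5 / 4) : ℝ) ≤ S ^ (-(5 / 4) : ℝ) :=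
      Real.rpow_le_rpow_of_nonpos hS hSs (by norm_num)
    have h2 : Real.exp (-(κ / 2 * saddlePoint β r)) ≤ (T' ^ (-β) * m)⁻¹ * |wrightG β β s T'| := by
      rw [inv_mul_eq_div, le_div_iff₀ (by positivity), wrightG_scale hβ hβ1 β hs hT']
      refine le_trans ?_ (le_abs_self _)
      rw [mul_comm, mul_assoc]
      refine mul_le_mul_of_nonneg_left (le_trans ?_ (hlow _ (by positivity) (hSc s hSs))) hTβ.le
      refine mul_le_mul_of_nonneg_left (Real.exp_le_exp.2 ?_) hm.le
      rw [hr, saddlePoint_mul hβ hs hτβ, saddlePoint_mul hβ hs hTβ]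
      have h3 : (T ^ (-β)) ^ (1 - β)⁻¹ ≤ (τ ^ (-β)) ^ (1 - β)⁻¹ := by
        refine Real.rpow_le_rpow (by positivity) ?_ hγ.le
        exact Real.rpow_le_rpow_of_nonpos hτ hτT (by linarith)
      have h4 := saddlePoint_pos hβ hs
      have h5 : κ' * (T' ^ (-β)) ^ (1 - β)⁻¹ ≤ κ / 2 * (τ ^ (-β)) ^ (1 - β)⁻¹ :=
        hT'κ.trans (mul_le_mul_of_nonneg_left h3 (by positivity))
      nlinarith
    calc _ ≤ C * K * (τ ^ (5 * β / 4 - a) * S ^ (-(5 / 4) : ℝ)) *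
          ((T' ^ (-β) * m)⁻¹ * |wrightG β β s T'|) := by gcongr
      _ = C * K * q * τ ^ (5 * β / 4 - a) * |wrightG β β s T'| := by rw [hq]; ring
      _ ≤ _ := by gcongr; linarith

end

end FracPDE

/-! ### The subordination transform in time and its Caputo derivative -/

namespace FracPDE

open Set Filter Topology MeasureTheory

noncomputable section

/-- Functions of time for which the Wright-type transform can be differentiated. -/
structure WrightTame (β : ℝ) (d : ℝ → ℝ) : Prop where
  cont : ContinuousOn d (Ioi 0)
  small : ∀ S, 0 < S → ∃ B, 0 ≤ B ∧ ∀ s, 0 < s → s ≤ S → |d s| ≤ B * √s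
  integrableOn : ∀ t, 0 < t → IntegrableOn (fun s => d s * wrightG β β s t) (Ioi 0)

/-- The transform of `d` with respect to `wrightG β a`. -/
def wrightInt (β a : ℝ) (d : ℝ → ℝ) (t : ℝ) : ℝ := ∫ s in Ioi (0 : ℝ), d s * wrightG β a s t

variable {β : ℝ} {d : ℝ → ℝ}

theorem WrightTame.integrableOn_abs_mul_domKernel (hd : WrightTame β d) {S T : ℝ} (hS : 0 < S)
    (hT : 0 < T) : IntegrableOn (fun s => |d s| * domKernel β S T s) (Ioi 0) := by
  rw [← Ioc_union_Ioi_eq_Ioi hS.le]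
  refine IntegrableOn.union ?_ ?_
  · obtain ⟨B, hB, hb⟩ := hd.small S hS
    have h1 : IntegrableOn (fun s : ℝ => s ^ (-(3 / 4) : ℝ)) (Ioc 0 S) :=
      (intervalIntegrable_iff_integrableOn_Ioc_of_le hS.le).1
        (intervalIntegral.intervalIntegrable_rpow' (by norm_num))
    have h2 : IntegrableOn (fun s => |d s| * s ^ (-(5 / 4) : ℝ)) (Ioc 0 S) := by
      refine (h1.const_mul B).mono' ?_ ?_
      · refine ContinuousOn.aestronglyMeasurable ?_ measurableSet_Ioc
        exact (hd.cont.mono Ioc_subset_Ioi_self).abs.mul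
          (continuousOn_id.rpow_const fun s hs => Or.inl (ne_of_gt hs.1))
      · refine (ae_restrict_iff' measurableSet_Ioc).2 (.of_forall fun s hs => ?_)
        have h0 := hs.1
        rw [Real.norm_eq_abs, abs_of_nonneg (by positivity)]
        calc |d s| * s ^ (-(5 / 4) : ℝ) ≤ B * √s * s ^ (-(5 / 4) : ℝ) := by
              gcongr; exact hb s hs.1 hs.2
          _ = B * (s ^ (1 / 2 : ℝ) * s ^ (-(5 / 4) : ℝ)) := by rw [Real.sqrt_eq_rpow, mul_assoc]
          _ = _ := by rw [← Real.rpow_add h0]; norm_num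
    exact IntegrableOn.congr_fun h2 (fun s hs => by simp only [domKernel, if_pos hs.2])
      measurableSet_Ioc
  · have h1 : IntegrableOn (fun s => |d s * wrightG β β s T|) (Ioi S) :=
      ((hd.integrableOn T hT).mono_set (Ioi_subset_Ioi hS.le)).abs
    exact IntegrableOn.congr_fun h1
      (fun s (hs : S < s) => by simp only [domKernel, if_neg (not_le.2 hs), abs_mul])
      measurableSet_Ioi

theorem WrightTame.aestronglyMeasurable (hd : WrightTame β d) (hβ : 0 < β) (hβ1 : β < 1)
    (a t : ℝ) : AEStronglyMeasurable (fun s => d s * wrightG β a s t)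
      (volume.restrict (Ioi 0)) :=
  (hd.cont.aestronglyMeasurable measurableSet_Ioi).mul (measurable_wrightG hβ hβ1 a t)

theorem WrightTame.exists_dom (hd : WrightTame β d) (hβ : 0 < β) (hβ1 : β < 1) {a : ℝ}
    (ha : 0 < a) {T : ℝ} (hT : 0 < T) : ∃ m : ℝ → ℝ, IntegrableOn m (Ioi 0) ∧
      ∀ s τ, 0 < s → 0 < τ → τ ≤ T → |d s * wrightG β a s τ| ≤ τ ^ (5 * β / 4 - a) * m s := by
  obtain ⟨C, S, T', hC, hS, hT', hb⟩ := exists_abs_wrightG_le_domKernel hβ hβ1 ha hT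
  refine ⟨fun s => C * (|d s| * domKernel β S T' s),
    (hd.integrableOn_abs_mul_domKernel hS hT').const_mul C, fun s τ hs hτ hτT => ?_⟩
  rw [abs_mul]
  calc |d s| * |wrightG β a s τ| ≤ |d s| * (C * τ ^ (5 * β / 4 - a) * domKernel β S T' s) := by
        gcongr; exact hb s τ hs hτ hτT
    _ = _ := by ring

theorem WrightTame.integrableOn_mul (hd : WrightTame β d) (hβ : 0 < β) (hβ1 : β < 1) {a : ℝ}
    (ha : 0 < a) {t : ℝ} (ht : 0 < t) : IntegrableOn (fun s => d s * wrightG β a s t) (Ioi 0) := by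
  obtain ⟨m, hm, hb⟩ := hd.exists_dom hβ hβ1 ha ht
  exact (hm.const_mul _).mono' (hd.aestronglyMeasurable hβ hβ1 a t)
    ((ae_restrict_iff' measurableSet_Ioi).2 (.of_forall fun s hs => hb s t hs ht le_rfl))

theorem WrightTame.exists_abs_wrightInt_le (hd : WrightTame β d) (hβ : 0 < β) (hβ1 : β < 1) {a : ℝ}
    (ha : 0 < a) {T : ℝ} (hT : 0 < T) : ∃ C, 0 ≤ C ∧ ∀ t, 0 < t → t ≤ T →
      |wrightInt β a d t| ≤ C * t ^ (5 * β / 4 - a) := by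
  obtain ⟨m, hm, hb⟩ := hd.exists_dom hβ hβ1 ha hT
  have h0 : ∀ s, 0 < s → 0 ≤ m s := fun s hs => by
    have h1 := (abs_nonneg _).trans (hb s T hs hT le_rfl)
    exact nonneg_of_mul_nonneg_right h1 (by positivity)
  refine ⟨∫ s in Ioi (0 : ℝ), m s, setIntegral_nonneg measurableSet_Ioi h0, fun t ht htT => ?_⟩
  rw [mul_comm, ← integral_const_mul]
  exact norm_integral_le_of_norm_le (f := fun s => d s * wrightG β a s t) (hm.const_mul _)
    ((ae_restrict_iff' measurableSet_Ioi).2 (.of_forall fun s hs => hb s t hs ht htT))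

theorem WrightTame.hasDerivAt_wrightInt (hd : WrightTame β d) (hβ : 0 < β) (hβ1 : β < 1) {a : ℝ}
    (ha : 0 < a) {t : ℝ} (ht : 0 < t) :
    HasDerivAt (wrightInt β a d) (wrightInt β (a + 1) d t) t := by
  obtain ⟨m, hm, hb⟩ := hd.exists_dom hβ hβ1 (by linarith : 0 < a + 1) (by linarith : 0 < 2 * t)
  set p := 5 * β / 4 - (a + 1)
  have h0 : ∀ s, 0 < s → 0 ≤ m s := fun s hs => by
    have h1 := (abs_nonneg _).trans (hb s t hs ht (by linarith))
    exact nonneg_of_mul_nonneg_right h1 (by positivity)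
  refine (hasDerivAt_integral_of_dominated_loc_of_deriv_le (μ := volume.restrict (Ioi (0 : ℝ)))
    (F := fun t s => d s * wrightG β a s t) (F' := fun t s => d s * wrightG β (a + 1) s t)
    -- The sum of the two endpoint powers dominates τ^p whichever sign p has.
    (s := Ioo (t / 2) (2 * t)) (bound := fun s => ((t / 2) ^ p + (2 * t) ^ p) * m s)
    (Ioo_mem_nhds (by linarith) (by linarith))
    (.of_forall fun τ => hd.aestronglyMeasurable hβ hβ1 a τ) (hd.integrableOn_mul hβ hβ1 ha ht)
    (hd.aestronglyMeasurable hβ hβ1 (a + 1) t) ?_ (hm.const_mul _) ?_).2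
  · refine (ae_restrict_iff' measurableSet_Ioi).2 (.of_forall fun s hs τ hτ => ?_)
    have hτ0 : 0 < τ := by linarith [hτ.1]
    refine (hb s τ hs hτ0 hτ.2.le).trans (mul_le_mul_of_nonneg_right ?_ (h0 s hs))
    have h1 : 0 < (t / 2) ^ p := by positivity
    have h2 : 0 < (2 * t) ^ p := by positivity
    rcases le_total 0 p with hp | hp
    · have := Real.rpow_le_rpow hτ0.le hτ.2.le hp
      linarith
    · have := Real.rpow_le_rpow_of_nonpos (by linarith) hτ.1.le hp
      linarith
  · exact (ae_restrict_iff' measurableSet_Ioi).2 (.of_forall fun s hs τ _ =>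
      (hasDerivAt_wrightG_time hβ hβ1 a τ hs).const_mul (d s))

theorem integrableOn_sub_rpow_mul_rpow {p q t : ℝ} (hp : -1 < p) (hq : -1 < q) (ht : 0 < t) :
    IntegrableOn (fun τ : ℝ => (t - τ) ^ q * τ ^ p) (Ioo 0 t) := by
  have h2 : 0 < t / 2 := half_pos ht
  have i1 : IntervalIntegrable (fun τ : ℝ => (t - τ) ^ q * τ ^ p) volume 0 (t / 2) := by
    refine (intervalIntegral.intervalIntegrable_rpow' hp).continuousOn_mul ?_
    rw [uIcc_of_le h2.le]
    exact (by fun_prop : ContinuousOn (fun τ : ℝ => t - τ) _).rpow_const fun τ hτ =>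
      Or.inl (by linarith [hτ.2])
  have i2 : IntervalIntegrable (fun τ : ℝ => (t - τ) ^ q * τ ^ p) volume (t / 2) t := by
    have h3 : IntervalIntegrable (fun τ : ℝ => (t - τ) ^ q) volume (t / 2) t := by
      have h4 := (intervalIntegral.intervalIntegrable_rpow' (a := t - t / 2) (b := t - t)
        hq).comp_sub_left t
      simpa using h4
    refine h3.mul_continuousOn ?_
    rw [uIcc_of_le (by linarith)]
    exact continuousOn_id.rpow_const fun τ hτ =>
      Or.inl (ne_of_gt (h2.trans_le hτ.1))
  exact ((intervalIntegrable_iff_integrableOn_Ioo_of_le ht.le).1 (i1.trans i2))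

theorem WrightTame.integrableOn_sub_rpow_mul_wrightInt (hd : WrightTame β d) (hβ : 0 < β)
    (hβ1 : β < 1) {a q t : ℝ} (ha : 0 < a) (haβ : a < 5 * β / 4 + 1) (hq : -1 < q) (ht : 0 < t) :
    IntegrableOn (fun τ => (t - τ) ^ q * wrightInt β a d τ) (Ioo 0 t) := by
  obtain ⟨C, hC, hb⟩ := hd.exists_abs_wrightInt_le hβ hβ1 ha ht
  refine ((integrableOn_sub_rpow_mul_rpow (p := 5 * β / 4 - a) (by linarith) hq ht).const_mul
    C).mono' ?_ ?_
  · refine ContinuousOn.aestronglyMeasurable ?_ measurableSet_Ioo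
    refine ((by fun_prop : ContinuousOn (fun τ : ℝ => t - τ) _).rpow_const fun τ hτ =>
      Or.inl (by linarith [hτ.2])).mul fun τ hτ =>
        (hd.hasDerivAt_wrightInt hβ hβ1 ha hτ.1).continuousAt.continuousWithinAt
  · refine (ae_restrict_iff' measurableSet_Ioo).2 (.of_forall fun τ hτ => ?_)
    have h1 : 0 < (t - τ) ^ q := Real.rpow_pos_of_pos (by linarith [hτ.2]) q
    rw [norm_mul, Real.norm_eq_abs, Real.norm_eq_abs, abs_of_pos h1, mul_left_comm]
    exact mul_le_mul_of_nonneg_left (hb τ hτ.1 hτ.2.le) h1.le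

/-- Fubini carries the index shift of the kernel over to the transform; a < 5β/4 + 1 is
integrability of the majorant at τ = 0. -/
theorem WrightTame.setIntegral_sub_rpow_mul_wrightInt (hd : WrightTame β d) (hβ : 0 < β)
    (hβ1 : β < 1) {a α t : ℝ} (ha : 0 < a) (haβ : a < 5 * β / 4 + 1) (hα : 0 < α) (ht : 0 < t) :
    ∫ τ in Ioo (0 : ℝ) t, (t - τ) ^ (α - 1) * wrightInt β a d τ =
      Real.Gamma α * wrightInt β (a - α) d t := by
  obtain ⟨m, hm, hb⟩ := hd.exists_dom hβ hβ1 ha ht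
  set f : ℝ → ℝ → ℝ := fun τ s => (t - τ) ^ (α - 1) * (d s * wrightG β a s τ) with hf
  have hi : Integrable (Function.uncurry f)
      ((volume.restrict (Ioo 0 t)).prod (volume.restrict (Ioi 0))) := by
    have hmaj := (integrableOn_sub_rpow_mul_rpow (p := 5 * β / 4 - a) (q := α - 1) (by linarith)
      (by linarith) ht).mul_prod hm
    rw [Measure.prod_restrict] at hmaj ⊢
    refine hmaj.mono' ?_ ?_
    · refine ContinuousOn.aestronglyMeasurable ?_ (measurableSet_Ioo.prod measurableSet_Ioi)
      have c1 : ContinuousOn (fun x : ℝ × ℝ => (t - x.1) ^ (α - 1)) (Ioo 0 t ×ˢ Ioi 0) :=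
        (by fun_prop : ContinuousOn (fun x : ℝ × ℝ => t - x.1) _).rpow_const fun x hx =>
          Or.inl (by linarith [hx.1.2])
      have c2 : ContinuousOn (fun x : ℝ × ℝ => d x.2) (Ioo 0 t ×ˢ Ioi 0) :=
        ContinuousOn.comp (g := d) (f := fun x : ℝ × ℝ => x.2) hd.cont continuousOn_snd
          fun x hx => hx.2
      have c3 : ContinuousOn (fun x : ℝ × ℝ => wrightG β a x.2 x.1) (Ioo 0 t ×ˢ Ioi 0) :=
        ContinuousOn.comp (g := fun x : ℝ × ℝ => wrightG β a x.1 x.2)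
          (f := fun x : ℝ × ℝ => (x.2, x.1)) (continuousOn_wrightG hβ hβ1 a) (by fun_prop)
          fun x hx => ⟨hx.2, mem_univ _⟩
      exact c1.mul (c2.mul c3)
    · refine (ae_restrict_iff' (measurableSet_Ioo.prod measurableSet_Ioi)).2
        (.of_forall fun x hx => ?_)
      have h1 : 0 < (t - x.1) ^ (α - 1) := Real.rpow_pos_of_pos (by linarith [hx.1.2]) _
      simp only [Function.uncurry, hf]
      rw [norm_mul, Real.norm_eq_abs, Real.norm_eq_abs, abs_of_pos h1, mul_assoc]
      exact mul_le_mul_of_nonneg_left (hb x.2 x.1 hx.2 hx.1.1 hx.1.2.le) h1.le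
  have h1 := integral_integral_swap hi
  have h2 : ∀ τ, ∫ s in Ioi (0 : ℝ), f τ s = (t - τ) ^ (α - 1) * wrightInt β a d τ :=
    fun τ => integral_const_mul _ _
  simp_rw [h2] at h1
  rw [h1, wrightInt, ← integral_const_mul]
  refine setIntegral_congr_fun measurableSet_Ioi fun s hs => ?_
  simp only [hf]
  rw [← mul_left_comm, ← setIntegral_Ioo_rpow_mul_wrightG hβ hβ1 a hα hs ht, ← integral_const_mul]
  refine integral_congr_ae (.of_forall fun τ => ?_)
  simp only []
  ring

theorem WrightTame.tendsto_wrightInt (hd : WrightTame β d) (hβ : 0 < β) (hβ1 : β < 1) :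
    Tendsto (wrightInt β β d) (𝓝[>] 0) (𝓝 0) := by
  obtain ⟨C, hC, hb⟩ := hd.exists_abs_wrightInt_le hβ hβ1 hβ one_pos
  have h1 : Tendsto (fun t : ℝ => C * t ^ (5 * β / 4 - β)) (𝓝[>] 0) (𝓝 0) := by
    have h2 : ContinuousAt (fun t : ℝ => C * t ^ (5 * β / 4 - β)) 0 :=
      continuousAt_const.mul (Real.continuousAt_rpow_const _ _ (Or.inr (by linarith)))
    have h3 := h2.tendsto
    rw [Real.zero_rpow (by linarith), mul_zero] at h3
    exact h3.mono_left nhdsWithin_le_nhds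
  refine squeeze_zero_norm' ?_ h1
  filter_upwards [Ioc_mem_nhdsGT one_pos] with t ht
  exact hb t ht.1 ht.2

/-- The transform of `ψ + d(s)` against the density solves the time-fractional relation. -/
theorem WrightTame.caputo_eq (hd : WrightTame β d) (hβ : 0 < β) (hβ1 : β < 1) {v : ℝ → ℝ} {ψ t : ℝ}
    (hv : ∀ τ, 0 < τ → v τ = ψ + wrightInt β β d τ) (ht : 0 < t) :
    IntegrableOn (fun τ => (t - τ) ^ (-β) * deriv v τ) (Ioo 0 t) ∧
      caputo β v t = wrightInt β (2 * β) d t := by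
  have hder : ∀ τ, 0 < τ → deriv v τ = wrightInt β (β + 1) d τ := fun τ hτ => by
    have h1 := (hd.hasDerivAt_wrightInt hβ hβ1 hβ hτ).const_add ψ
    refine (h1.congr_of_eventuallyEq ?_).deriv
    filter_upwards [Ioi_mem_nhds hτ] with r hr using hv r hr
  constructor
  · refine IntegrableOn.congr_fun (hd.integrableOn_sub_rpow_mul_wrightInt hβ hβ1
      (by linarith : 0 < β + 1) (by linarith) (by linarith : -1 < -β) ht) (fun τ hτ => ?_)
      measurableSet_Ioo
    rw [hder τ hτ.1]
  -- The derivative has index β + 1, and the fractional integral of order 1 − β lowers it to 2β.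
  · have h1 := hd.setIntegral_sub_rpow_mul_wrightInt hβ hβ1 (a := β + 1) (α := 1 - β)
      (by linarith) (by linarith) (by linarith) ht
    rw [caputo, if_neg hβ1.ne, setIntegral_congr_fun measurableSet_Ioo
      (g := fun τ => (t - τ) ^ (1 - β - 1) * wrightInt β (β + 1) d τ)
      fun τ hτ => by rw [hder τ hτ.1]; ring_nf, h1, ← mul_assoc,
      inv_mul_cancel₀ (Real.Gamma_pos_of_pos (by linarith)).ne', one_mul]
    ring_nf

theorem contDiffOn_one_of_hasDerivAt {f f' : ℝ → ℝ} {s : Set ℝ} (hs : IsOpen s)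
    (h : ∀ x ∈ s, HasDerivAt f (f' x) x) (hf' : ContinuousOn f' s) : ContDiffOn ℝ 1 f s := by
  rw [show (1 : WithTop ℕ∞) = 0 + 1 by rfl, contDiffOn_succ_iff_deriv_of_isOpen hs]
  refine ⟨fun x hx => (h x hx).differentiableAt.differentiableWithinAt, by simp, ?_⟩
  rw [contDiffOn_zero]
  exact hf'.congr fun x hx => (h x hx).deriv

theorem contDiffOn_two_of_hasDerivAt {f f' f'' : ℝ → ℝ} {s : Set ℝ} (hs : IsOpen s)
    (h : ∀ x ∈ s, HasDerivAt f (f' x) x) (h' : ∀ x ∈ s, HasDerivAt f' (f'' x) x)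
    (hf'' : ContinuousOn f'' s) : ContDiffOn ℝ 2 f s := by
  rw [show (2 : WithTop ℕ∞) = 1 + 1 by rfl, contDiffOn_succ_iff_deriv_of_isOpen hs]
  refine ⟨fun x hx => (h x hx).differentiableAt.differentiableWithinAt, by simp, ?_⟩
  exact (contDiffOn_one_of_hasDerivAt hs h' hf'').congr fun x hx => (h x hx).deriv

theorem WrightTame.contDiffOn (hd : WrightTame β d) (hβ : 0 < β) (hβ1 : β < 1) :
    ContDiffOn ℝ 1 (wrightInt β β d) (Ioi 0) :=
  contDiffOn_one_of_hasDerivAt isOpen_Ioi (fun _ ht => hd.hasDerivAt_wrightInt hβ hβ1 hβ ht)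
    fun _ ht => (hd.hasDerivAt_wrightInt hβ hβ1 (by linarith)
      ht).continuousAt.continuousWithinAt

end

end FracPDE

/-! ### Limits of functions with boundedly convergent second derivatives -/

namespace FracPDE

open Set Filter Topology MeasureTheory

noncomputable section

theorem hasDerivAt_integral_of_continuousOn_Ioo {r : ℝ → ℝ} {a b z₀ z : ℝ}
    (hr : ContinuousOn r (Ioo a b)) (hz₀ : z₀ ∈ Ioo a b) (hz : z ∈ Ioo a b) :
    HasDerivAt (fun z => ∫ y in z₀..z, r y) (r z) z :=
  intervalIntegral.integral_hasDerivAt_right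
    ((hr.mono (ordConnected_Ioo.uIcc_subset hz₀ hz)).intervalIntegrable)
    (hr.stronglyMeasurableAtFilter isOpen_Ioo z hz) (hr.continuousAt (isOpen_Ioo.mem_nhds hz))

theorem eq_taylor_of_hasDerivAt {w w₁ r : ℝ → ℝ} {a b z₀ z : ℝ}
    (h₁ : ∀ z ∈ Ioo a b, HasDerivAt w (w₁ z) z) (h₂ : ∀ z ∈ Ioo a b, HasDerivAt w₁ (r z) z)
    (hr : ContinuousOn r (Ioo a b)) (hz₀ : z₀ ∈ Ioo a b) (hz : z ∈ Ioo a b) :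
    w z = w z₀ + w₁ z₀ * (z - z₀) + ∫ y in z₀..z, ∫ x in z₀..y, r x := by
  have hsub := ordConnected_Ioo.uIcc_subset hz₀ hz
  have hI : ContinuousOn (fun y => ∫ x in z₀..y, r x) (Ioo a b) := fun y hy =>
    (hasDerivAt_integral_of_continuousOn_Ioo hr hz₀ hy).continuousAt.continuousWithinAt
  have e1 : ∀ y ∈ Ioo a b, w₁ y = w₁ z₀ + ∫ x in z₀..y, r x := fun y hy => by
    have hs := ordConnected_Ioo.uIcc_subset hz₀ hy
    rw [intervalIntegral.integral_eq_sub_of_hasDerivAt (fun x hx => h₂ x (hs hx))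
      (hr.mono hs).intervalIntegrable]
    ring
  have hw₁ : ContinuousOn w₁ (uIcc z₀ z) := fun y hy =>
    (h₂ y (hsub hy)).continuousAt.continuousWithinAt
  have e2 := intervalIntegral.integral_eq_sub_of_hasDerivAt (fun x hx => h₁ x (hsub hx))
    hw₁.intervalIntegrable
  rw [intervalIntegral.integral_congr (g := fun y => w₁ z₀ + ∫ x in z₀..y, r x)
    (fun y hy => e1 y (hsub hy)), intervalIntegral.integral_add intervalIntegrable_const
    (hI.mono hsub).intervalIntegrable, intervalIntegral.integral_const, smul_eq_mul] at e2
  linarith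

/-- Pointwise limits of functions with bounded convergent second derivatives. -/
theorem hasDerivAt_deriv_of_tendsto {w w₁ R : ℕ → ℝ → ℝ} {v r : ℝ → ℝ} {a b K : ℝ}
    (h₁ : ∀ k, ∀ z ∈ Ioo a b, HasDerivAt (w k) (w₁ k z) z)
    (h₂ : ∀ k, ∀ z ∈ Ioo a b, HasDerivAt (w₁ k) (R k z) z)
    (hRc : ∀ k, ContinuousOn (R k) (Ioo a b))
    (hv : ∀ z ∈ Ioo a b, Tendsto (fun k => w k z) atTop (𝓝 (v z)))
    (hR : ∀ z ∈ Ioo a b, Tendsto (fun k => R k z) atTop (𝓝 (r z)))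
    (hK : ∀ k, ∀ z ∈ Ioo a b, |R k z| ≤ K) (hr : ContinuousOn r (Ioo a b))
    {z : ℝ} (hz : z ∈ Ioo a b) : DifferentiableAt ℝ v z ∧ HasDerivAt (deriv v) (r z) z := by
  set z₁ := (z + b) / 2 with hz₁
  have hz₁m : z₁ ∈ Ioo a b := ⟨by rw [hz₁]; linarith [hz.1, hz.2], by rw [hz₁]; linarith [hz.2]⟩
  have hne : z₁ - z ≠ 0 := by rw [hz₁]; linarith [hz.2]
  have hI : ∀ y ∈ Ioo a b, Tendsto (fun k => ∫ x in z..y, R k x) atTop (𝓝 (∫ x in z..y, r x)) := by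
    intro y hy
    have hs := uIoc_subset_uIcc.trans (ordConnected_Ioo.uIcc_subset hz hy)
    refine intervalIntegral.tendsto_integral_filter_of_dominated_convergence (fun _ => K)
      (.of_forall fun k => ((hRc k).mono hs).aestronglyMeasurable measurableSet_uIoc)
      (.of_forall fun k => .of_forall fun x hx => hK k x (hs hx)) intervalIntegrable_const
      (.of_forall fun x hx => hR x (hs hx))
  have hJ : ∀ y ∈ Ioo a b, Tendsto (fun k => ∫ x in z..y, ∫ u in z..x, R k u) atTop
      (𝓝 (∫ x in z..y, ∫ u in z..x, r u)) := by
    intro y hy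
    have hs := uIoc_subset_uIcc.trans (ordConnected_Ioo.uIcc_subset hz hy)
    refine intervalIntegral.tendsto_integral_filter_of_dominated_convergence
      (fun _ => K * (b - a))
      (.of_forall fun k => ContinuousOn.aestronglyMeasurable (fun x hx =>
        (hasDerivAt_integral_of_continuousOn_Ioo (hRc k) hz
          (hs hx)).continuousAt.continuousWithinAt) measurableSet_uIoc)
      (.of_forall fun k => .of_forall fun x hx => ?_) intervalIntegrable_const
      (.of_forall fun x hx => hI x (hs hx))
    have hx' := hs hx
    have hs' := uIoc_subset_uIcc.trans (ordConnected_Ioo.uIcc_subset hz hx')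
    refine (intervalIntegral.norm_integral_le_of_norm_le_const (fun u hu => hK k u (hs' hu))).trans ?_
    have hK0 : 0 ≤ K := (abs_nonneg _).trans (hK k z hz)
    refine mul_le_mul_of_nonneg_left (abs_le.2 ⟨?_, ?_⟩) hK0
    · linarith [hx'.1, hz.2]
    · linarith [hx'.2, hz.1]
  -- No convergence of first derivatives is assumed: it is read off from Taylor's formula between z
  -- and the auxiliary point z₁.
  have hc : Tendsto (fun k => w₁ k z) atTop
      (𝓝 ((v z₁ - v z - ∫ x in z..z₁, ∫ u in z..x, r u) / (z₁ - z))) := by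
    refine ((((hv z₁ hz₁m).sub (hv z hz)).sub (hJ z₁ hz₁m)).div_const (z₁ - z)).congr fun k => ?_
    rw [eq_taylor_of_hasDerivAt (h₁ k) (h₂ k) (hRc k) hz hz₁m]
    field_simp
    ring
  set c := (v z₁ - v z - ∫ x in z..z₁, ∫ u in z..x, r u) / (z₁ - z)
  -- Taylor's formula passes to the limit and exhibits v as a twice iterated integral of a
  -- continuous function.
  have hrep : ∀ y ∈ Ioo a b, v y = v z + c * (y - z) + ∫ x in z..y, ∫ u in z..x, r u := by
    intro y hy
    refine tendsto_nhds_unique (hv y hy) ?_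
    refine (((hv z hz).add (hc.mul_const (y - z))).add (hJ y hy)).congr fun k => ?_
    exact (eq_taylor_of_hasDerivAt (h₁ k) (h₂ k) (hRc k) hz hy).symm
  have hIc : ContinuousOn (fun y => ∫ x in z..y, r x) (Ioo a b) := fun y hy =>
    (hasDerivAt_integral_of_continuousOn_Ioo hr hz hy).continuousAt.continuousWithinAt
  have hd : ∀ y ∈ Ioo a b, HasDerivAt v (c + ∫ x in z..y, r x) y := by
    intro y hy
    have h1 := (((hasDerivAt_id y).sub_const z).const_mul c).const_add (v z)
    have h2 := (h1.add (hasDerivAt_integral_of_continuousOn_Ioo hIc hz hy))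
    rw [mul_one] at h2
    refine h2.congr_of_eventuallyEq ?_
    filter_upwards [isOpen_Ioo.mem_nhds hy] with x hx using hrep x hx
  refine ⟨(hd z hz).differentiableAt, ?_⟩
  have h3 := (hasDerivAt_integral_of_continuousOn_Ioo hr hz hz).const_add c
  refine h3.congr_of_eventuallyEq ?_
  filter_upwards [isOpen_Ioo.mem_nhds hz] with x hx using (hd x hx).deriv

theorem continuousOn_slice {φ : ℝ → ℝ → ℝ} {U : Set ℝ}
    (hφ : ContinuousOn (fun x : ℝ × ℝ => φ x.1 x.2) {x | x.2 ∈ U}) (z : ℝ) :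
    ContinuousOn (φ z) U :=
  ContinuousOn.comp (g := fun x : ℝ × ℝ => φ x.1 x.2) (f := fun s => (z, s)) hφ (by fun_prop)
    fun _ hs => hs

theorem exists_abs_le_of_continuousOn {φ : ℝ → ℝ → ℝ} {ε N : ℝ}
    (hφ : ContinuousOn (fun x : ℝ × ℝ => φ x.1 x.2) {x | x.2 ∈ Icc ε N}) (z : ℝ) :
    ∃ K, ∀ y ∈ Icc (z - 1) (z + 1), ∀ s ∈ Icc ε N, |φ y s| ≤ K := by
  have hsub : Icc (z - 1) (z + 1) ×ˢ Icc ε N ⊆ {x : ℝ × ℝ | x.2 ∈ Icc ε N} := fun x hx => hx.2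
  obtain ⟨K, hK⟩ := (isCompact_Icc.prod isCompact_Icc).exists_bound_of_continuousOn (hφ.mono hsub)
  exact ⟨K, fun y hy s hs => hK (y, s) ⟨hy, hs⟩⟩

theorem continuous_integral_mul {φ : ℝ → ℝ → ℝ} {g : ℝ → ℝ} {ε N : ℝ} (hεN : ε ≤ N)
    (hφ : ContinuousOn (fun x : ℝ × ℝ => φ x.1 x.2) {x | x.2 ∈ Icc ε N})
    (hg : ContinuousOn g (Icc ε N)) : Continuous fun z => ∫ s in ε..N, φ z s * g s := by
  have hsub : uIoc ε N ⊆ Icc ε N := by rw [uIoc_of_le hεN]; exact Ioc_subset_Icc_self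
  refine continuous_iff_continuousAt.2 fun z => ?_
  obtain ⟨K, hK⟩ := exists_abs_le_of_continuousOn hφ z
  refine intervalIntegral.continuousAt_of_dominated_interval (bound := fun s => K * |g s|)
    (.of_forall fun y => (((continuousOn_slice hφ y).mul hg).mono hsub).aestronglyMeasurable
      measurableSet_uIoc) ?_ ?_ ?_
  · filter_upwards [Icc_mem_nhds (by linarith : z - 1 < z) (by linarith : z < z + 1)] with y hy
    refine .of_forall fun s hs => ?_
    rw [norm_mul, Real.norm_eq_abs, Real.norm_eq_abs]
    exact mul_le_mul_of_nonneg_right (hK y hy s (hsub hs)) (abs_nonneg _)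
  · rw [← uIcc_of_le hεN] at hg
    exact (hg.abs.const_smul K).intervalIntegrable
  · refine .of_forall fun s hs => ?_
    have h1 : Continuous fun z => φ z s := continuousOn_univ.1
      (ContinuousOn.comp (g := fun x : ℝ × ℝ => φ x.1 x.2) (f := fun z => (z, s)) hφ
        (by fun_prop) fun _ _ => hsub hs)
    exact (h1.continuousAt).mul continuousAt_const

theorem hasDerivAt_integral_mul {φ φ' : ℝ → ℝ → ℝ} {g : ℝ → ℝ} {ε N : ℝ} (hεN : ε ≤ N)
    (hφ : ContinuousOn (fun x : ℝ × ℝ => φ x.1 x.2) {x | x.2 ∈ Icc ε N})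
    (hφ' : ContinuousOn (fun x : ℝ × ℝ => φ' x.1 x.2) {x | x.2 ∈ Icc ε N})
    (hd : ∀ z, ∀ s ∈ Icc ε N, HasDerivAt (fun z => φ z s) (φ' z s) z)
    (hg : ContinuousOn g (Icc ε N)) (z : ℝ) :
    HasDerivAt (fun z => ∫ s in ε..N, φ z s * g s) (∫ s in ε..N, φ' z s * g s) z := by
  have hsub : uIoc ε N ⊆ Icc ε N := by rw [uIoc_of_le hεN]; exact Ioc_subset_Icc_self
  obtain ⟨K, hK⟩ := exists_abs_le_of_continuousOn hφ' z
  have hg' := hg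
  rw [← uIcc_of_le hεN] at hg'
  refine (intervalIntegral.hasDerivAt_integral_of_dominated_loc_of_deriv_le
    (F := fun z s => φ z s * g s) (F' := fun z s => φ' z s * g s)
    (bound := fun s => K * |g s|) (s := Icc (z - 1) (z + 1))
    (Icc_mem_nhds (by linarith : z - 1 < z) (by linarith : z < z + 1))
    (.of_forall fun y => (((continuousOn_slice hφ y).mul hg).mono hsub).aestronglyMeasurable
      measurableSet_uIoc) ?_ ?_ ?_ ?_ ?_).2
  · refine ContinuousOn.intervalIntegrable ?_
    rw [uIcc_of_le hεN]
    exact (continuousOn_slice hφ z).mul hg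
  · exact (((continuousOn_slice hφ' z).mul hg).mono hsub).aestronglyMeasurable measurableSet_uIoc
  · refine .of_forall fun s hs y hy => ?_
    rw [norm_mul, Real.norm_eq_abs, Real.norm_eq_abs]
    exact mul_le_mul_of_nonneg_right (hK y hy s (hsub hs)) (abs_nonneg _)
  · exact (hg'.abs.const_smul K).intervalIntegrable
  · exact .of_forall fun s hs y _ => (hd y s (hsub hs)).mul_const (g s)

end

end FracPDE

/-! ### Space derivatives of the transformed evolution -/

namespace FracPDE

open Set Filter Topology MeasureTheory

noncomputable section

theorem tendsto_intervalIntegral_Ioi {f : ℝ → ℝ} (hf : IntegrableOn f (Ioi 0)) {ε N : ℕ → ℝ}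
    (hε0 : ∀ k, 0 < ε k) (hε : Tendsto ε atTop (𝓝 0)) (hN0 : ∀ k, 0 < N k)
    (hN : Tendsto N atTop atTop) :
    Tendsto (fun k => ∫ s in ε k..N k, f s) atTop (𝓝 (∫ s in Ioi (0 : ℝ), f s)) := by
  have hi : ∀ b, 0 < b → IntervalIntegrable f volume 0 b := fun b hb =>
    (intervalIntegrable_iff_integrableOn_Ioc_of_le hb.le).2 (hf.mono_set Ioc_subset_Ioi_self)
  have h1 := intervalIntegral_tendsto_integral_Ioi 0 hf hN
  set g := (Ioi (0 : ℝ)).indicator f with hg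
  have hgi : Integrable g := (integrable_indicator_iff measurableSet_Ioi).2 hf
  have h2 := ((intervalIntegral.continuous_primitive (fun a b => hgi.intervalIntegrable)
    0).tendsto 0).comp hε
  rw [intervalIntegral.integral_same] at h2
  have h3 := h1.sub h2
  rw [sub_zero] at h3
  refine h3.congr fun k => ?_
  have e : ∫ s in (0 : ℝ)..ε k, g s = ∫ s in (0 : ℝ)..ε k, f s := by
    rw [intervalIntegral.integral_of_le (hε0 k).le, intervalIntegral.integral_of_le (hε0 k).le]
    exact setIntegral_congr_fun measurableSet_Ioc fun s hs => indicator_of_mem hs.1 _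
  simp only [Function.comp_apply]
  rw [e]
  exact intervalIntegral.integral_interval_sub_left (hi _ (hN0 k)) (hi _ (hε0 k))

theorem abs_intervalIntegral_le_setIntegral {f m : ℝ → ℝ} (hm : IntegrableOn m (Ioi 0))
    (hf : ∀ s, 0 < s → |f s| ≤ m s) {ε N : ℝ} (hε : 0 < ε) (hεN : ε ≤ N) :
    |∫ s in ε..N, f s| ≤ ∫ s in Ioi (0 : ℝ), m s := by
  have hsub : Ioc ε N ⊆ Ioi 0 := fun s hs => hε.trans hs.1
  rw [intervalIntegral.integral_of_le hεN]
  refine (norm_integral_le_of_norm_le (f := f) (hm.mono_set hsub)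
    ((ae_restrict_iff' measurableSet_Ioc).2 (.of_forall fun s hs => hf s (hsub hs)))).trans ?_
  exact setIntegral_mono_set hm ((ae_restrict_iff' measurableSet_Ioi).2
    (.of_forall fun s hs => (abs_nonneg _).trans (hf s hs))) hsub.eventuallyLE

/-- An integrable function need not tend to 0 but is small at arbitrarily distant points; this
suffices to choose upper cut-offs. -/
theorem exists_ge_abs_lt_of_integrableOn {F : ℝ → ℝ} (hF : IntegrableOn F (Ioi 0)) {δ : ℝ}
    (hδ : 0 < δ) (n : ℝ) : ∃ N, n ≤ N ∧ |F N| < δ := by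
  by_contra! h
  have h1 : IntegrableOn (fun _ : ℝ => δ) (Ioi (max n 0)) := by
    refine (hF.mono_set (Ioi_subset_Ioi (le_max_right n 0))).norm.mono'
      aestronglyMeasurable_const ((ae_restrict_iff' measurableSet_Ioi).2 (.of_forall
        fun s (hs : max n 0 < s) => ?_))
    rw [Real.norm_eq_abs, abs_of_pos hδ]
    exact h s ((le_max_left _ _).trans hs.le)
  rw [integrableOn_const_iff] at h1
  rcases h1 with h1 | h1
  · exact hδ.ne' (by simpa using h1)
  · simp at h1

/-- Initial values for which the heat-type evolution has a Wright-type transform. -/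
structure WrightHeat (β α γ : ℝ) (ψ : ℝ → ℝ) : Prop where
  tame : GaussTame ψ
  lipschitz : ∀ z, 0 < z → ∃ δ L, 0 < δ ∧ 0 ≤ L ∧ ∀ y, |y - z| ≤ δ → |ψ y - ψ z| ≤ L * |y - z|
  convergent : ∀ a b t, 0 < a → a ≤ b → 0 < t → ∃ M : ℝ → ℝ,
    IntegrableOn (fun s => M s * wrightG β β s t) (Ioi 0) ∧
    ∀ z ∈ Icc a b, ∀ s, 0 < s → |linHeat α γ ψ z s| ≤ M s

variable {β α γ : ℝ} {ψ : ℝ → ℝ}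

theorem WrightHeat.continuousOn (h : WrightHeat β α γ ψ) : ContinuousOn ψ (Ioi 0) := by
  intro z hz
  obtain ⟨δ, L, hδ, hL, hb⟩ := h.lipschitz z hz
  refine ContinuousAt.continuousWithinAt ?_
  rw [ContinuousAt, tendsto_iff_norm_sub_tendsto_zero]
  have h1 : Tendsto (fun y => L * |y - z|) (𝓝 z) (𝓝 0) := by
    have : Continuous fun y => L * |y - z| := by fun_prop
    simpa using this.tendsto z
  refine squeeze_zero' (.of_forall fun _ => norm_nonneg _) ?_ h1
  filter_upwards [Metric.closedBall_mem_nhds z hδ] with y hy using hb y hy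

theorem continuousOn_linHeat_time (hψ : GaussTame ψ) (α γ z : ℝ) :
    ContinuousOn (fun s => linHeat α γ ψ z s) (Ioi 0) := fun _ hs =>
  (hasDerivAt_linHeat_time hψ α γ z hs).continuousAt.continuousWithinAt

theorem WrightHeat.integrableOn (h : WrightHeat β α γ ψ) (hβ : 0 < β) (hβ1 : β < 1) {z t : ℝ}
    (hz : 0 < z) (ht : 0 < t) :
    IntegrableOn (fun s => linHeat α γ ψ z s * wrightG β β s t) (Ioi 0) := by
  obtain ⟨M, hM, hb⟩ := h.convergent z z t hz le_rfl ht
  refine hM.norm.mono' (((continuousOn_linHeat_time h.tame α γ z).aestronglyMeasurable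
    measurableSet_Ioi).mul (measurable_wrightG hβ hβ1 β t)) ?_
  refine (ae_restrict_iff' measurableSet_Ioi).2 (.of_forall fun s hs => ?_)
  rw [norm_mul, norm_mul]
  exact mul_le_mul_of_nonneg_right ((hb z ⟨le_rfl, le_rfl⟩ s hs).trans (le_abs_self _))
    (norm_nonneg _)

theorem WrightHeat.wrightTame (h : WrightHeat β α γ ψ) (hβ : 0 < β) (hβ1 : β < 1) {z : ℝ}
    (hz : 0 < z) : WrightTame β (fun s => linHeat α γ ψ z s - ψ z) where
  cont := (continuousOn_linHeat_time h.tame α γ z).sub continuousOn_const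
  small S hS := by
    obtain ⟨δ, L, hδ, hL, hb⟩ := h.lipschitz z hz
    exact abs_linHeat_sub_le h.tame α γ z hS hδ hL hb
  integrableOn t ht := by
    refine ((h.integrableOn hβ hβ1 hz ht).sub
      ((integrableOn_wrightG hβ hβ1 hβ ht).const_mul (ψ z))).congr (.of_forall fun s => ?_)
    simp only [Pi.sub_apply]; ring

theorem WrightHeat.integral_eq (h : WrightHeat β α γ ψ) (hβ : 0 < β) (hβ1 : β < 1) {z t : ℝ}
    (hz : 0 < z) (ht : 0 < t) : ∫ s in Ioi (0 : ℝ), linHeat α γ ψ z s * wrightG β β s t =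
      ψ z + wrightInt β β (fun s => linHeat α γ ψ z s - ψ z) t := by
  have h1 := integral_sub (h.integrableOn hβ hβ1 hz ht)
    ((integrableOn_wrightG hβ hβ1 hβ ht).const_mul (ψ z))
  rw [integral_const_mul, integral_wrightG_density hβ hβ1 ht, mul_one] at h1
  rw [wrightInt, add_comm, ← sub_eq_iff_eq_add, ← h1]
  congr 1; funext s; ring

theorem exists_abs_linHeat_sub_le (hψ : GaussTame ψ) (hψc : ContinuousOn ψ (Ioi 0)) (α γ b : ℝ)
    {a S : ℝ} (ha : 0 < a) (hS : 0 < S) :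
    ∃ D, 0 ≤ D ∧ ∀ z ∈ Icc a b, |ψ z| ≤ D ∧
      ∀ s, 0 < s → s ≤ S → |linHeat α γ ψ z s - ψ z| ≤ D := by
  have hsub : Icc (a / 2) (b + a / 2) ⊆ Ioi 0 := fun y hy => by
    have := hy.1; simp only [mem_Ioi]; linarith
  obtain ⟨B, hB⟩ := isCompact_Icc.exists_bound_of_continuousOn (hψc.mono hsub)
  obtain ⟨C, hC, hCb⟩ := abs_linHeat_le α γ b hS (half_pos ha)
  set I := ∫ y, |Real.exp (-(1 / (8 * S) * y ^ 2)) * ψ y|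
  have hI : 0 ≤ I := integral_nonneg fun y => abs_nonneg _
  refine ⟨|B| + C * (|B| + √S * I), by positivity, fun z hz => ?_⟩
  have h1 : |ψ z| ≤ |B| :=
    (hB z ⟨by linarith [hz.1], by linarith [hz.2]⟩).trans (le_abs_self B)
  refine ⟨h1.trans (le_add_of_nonneg_right (by positivity)), fun s hs hsS => ?_⟩
  have h2 := hCb ψ hψ z s |B| 0 (abs_le.2 ⟨by linarith [hz.1, hz.2], hz.2⟩) hs hsS
    (abs_nonneg _) le_rfl fun y hy => by
      rw [zero_mul, add_zero]
      rw [abs_le] at hy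
      exact (hB y ⟨by linarith [hz.1, hy.1], by linarith [hz.2, hy.2]⟩).trans (le_abs_self B)
  have h3 : C * (|B| + 2 * 0 * √s + √s * I) ≤ C * (|B| + √S * I) := by
    rw [mul_zero, zero_mul, add_zero]
    gcongr
  calc |linHeat α γ ψ z s - ψ z| ≤ |linHeat α γ ψ z s| + |ψ z| := abs_sub _ _
    _ ≤ _ := by linarith

theorem exists_abs_wrightG_time_le (hβ : 0 < β) (hβ1 : β < 1) {a t : ℝ} (ha : 0 < a) (ht : 0 < t) :
    ∃ C, 0 ≤ C ∧ ∀ s, 0 < s → |wrightG β a s t| ≤ C := by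
  obtain ⟨C, κ, hC, hκ, hb⟩ := exists_abs_wrightG_le hβ hβ1 ha
  refine ⟨t ^ (-a) * C, by positivity, fun s hs => ?_⟩
  have ht' : 0 < t ^ (-a) := by positivity
  have hr : 0 < s * t ^ (-β) := by positivity
  rw [wrightG_scale hβ hβ1 a hs ht, abs_mul, abs_of_pos ht']
  refine mul_le_mul_of_nonneg_left ((hb _ hr).trans ?_) ht'.le
  refine mul_le_of_le_one_right hC (Real.exp_le_one_iff.2 ?_)
  have := saddlePoint_pos hβ hr
  have : 0 < κ * saddlePoint β (s * t ^ (-β)) := by positivity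
  linarith

/-- The convergence hypothesis concerns index β only. For s ≤ S both factors are bounded uniformly
in z; for s > S the kernel of index 2β is dominated by the density at the later time T', where the
hypothesis applies. -/
theorem WrightHeat.exists_dom (h : WrightHeat β α γ ψ) (hβ : 0 < β) (hβ1 : β < 1) {a b t : ℝ}
    (ha : 0 < a) (hab : a ≤ b) (ht : 0 < t) : ∃ m : ℝ → ℝ, IntegrableOn m (Ioi 0) ∧
      ∀ z ∈ Icc a b, ∀ s, 0 < s →
        |(linHeat α γ ψ z s - ψ z) * wrightG β (2 * β) s t| ≤ m s := by
  have h2β : 0 < 2 * β := by linarith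
  obtain ⟨C, S, T', hC, hS, hT', hG⟩ := exists_abs_wrightG_le_domKernel hβ hβ1 h2β ht
  obtain ⟨C', hC', hG'⟩ := exists_abs_wrightG_time_le hβ hβ1 h2β ht
  obtain ⟨D, hD, hDb⟩ := exists_abs_linHeat_sub_le h.tame h.continuousOn α γ b ha hS
  obtain ⟨M, hM, hMb⟩ := h.convergent a b T' ha hab hT'
  set E := C * t ^ (5 * β / 4 - 2 * β)
  have hE : 0 ≤ E := by positivity
  refine ⟨fun s => if s ≤ S then D * C' else |E * (M s * wrightG β β s T' + D * wrightG β β s T')|,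
    ?_, fun z hz s hs => ?_⟩
  · rw [← Ioc_union_Ioi_eq_Ioi hS.le]
    refine IntegrableOn.union ?_ ?_
    · have h1 : IntegrableOn (fun _ : ℝ => D * C') (Ioc 0 S) := by
        rw [integrableOn_const_iff]; right; simp
      exact h1.congr_fun (fun s hs => by simp only [if_pos hs.2]) measurableSet_Ioc
    · have h1 : IntegrableOn (fun s => |E * (M s * wrightG β β s T' + D * wrightG β β s T')|)
          (Ioi S) :=
        (IntegrableOn.mono_set ((hM.add ((integrableOn_wrightG hβ hβ1 hβ hT').const_mul
          D)).const_mul E) (Ioi_subset_Ioi hS.le)).abs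
      exact h1.congr_fun (fun s (hs : S < s) => by simp only [if_neg (not_le.2 hs)])
        measurableSet_Ioi
  · rw [abs_mul]
    beta_reduce
    split_ifs with hsS
    · exact mul_le_mul ((hDb z hz).2 s hs hsS) (hG' s hs) (abs_nonneg _) hD
    · have h1 := hG s t hs ht le_rfl
      rw [domKernel, if_neg hsS] at h1
      have h2 : |linHeat α γ ψ z s - ψ z| ≤ M s + D :=
        (abs_sub _ _).trans (add_le_add (hMb z hz s hs) (hDb z hz).1)
      have h3 : 0 ≤ M s + D := (abs_nonneg _).trans h2
      calc _ ≤ (M s + D) * (E * |wrightG β β s T'|) := by gcongr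
        _ = _ := by
          rw [← add_mul, abs_mul E, abs_mul (M s + D), abs_of_nonneg hE, abs_of_nonneg h3]; ring

theorem continuousOn_linHeat_space (hψ : GaussTame ψ) (α γ : ℝ) {s : ℝ} (hs : 0 < s) (U : Set ℝ) :
    ContinuousOn (fun z => linHeat α γ ψ z s) U := fun z _ =>
  (hasDerivAt_linHeat_space hψ α γ z hs).continuousAt.continuousWithinAt

theorem WrightHeat.continuousOn_wrightInt (h : WrightHeat β α γ ψ) (hβ : 0 < β) (hβ1 : β < 1)
    {a b t : ℝ} (ha : 0 < a) (hab : a ≤ b) (ht : 0 < t) :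
    ContinuousOn (fun z => wrightInt β (2 * β) (fun s => linHeat α γ ψ z s - ψ z) t) (Icc a b) := by
  have hsub : Icc a b ⊆ Ioi 0 := fun z hz => ha.trans_le hz.1
  obtain ⟨m, hm, hmb⟩ := h.exists_dom hβ hβ1 ha hab ht
  refine continuousOn_of_dominated (bound := m)
    (fun z hz => (h.wrightTame hβ hβ1 (hsub hz)).aestronglyMeasurable hβ hβ1 (2 * β) t)
    (fun z hz => (ae_restrict_iff' measurableSet_Ioi).2 (.of_forall (hmb z hz))) hm
    ((ae_restrict_iff' measurableSet_Ioi).2 (.of_forall fun s hs => ?_))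
  exact ((continuousOn_linHeat_space h.tame α γ hs _).sub (h.continuousOn.mono hsub)).mul
    continuousOn_const

theorem WrightHeat.continuousOn_integral (h : WrightHeat β α γ ψ) (hβ : 0 < β) (hβ1 : β < 1)
    {a b t : ℝ} (ha : 0 < a) (hab : a ≤ b) (ht : 0 < t) :
    ContinuousOn (fun z => ∫ s in Ioi (0 : ℝ), linHeat α γ ψ z s * wrightG β β s t)
      (Icc a b) := by
  obtain ⟨M, hM, hMb⟩ := h.convergent a b t ha hab ht
  refine continuousOn_of_dominated (bound := fun s => ‖M s * wrightG β β s t‖)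
    (fun z hz => (h.integrableOn hβ hβ1 (ha.trans_le hz.1) ht).aestronglyMeasurable)
    (fun z hz => (ae_restrict_iff' measurableSet_Ioi).2 (.of_forall fun s hs => ?_)) hM.norm
    ((ae_restrict_iff' measurableSet_Ioi).2 (.of_forall fun s hs => ?_))
  · rw [norm_mul, norm_mul]
    exact mul_le_mul_of_nonneg_right ((hMb z hz s hs).trans (le_abs_self _)) (norm_nonneg _)
  · exact (continuousOn_linHeat_space h.tame α γ hs _).mul continuousOn_const

/-- By the evolution equation w_zz = 4(w_s + (αz + γ)w), and an integration by parts in s moves the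
derivative onto the density, whose s-derivative is minus the kernel of index 2β. The right-hand side
contains no space derivative of w. -/
theorem integral_linHeatXX_mul (hψ : GaussTame ψ) (hβ : 0 < β) (hβ1 : β < 1) (α γ z t : ℝ)
    {ε N : ℝ} (hε : 0 < ε) (hεN : ε ≤ N) :
    ∫ s in ε..N, linHeatXX α γ ψ z s * wrightG β β s t =
      4 * ((α * z + γ) * (∫ s in ε..N, linHeat α γ ψ z s * wrightG β β s t) +
        ((linHeat α γ ψ z N - ψ z) * wrightG β β N t - (linHeat α γ ψ z ε - ψ z) * wrightG β β ε t +
          ∫ s in ε..N, (linHeat α γ ψ z s - ψ z) * wrightG β (2 * β) s t)) := by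
  have hsub : uIcc ε N ⊆ Ioi 0 := by
    rw [uIcc_of_le hεN]; exact fun s hs => hε.trans_le hs.1
  have cG (a : ℝ) : ContinuousOn (fun s => wrightG β a s t) (uIcc ε N) := fun s hs =>
    (hasDerivAt_wrightG_space hβ hβ1 a t (hsub hs)).continuousAt.continuousWithinAt
  have cw := (continuousOn_linHeat_time hψ α γ z).mono hsub
  have cX : ContinuousOn (fun s => linHeatXX α γ ψ z s) (uIcc ε N) :=
    (continuousOn_slice (U := Ioi 0) (continuousOn_linHeatXX hψ α γ) z).mono hsub
  have cu' : ContinuousOn (fun s => linHeatXX α γ ψ z s / 4 - (α * z + γ) * linHeat α γ ψ z s)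
      (uIcc ε N) := (cX.div_const 4).sub (continuousOn_const.mul cw)
  have cd : ContinuousOn (fun s => linHeat α γ ψ z s - ψ z) (uIcc ε N) := cw.sub continuousOn_const
  have key := intervalIntegral.integral_deriv_mul_eq_sub (a := ε) (b := N)
    (u := fun s => linHeat α γ ψ z s - ψ z) (v := fun s => wrightG β β s t)
    (u' := fun s => linHeatXX α γ ψ z s / 4 - (α * z + γ) * linHeat α γ ψ z s)
    (v' := fun s => -wrightG β (β + β) s t)
    (fun s hs => (hasDerivAt_linHeat_time hψ α γ z (hsub hs)).sub_const _)
    (fun s hs => hasDerivAt_wrightG_space hβ hβ1 β t (hsub hs))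
    cu'.intervalIntegrable (cG _).neg.intervalIntegrable
  have i1 : IntervalIntegrable (fun s =>
      (linHeatXX α γ ψ z s / 4 - (α * z + γ) * linHeat α γ ψ z s) * wrightG β β s t +
        (linHeat α γ ψ z s - ψ z) * -wrightG β (β + β) s t) volume ε N :=
    ((cu'.mul (cG β)).add (cd.mul (cG (β + β)).neg)).intervalIntegrable
  have i2 : IntervalIntegrable (fun s => (linHeat α γ ψ z s - ψ z) * wrightG β (2 * β) s t)
      volume ε N := (cd.mul (cG (2 * β))).intervalIntegrable
  have i3 : IntervalIntegrable (fun s => (α * z + γ) * (linHeat α γ ψ z s * wrightG β β s t))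
      volume ε N := (continuousOn_const.mul (cw.mul (cG β))).intervalIntegrable
  rw [← key, ← intervalIntegral.integral_const_mul, ← intervalIntegral.integral_add i1 i2,
    ← intervalIntegral.integral_add i3 (i1.add i2), ← intervalIntegral.integral_const_mul]
  refine intervalIntegral.integral_congr fun s _ => ?_
  simp only [two_mul]
  ring

/-- Derivatives cannot be taken directly under the infinite integral, since w_z and w_zz are not
controlled. The integrals over [ε, N] are smooth in z, and their second derivatives, rewritten by
parts, converge pointwise and stay bounded. -/
theorem WrightHeat.hasDerivAt_space (h : WrightHeat β α γ ψ) (hβ : 0 < β) (hβ1 : β < 1)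
    {z t : ℝ} (hz : 0 < z) (ht : 0 < t) :
    DifferentiableAt ℝ (fun z => ∫ s in Ioi (0 : ℝ), linHeat α γ ψ z s * wrightG β β s t) z ∧
    HasDerivAt (deriv fun z => ∫ s in Ioi (0 : ℝ), linHeat α γ ψ z s * wrightG β β s t)
      (4 * ((α * z + γ) * (∫ s in Ioi (0 : ℝ), linHeat α γ ψ z s * wrightG β β s t) +
        wrightInt β (2 * β) (fun s => linHeat α γ ψ z s - ψ z) t)) z := by
  set a := z / 2 with ha_def
  set b := 2 * z with hb_def
  have ha : 0 < a := by positivity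
  have hab : a ≤ b := by rw [ha_def, hb_def]; linarith
  have hzab : z ∈ Ioo a b := ⟨by rw [ha_def]; linarith, by rw [hb_def]; linarith⟩
  obtain ⟨M, hM, hMb⟩ := h.convergent a b t ha hab ht
  obtain ⟨m, hm, hmb⟩ := h.exists_dom hβ hβ1 ha hab ht
  obtain ⟨D, hD, hDb⟩ := exists_abs_linHeat_sub_le h.tame h.continuousOn α γ b ha one_pos
  obtain ⟨C, hC, hCb⟩ := exists_abs_wrightG_time_le hβ hβ1 hβ ht
  have hF : IntegrableOn (fun s => M s * wrightG β β s t + D * wrightG β β s t) (Ioi 0) :=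
    hM.add ((integrableOn_wrightG hβ hβ1 hβ ht).const_mul D)
  -- The upper cut-offs are chosen where the majorant of the boundary term is below 1/(k+1),
  -- uniformly in z.
  choose N hN1 hN2 using fun k : ℕ =>
    exists_ge_abs_lt_of_integrableOn hF (δ := 1 / ((k : ℝ) + 1)) (by positivity) ((k : ℝ) + 1)
  set ε : ℕ → ℝ := fun k => 1 / ((k : ℝ) + 1) with hε_def
  have hε0 : ∀ k, 0 < ε k := fun k => by positivity
  have hε1 : ∀ k, ε k ≤ 1 := fun k => by
    rw [hε_def]; simp only []; rw [div_le_one (by positivity)]; linarith [Nat.cast_nonneg (α := ℝ) k]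
  have hεt : Tendsto ε atTop (𝓝 0) := tendsto_one_div_add_atTop_nhds_zero_nat
  have hN1' : ∀ k, 1 ≤ N k := fun k => by linarith [hN1 k, Nat.cast_nonneg (α := ℝ) k]
  have hN0 : ∀ k, 0 < N k := fun k => one_pos.trans_le (hN1' k)
  have hεN : ∀ k, ε k ≤ N k := fun k => (hε1 k).trans (hN1' k)
  have hNt : Tendsto N atTop atTop :=
    tendsto_atTop_mono hN1 (tendsto_atTop_add_const_right _ _ tendsto_natCast_atTop_atTop)
  have hIcc : ∀ k, Icc (ε k) (N k) ⊆ Ioi 0 := fun k s hs => (hε0 k).trans_le hs.1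
  have hsub : ∀ k, {x : ℝ × ℝ | x.2 ∈ Icc (ε k) (N k)} ⊆ {x | 0 < x.2} := fun k x hx => hIcc k hx
  have cG : ∀ k, ContinuousOn (fun s => wrightG β β s t) (Icc (ε k) (N k)) := fun k s hs =>
    (hasDerivAt_wrightG_space hβ hβ1 β t (hIcc k hs)).continuousAt.continuousWithinAt
  have hdN : ∀ y ∈ Ioo a b, ∀ k, |(linHeat α γ ψ y (N k) - ψ y) * wrightG β β (N k) t| ≤ ε k := by
    intro y hy k
    have hy' := Ioo_subset_Icc_self hy
    have h2 : |linHeat α γ ψ y (N k) - ψ y| ≤ M (N k) + D :=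
      (abs_sub _ _).trans (add_le_add (hMb y hy' _ (hN0 k)) (hDb y hy').1)
    refine le_trans ?_ (hN2 k).le
    rw [← add_mul, abs_mul, abs_mul]
    exact mul_le_mul_of_nonneg_right (h2.trans (le_abs_self _)) (abs_nonneg _)
  have hMb' : ∀ y ∈ Ioo a b, ∀ s, 0 < s →
      |linHeat α γ ψ y s * wrightG β β s t| ≤ ‖M s * wrightG β β s t‖ := fun y hy s hs => by
    rw [abs_mul, norm_mul]
    exact mul_le_mul_of_nonneg_right
      ((hMb y (Ioo_subset_Icc_self hy) s hs).trans (le_abs_self _)) (abs_nonneg _)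
  refine hasDerivAt_deriv_of_tendsto
    (w := fun k z => ∫ s in ε k..N k, linHeat α γ ψ z s * wrightG β β s t)
    (w₁ := fun k z => ∫ s in ε k..N k, linHeatX α γ ψ z s * wrightG β β s t)
    (R := fun k z => ∫ s in ε k..N k, linHeatXX α γ ψ z s * wrightG β β s t)
    (v := fun z => ∫ s in Ioi (0 : ℝ), linHeat α γ ψ z s * wrightG β β s t)
    (r := fun z => 4 * ((α * z + γ) * (∫ s in Ioi (0 : ℝ), linHeat α γ ψ z s * wrightG β β s t) +
        wrightInt β (2 * β) (fun s => linHeat α γ ψ z s - ψ z) t))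
    (K := 4 * ((|α| * b + |γ|) * (∫ s in Ioi (0 : ℝ), ‖M s * wrightG β β s t‖) +
      (1 + D * C + ∫ s in Ioi (0 : ℝ), m s)))
    (a := a) (b := b) ?_ ?_ ?_ ?_ ?_ ?_ ?_ hzab
  · exact fun k y _ => hasDerivAt_integral_mul (hεN k)
      ((continuousOn_linHeat h.tame α γ).mono (hsub k))
      ((continuousOn_linHeatX h.tame α γ).mono (hsub k))
      (fun y s hs => hasDerivAt_linHeat_space h.tame α γ y (hIcc k hs)) (cG k) y
  · exact fun k y _ => hasDerivAt_integral_mul (hεN k)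
      ((continuousOn_linHeatX h.tame α γ).mono (hsub k))
      ((continuousOn_linHeatXX h.tame α γ).mono (hsub k))
      (fun y s hs => hasDerivAt_linHeatX_space h.tame α γ y (hIcc k hs)) (cG k) y
  · exact fun k => (continuous_integral_mul (hεN k)
      ((continuousOn_linHeatXX h.tame α γ).mono (hsub k)) (cG k)).continuousOn
  · exact fun y hy => tendsto_intervalIntegral_Ioi
      (h.integrableOn hβ hβ1 (ha.trans hy.1) ht) hε0 hεt hN0 hNt
  · intro y hy
    have hy0 : 0 < y := ha.trans hy.1
    have hd := h.wrightTame hβ hβ1 hy0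
    simp_rw [fun k => integral_linHeatXX_mul h.tame hβ hβ1 α γ y t (hε0 k) (hεN k)]
    have l1 := tendsto_intervalIntegral_Ioi (h.integrableOn hβ hβ1 hy0 ht) hε0 hεt hN0 hNt
    have l2 := tendsto_intervalIntegral_Ioi (hd.integrableOn_mul hβ hβ1
      (by linarith : 0 < 2 * β) ht) hε0 hεt hN0 hNt
    have l3 : Tendsto (fun k => (linHeat α γ ψ y (N k) - ψ y) * wrightG β β (N k) t) atTop (𝓝 0) :=
      squeeze_zero_norm (hdN y hy) hεt
    -- At the lower end the boundary term vanishes because w − ψ = O(√ε) and the density is bounded.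
    have l4 : Tendsto (fun k => (linHeat α γ ψ y (ε k) - ψ y) * wrightG β β (ε k) t) atTop
        (𝓝 0) := by
      obtain ⟨B, hB, hBb⟩ := hd.small 1 one_pos
      have l5 : Tendsto (fun k => B * √(ε k) * C) atTop (𝓝 0) := by
        have c : Continuous fun x : ℝ => B * √x * C := by fun_prop
        have l := (c.tendsto 0).comp hεt
        rw [Real.sqrt_zero, mul_zero, zero_mul] at l
        exact l
      refine squeeze_zero_norm (fun k => ?_) l5
      rw [norm_mul]
      exact mul_le_mul (hBb _ (hε0 k) (hε1 k)) (hCb _ (hε0 k)) (norm_nonneg _) (by positivity)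
    have l6 := ((l1.const_mul (α * y + γ)).add ((l3.sub l4).add l2)).const_mul 4
    rw [sub_zero, zero_add] at l6
    exact l6
  · intro k y hy
    have hy' := Ioo_subset_Icc_self hy
    rw [integral_linHeatXX_mul h.tame hβ hβ1 α γ y t (hε0 k) (hεN k), abs_mul,
      abs_of_pos (by norm_num : (0 : ℝ) < 4)]
    refine mul_le_mul_of_nonneg_left ?_ (by norm_num)
    refine (abs_add_le _ _).trans (add_le_add ?_ ?_)
    · rw [abs_mul]
      refine mul_le_mul ?_ (abs_intervalIntegral_le_setIntegral hM.norm (hMb' y hy) (hε0 k)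
        (hεN k)) (abs_nonneg _) (by positivity)
      refine (abs_add_le _ _).trans (add_le_add ?_ le_rfl)
      rw [abs_mul, abs_of_pos (ha.trans hy.1)]
      exact mul_le_mul_of_nonneg_left hy.2.le (abs_nonneg _)
    · refine (abs_add_le _ _).trans (add_le_add ((abs_sub _ _).trans (add_le_add ?_ ?_)) ?_)
      · exact (hdN y hy k).trans (hε1 k)
      · rw [abs_mul]
        exact mul_le_mul ((hDb y hy').2 _ (hε0 k) (hε1 k)) (hCb _ (hε0 k)) (abs_nonneg _) hD
      · exact abs_intervalIntegral_le_setIntegral hm (hmb y hy') (hε0 k) (hεN k)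
  · refine ContinuousOn.mono ?_ Ioo_subset_Icc_self
    exact continuousOn_const.mul (((by fun_prop : ContinuousOn (fun z => α * z + γ) _).mul
      (h.continuousOn_integral hβ hβ1 ha hab ht)).add (h.continuousOn_wrightInt hβ hβ1 ha hab ht))

end

end FracPDE

/-! ### Growth of the evolution against decay of the density -/

namespace FracPDE

open Set Filter Topology MeasureTheory

noncomputable section

variable {α γ : ℝ} {ψ : ℝ → ℝ}

theorem exists_mul_rpow_le_rpow {p q : ℝ} (hp : 0 < p) (hpq : p < q) {R ε : ℝ} (hR : 0 ≤ R)
    (hε : 0 < ε) : ∃ K, ∀ s, 0 < s → R * s ^ p ≤ ε * s ^ q + K := by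
  have hq : 0 < q := hp.trans hpq
  obtain ⟨K, hK⟩ := exists_mul_rpow_le (div_pos hp hq) ((div_lt_one hq).2 hpq) hR hε
  refine ⟨K, fun s hs => ?_⟩
  have h := hK (s ^ q) (by positivity)
  rwa [← Real.rpow_mul hs.le, mul_div_cancel₀ p hq.ne'] at h

/-- At fixed t the density decays like exp(−κ's^q) with q = 1/(1−β) > 1, and q > 3 is equivalent to
β > 2/3. A quarter of the rate absorbs each of the linear and cubic terms. -/
theorem integrableOn_exp_mul_wrightG {β : ℝ} (hβ : 0 < β) (hβ1 : β < 1) {t c₁ c₃ : ℝ} (ht : 0 < t)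
    (hc₁ : 0 ≤ c₁) (hc₃ : 0 ≤ c₃) (hc : c₃ = 0 ∨ 2 / 3 < β) :
    IntegrableOn (fun s => Real.exp (c₁ * s + c₃ * s ^ 3) * wrightG β β s t) (Ioi 0) := by
  obtain ⟨C, κ, hC, hκ, hG⟩ := exists_abs_wrightG_le hβ hβ1 hβ
  set q := (1 - β)⁻¹ with hq
  have hq1 : 1 < q := (one_lt_inv₀ (by linarith)).2 (by linarith)
  set κ' := κ * (β * t ^ (-β)) ^ q with hκ'
  have hκ'0 : 0 < κ' := by positivity
  obtain ⟨K₁, hK₁⟩ := exists_mul_rpow_le_rpow one_pos hq1 hc₁ (by positivity : 0 < κ' / 4)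
  obtain ⟨K₃, hK₃⟩ : ∃ K, ∀ s, 0 < s → c₃ * s ^ 3 ≤ κ' / 4 * s ^ q + K := by
    rcases hc with hc | hc
    · exact ⟨0, fun s hs => by rw [hc, zero_mul, add_zero]; positivity⟩
    · have h3 : 3 < q := by
        rw [hq, lt_inv_comm₀ (by norm_num) (by linarith)]
        linarith
      obtain ⟨K, hK⟩ := exists_mul_rpow_le_rpow (by norm_num) h3 hc₃ (by positivity : 0 < κ' / 4)
      refine ⟨K, fun s hs => ?_⟩
      have := hK s hs
      rwa [show (3 : ℝ) = ((3 : ℕ) : ℝ) by norm_num, Real.rpow_natCast] at this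
  have hmaj : IntegrableOn (fun s => t ^ (-β) * C * Real.exp (K₁ + K₃) *
      (s ^ (0 : ℝ) * Real.exp (-(κ' / 2) * s ^ q))) (Ioi 0) :=
    (integrableOn_rpow_mul_exp_neg_mul_rpow (by norm_num) (by linarith)
      (by positivity)).const_mul _
  refine hmaj.mono' ((Continuous.aestronglyMeasurable (by fun_prop)).mul
    (measurable_wrightG hβ hβ1 β t)) ((ae_restrict_iff' measurableSet_Ioi).2
    (.of_forall fun s (hs : 0 < s) => ?_))
  have ht' : 0 < t ^ (-β) := by positivity
  have hsad : κ * saddlePoint β (s * t ^ (-β)) = κ' * s ^ q := by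
    rw [saddlePoint, hκ', ← hq, mul_assoc, ← Real.mul_rpow (by positivity) hs.le]
    congr 2; ring
  have h1 := hG (s * t ^ (-β)) (by positivity)
  rw [hsad] at h1
  have h2 := hK₁ s hs
  rw [Real.rpow_one] at h2
  have h3 := hK₃ s hs
  rw [norm_mul, Real.norm_eq_abs, Real.norm_eq_abs, Real.abs_exp, wrightG_scale hβ hβ1 β hs ht,
    abs_mul, abs_of_pos ht', Real.rpow_zero, one_mul]
  calc Real.exp (c₁ * s + c₃ * s ^ 3) * (t ^ (-β) * |wrightG β β (s * t ^ (-β)) 1|) ≤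
        Real.exp (κ' / 4 * s ^ q + K₁ + (κ' / 4 * s ^ q + K₃)) *
          (t ^ (-β) * (C * Real.exp (-(κ' * s ^ q)))) := by
        gcongr
    _ = t ^ (-β) * C * (Real.exp (κ' / 4 * s ^ q + K₁ + (κ' / 4 * s ^ q + K₃)) *
          Real.exp (-(κ' * s ^ q))) := by ring
    _ = _ := by rw [← Real.exp_add, mul_assoc _ (Real.exp (K₁ + K₃)), ← Real.exp_add]; ring_nf

/-- The Gaussian supplies −y²/(2s). The growth of h takes y²/(4s), and the terms k|y| and αsy/2 take
y²/(16s) each, so y²/(8s) remains; the costs are at most cubic in s. -/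
theorem exponent_le_of_one_le {α γ q₁ q₀ k b s y z : ℝ} (hs : 1 ≤ s) (hz : |z| ≤ b) :
    -((z - y) ^ 2 / s) - α * s * (z + y) / 2 - γ * s + α ^ 2 * s ^ 3 / 48 +
        (k * |y| + airyRate q₁ q₀ y * |y|) ≤
      -(1 / (8 * s)) * y ^ 2 + (b ^ 2 + b ^ 2 / 2 + (|γ| + 4 * k ^ 2 + 2 * (|q₀| + 1)) * s +
        (2 * α ^ 2 + 8 * q₁ ^ 2) * s ^ 3) := by
  have hs0 : 0 < s := by linarith
  have h1 := airyRate_mul_le q₁ q₀ y hs0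
  rw [sq_abs] at h1
  have hz2 : z ^ 2 ≤ b ^ 2 := by rw [← sq_abs z]; gcongr
  have hs3 : s ≤ s ^ 3 := by nlinarith [mul_self_nonneg (s - 1), mul_nonneg hs0.le hs0.le]
  have h2 : -((z - y) ^ 2 / s) ≤ -(y ^ 2 / (2 * s)) + b ^ 2 := by
    have e : -(y ^ 2 / (2 * s)) + b ^ 2 - -((z - y) ^ 2 / s) =
        (2 * z - y) ^ 2 / (2 * s) + (b ^ 2 - z ^ 2 / s) := by field_simp; ring
    have h3 : z ^ 2 / s ≤ z ^ 2 := div_le_self (sq_nonneg _) hs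
    have h4 : 0 ≤ (2 * z - y) ^ 2 / (2 * s) := by positivity
    linarith
  have h5 : k * |y| ≤ y ^ 2 / (16 * s) + 4 * k ^ 2 * s := by
    have e : y ^ 2 / (16 * s) + 4 * k ^ 2 * s - k * |y| = (|y| - 8 * k * s) ^ 2 / (16 * s) := by
      rw [← sq_abs y]; field_simp; ring
    have : 0 ≤ (|y| - 8 * k * s) ^ 2 / (16 * s) := by positivity
    linarith
  have h6 : -(α * s * y / 2) ≤ y ^ 2 / (16 * s) + α ^ 2 * s ^ 3 := by
    have e : y ^ 2 / (16 * s) + α ^ 2 * s ^ 3 + α * s * y / 2 =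
        (y + 4 * α * s ^ 2) ^ 2 / (16 * s) := by field_simp; ring
    have : 0 ≤ (y + 4 * α * s ^ 2) ^ 2 / (16 * s) := by positivity
    linarith
  have h7 : -(α * s * z / 2) ≤ b ^ 2 / 2 + α ^ 2 * s ^ 3 / 8 := by
    have h8 : α ^ 2 * s ^ 2 ≤ α ^ 2 * s ^ 3 := by
      have : s ^ 2 ≤ s ^ 3 := pow_le_pow_right₀ hs (by norm_num)
      exact mul_le_mul_of_nonneg_left this (sq_nonneg α)
    nlinarith [sq_nonneg (α * s / 2 + z)]
  have h9 : -(γ * s) ≤ |γ| * s := by nlinarith [neg_abs_le γ]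
  have h10 : 0 ≤ α ^ 2 * s ^ 3 := by positivity
  have e : y ^ 2 / (4 * s) + y ^ 2 / (16 * s) + y ^ 2 / (16 * s) - y ^ 2 / (2 * s) =
      -(1 / (8 * s)) * y ^ 2 := by field_simp; ring
  have e2 : α * s * (z + y) / 2 = α * s * z / 2 + α * s * y / 2 := by ring
  rw [e2]
  linarith

/-- Growth of the evolution for initial values of at most Airy type growth. -/
theorem exists_abs_linHeat_le_exp (hψ : GaussTame ψ) (hψc : ContinuousOn ψ (Ioi 0)) (α γ b : ℝ)
    {q₁ q₀ k K a : ℝ} (hK : 0 ≤ K)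
    (hb : ∀ y, y ≠ 0 → |ψ y| ≤ K * Real.exp (k * |y| + airyRate q₁ q₀ y * |y|)) (ha : 0 < a) :
    ∃ D c, 0 ≤ D ∧ 0 ≤ c ∧ ∀ z ∈ Icc a b, ∀ s, 0 < s →
      |linHeat α γ ψ z s| ≤ D * Real.exp (c * s + (2 * α ^ 2 + 8 * q₁ ^ 2) * s ^ 3) := by
  obtain ⟨D, hD, hDb⟩ := exists_abs_linHeat_sub_le hψ hψc α γ b ha one_pos
  set c := |γ| + 4 * k ^ 2 + 2 * (|q₀| + 1) with hc
  have hc0 : 0 ≤ c := by positivity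
  set E := K * √8 * Real.exp (b ^ 2 + b ^ 2 / 2) with hE
  have hE0 : 0 ≤ E := by positivity
  refine ⟨2 * D + E, c, by positivity, hc0, fun z hz s hs => ?_⟩
  set c₃ := 2 * α ^ 2 + 8 * q₁ ^ 2 with hc₃
  have hc₃0 : 0 ≤ c₃ := by positivity
  have hexp : 1 ≤ Real.exp (c * s + c₃ * s ^ 3) := Real.one_le_exp (by positivity)
  -- Small times are covered by the bound near the initial value; for s ≥ 1 the Gaussian integral
  -- √(8πs) cancels the prefactor of the kernel.
  rcases le_total s 1 with h | h
  · obtain ⟨h1, h2⟩ := hDb z hz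
    have h3 : |linHeat α γ ψ z s| ≤ 2 * D := by
      have := abs_add_le (linHeat α γ ψ z s - ψ z) (ψ z)
      rw [sub_add_cancel] at this
      linarith [h2 s hs h]
    nlinarith
  · have hmaj : Integrable fun y : ℝ => (√(Real.pi * s))⁻¹ * K * Real.exp (b ^ 2 + b ^ 2 / 2 +
        c * s + c₃ * s ^ 3) * Real.exp (-(1 / (8 * s)) * y ^ 2) :=
      (integrable_exp_neg_mul_sq (by positivity)).const_mul _
    have hae : ∀ᵐ y : ℝ, y ≠ 0 := by simp [ae_iff]
    have h1 : |linHeat α γ ψ z s| ≤ ∫ y : ℝ, (√(Real.pi * s))⁻¹ * K * Real.exp (b ^ 2 + b ^ 2 / 2 +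
        c * s + c₃ * s ^ 3) * Real.exp (-(1 / (8 * s)) * y ^ 2) := by
      refine norm_integral_le_of_norm_le (f := fun y => linKernel α γ s z y * ψ y) hmaj ?_
      filter_upwards [hae] with y hy
      have hz' : |z| ≤ b := abs_le.2 ⟨by linarith [hz.1, hz.2], hz.2⟩
      have h2 := exponent_le_of_one_le (α := α) (γ := γ) (q₁ := q₁) (q₀ := q₀) (y := y) (k := k) h hz'
      rw [norm_mul, Real.norm_eq_abs, Real.norm_eq_abs, abs_of_pos (linKernel_pos α γ hs z y),
        linKernel]
      calc _ ≤ (√(Real.pi * s))⁻¹ * Real.exp (-((z - y) ^ 2 / s) - α * s * (z + y) / 2 - γ * s +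
              α ^ 2 * s ^ 3 / 48) * (K * Real.exp (k * |y| + airyRate q₁ q₀ y * |y|)) := by
            gcongr; exact hb y hy
        _ = (√(Real.pi * s))⁻¹ * K * Real.exp (-((z - y) ^ 2 / s) - α * s * (z + y) / 2 - γ * s +
              α ^ 2 * s ^ 3 / 48 + (k * |y| + airyRate q₁ q₀ y * |y|)) := by
            rw [Real.exp_add _ (k * |y| + airyRate q₁ q₀ y * |y|)]; ring
        _ ≤ (√(Real.pi * s))⁻¹ * K * Real.exp (-(1 / (8 * s)) * y ^ 2 + (b ^ 2 + b ^ 2 / 2 +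
              c * s + c₃ * s ^ 3)) := by gcongr
        _ = _ := by rw [Real.exp_add]; ring
    refine h1.trans ?_
    rw [integral_const_mul, integral_gaussian]
    have e : √(Real.pi / (1 / (8 * s))) = √8 * √(Real.pi * s) := by
      rw [← Real.sqrt_mul (by norm_num)]; congr 1; field_simp
    have hp : 0 < √(Real.pi * s) := by positivity
    have e2 : Real.exp (b ^ 2 + b ^ 2 / 2 + c * s + c₃ * s ^ 3) =
        Real.exp (b ^ 2 + b ^ 2 / 2) * Real.exp (c * s + c₃ * s ^ 3) := by
      rw [← Real.exp_add]; congr 1; ring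
    rw [e, e2]
    have e3 : (√(Real.pi * s))⁻¹ * K * (Real.exp (b ^ 2 + b ^ 2 / 2) *
        Real.exp (c * s + c₃ * s ^ 3)) * (√8 * √(Real.pi * s)) =
        E * Real.exp (c * s + c₃ * s ^ 3) := by
      rw [hE]; field_simp
    rw [e3]
    gcongr
    linarith

end

end FracPDE

/-! ### Back to the variable x, and the solution of order one -/

namespace FracPDE

open Set Filter Topology MeasureTheory

noncomputable section

/-- The substitution `v(x) = w(√x) / h(√x)` turns `w'' / 4 - (α z + γ) w` into
`x v'' + f(x) v'`. -/
theorem AirySol.transfer {α γ : ℝ} {h h' f w w₁ w₂ : ℝ → ℝ} (hs : AirySol (4 * α) (4 * γ) h h')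
    (hpos : ∀ z, 0 < z → 0 < h z) (hh' : ∀ z, 0 < z → h' z = h z * ((f (z ^ 2) - 1 / 2) / z))
    (hw₁ : ∀ z, 0 < z → HasDerivAt w (w₁ z) z) (hw₂ : ∀ z, 0 < z → HasDerivAt w₁ (w₂ z) z)
    (hc : ContinuousOn w₂ (Ioi 0)) :
    ContDiffOn ℝ 2 (fun x => w √x / h √x) (Ioi 0) ∧
    ∀ x, 0 < x → x * deriv (deriv fun x => w √x / h √x) x + f x * deriv (fun x => w √x / h √x) x =
      (w₂ √x / 4 - (α * √x + γ) * w √x) / h √x := by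
  set q₁ : ℝ → ℝ := fun z => (w₁ z * h z - w z * h' z) / h z ^ 2 with hq₁
  set q₂ : ℝ → ℝ := fun z => ((w₂ z * h z - w z * ((4 * α * z + 4 * γ) * h z)) * h z ^ 2 -
    (w₁ z * h z - w z * h' z) * (2 * h z * h' z)) / (h z ^ 2) ^ 2 with hq₂
  have dq : ∀ z, 0 < z → HasDerivAt (fun z => w z / h z) (q₁ z) z := fun z hz =>
    (hw₁ z hz).div (hs z).1 (hpos z hz).ne'
  have dq₁ : ∀ z, 0 < z → HasDerivAt q₁ (q₂ z) z := fun z hz => by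
    refine ((((hw₂ z hz).mul (hs z).1).sub ((hw₁ z hz).mul (hs z).2)).div ((hs z).1.pow 2)
      (pow_ne_zero 2 (hpos z hz).ne')).congr_deriv ?_
    simp only [hq₂, Pi.mul_apply, Pi.sub_apply, Pi.pow_apply]
    push_cast
    ring
  have ds : ∀ x, 0 < x → HasDerivAt (fun x => √x) (1 / (2 * √x)) x := fun x hx =>
    Real.hasDerivAt_sqrt hx.ne'
  set v₁ : ℝ → ℝ := fun x => q₁ √x * (1 / (2 * √x)) with hv₁
  set v₂ : ℝ → ℝ := fun x => q₂ √x * (1 / (2 * √x)) * (1 / (2 * √x)) +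
    q₁ √x * (-(2 * (1 / (2 * √x))) / (2 * √x) ^ 2) with hv₂
  have dv : ∀ x ∈ Ioi (0 : ℝ), HasDerivAt (fun x => w √x / h √x) (v₁ x) x := fun x hx =>
    (dq √x (Real.sqrt_pos.2 hx)).comp x (ds x hx)
  have dv₁ : ∀ x ∈ Ioi (0 : ℝ), HasDerivAt v₁ (v₂ x) x := fun x hx => by
    have hz : 0 < √x := Real.sqrt_pos.2 hx
    have d1 := (dq₁ √x hz).comp x (ds x hx)
    have d2 := ((ds x hx).const_mul 2).inv (by positivity : 2 * √x ≠ 0)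
    refine ((d1.mul d2).congr_deriv ?_).congr_of_eventuallyEq (.of_forall fun y => ?_)
    · simp only [hv₂, Function.comp_apply, Pi.inv_apply, one_div]
    · simp only [hv₁, Pi.mul_apply, Function.comp_apply, one_div, Pi.inv_apply]
  have ch : Continuous h := hs.continuous.1
  have ch' : Continuous h' := hs.continuous.2
  have cw : ContinuousOn w (Ioi 0) := fun z hz => (hw₁ z hz).continuousAt.continuousWithinAt
  have cw₁ : ContinuousOn w₁ (Ioi 0) := fun z hz => (hw₂ z hz).continuousAt.continuousWithinAt
  have cq₁ : ContinuousOn q₁ (Ioi 0) := fun z hz => (dq₁ z hz).continuousAt.continuousWithinAt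
  have cq₂ : ContinuousOn q₂ (Ioi 0) := by
    refine ContinuousOn.div ?_ (by fun_prop) fun z hz => ?_
    · have c1 := ch.continuousOn (s := Ioi 0)
      have c2 := ch'.continuousOn (s := Ioi 0)
      fun_prop
    · have := hpos z hz
      positivity
  have csq : ContinuousOn (fun x : ℝ => √x) (Ioi 0) := Real.continuous_sqrt.continuousOn
  have hmaps : MapsTo (fun x : ℝ => √x) (Ioi 0) (Ioi 0) := fun x hx => Real.sqrt_pos.2 hx
  have cv₂ : ContinuousOn v₂ (Ioi 0) := by
    have c1 := cq₂.comp csq hmaps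
    have c2 := cq₁.comp csq hmaps
    have c3 : ContinuousOn (fun x : ℝ => 1 / (2 * √x)) (Ioi 0) :=
      continuousOn_const.div (by fun_prop) fun x hx => by
        have := hmaps hx
        simp only [mem_Ioi] at this
        positivity
    have c4 : ContinuousOn (fun x : ℝ => -(2 * (1 / (2 * √x))) / (2 * √x) ^ 2) (Ioi 0) :=
      ((continuousOn_const.mul c3).neg).div (by fun_prop) fun x hx => by
        have := hmaps hx
        simp only [mem_Ioi] at this
        positivity
    exact ((c1.mul c3).mul c3).add (c2.mul c4)
  refine ⟨contDiffOn_two_of_hasDerivAt isOpen_Ioi dv dv₁ cv₂, fun x hx => ?_⟩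
  have e1 : deriv (deriv fun x => w √x / h √x) x = v₂ x := by
    refine ((dv₁ x hx).congr_of_eventuallyEq ?_).deriv
    filter_upwards [Ioi_mem_nhds hx] with y hy using (dv y hy).deriv
  rw [e1, (dv x hx).deriv]
  have hz : 0 < √x := Real.sqrt_pos.2 hx
  have hx2 : x = √x ^ 2 := (Real.sq_sqrt hx.le).symm
  have hp := hpos _ hz
  simp only [hv₁, hv₂, hq₁, hq₂]
  rw [hh' _ hz]
  generalize √x = z at *
  subst hx2
  field_simp
  ring

variable {A C β : ℝ} {f F h h' φ : ℝ → ℝ}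

theorem Gauge.exists_lipschitz (hg : Gauge A C F h h') (hφ : ContDiffOn ℝ 2 φ (Ioi 0)) {z : ℝ}
    (hz : 0 < z) : ∃ δ L, 0 < δ ∧ 0 ≤ L ∧
      ∀ y, |y - z| ≤ δ → |h y * φ (y ^ 2) - h z * φ (z ^ 2)| ≤ L * |y - z| := by
  have hsub : Icc (z - z / 2) (z + z / 2) ⊆ Ioi 0 := fun y hy => by
    have := hy.1; simp only [mem_Ioi]; linarith
  have hd : ∀ y ∈ Ioi (0 : ℝ), HasDerivAt φ (deriv φ y) y := fun y hy =>
    ((hφ.differentiableOn (by norm_num)).differentiableAt (Ioi_mem_nhds hy)).hasDerivAt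
  have hc : ContinuousOn (deriv φ) (Ioi 0) :=
    hφ.continuousOn_deriv_of_isOpen isOpen_Ioi (by norm_num)
  have hsq : MapsTo (fun y : ℝ => y ^ 2) (Ioi 0) (Ioi 0) := fun y (hy : 0 < y) => by
    simp only [mem_Ioi]; positivity
  obtain ⟨L, hL, hLb⟩ := exists_lipschitz_near (h := fun y => h y * φ (y ^ 2))
    (h' := fun y => h' y * φ (y ^ 2) + h y * (deriv φ (y ^ 2) * (2 * y))) (z := z) (δ := z / 2)
    (fun y hy => by
      have d0 : HasDerivAt (fun y : ℝ => y ^ 2) (2 * y) y := by simpa using hasDerivAt_pow 2 y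
      have d1 : HasDerivAt (fun y => φ (y ^ 2)) (deriv φ (y ^ 2) * (2 * y)) y :=
        HasDerivAt.comp (h₂ := φ) (h := fun y => y ^ 2) y (hd _ (hsq (hsub hy))) d0
      exact (hg.sol y).1.mul d1)
    (by
      have c1 := hc.comp (by fun_prop : ContinuousOn (fun y : ℝ => y ^ 2) (Ioi 0)) hsq
      have c2 := hφ.continuousOn.comp (by fun_prop : ContinuousOn (fun y : ℝ => y ^ 2) (Ioi 0)) hsq
      exact ((hg.sol.continuous.2.continuousOn.mul c2).add
        (hg.sol.continuous.1.continuousOn.mul (c1.mul (by fun_prop)))).mono hsub)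
  exact ⟨z / 2, L, half_pos hz, hL, hLb⟩

theorem Gauge.tame (hg : Gauge A C F h h')
    (hφ : ∀ ε : ℝ, 0 < ε → IntegrableOn
      (fun y => Real.exp (-(ε * y)) * (√y)⁻¹ * φ y) (Ioi 0)) :
    GaussTame fun z => h z * φ (z ^ 2) := hg.sol.gaussTame_mul hφ

theorem Gauge.isSolution_one (hg : Gauge A C F h h')
    (hh' : ∀ z, 0 < z → h' z = h z * ((f (z ^ 2) - 1 / 2) / z)) (hφ : ContDiffOn ℝ 2 φ (Ioi 0))
    (hψ : GaussTame fun z => h z * φ (z ^ 2)) :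
    IsSolution 1 f φ (kernelSolution (spaceKernel A C h) φ) := by
  have hu : ∀ x t, 0 < t → kernelSolution (spaceKernel A C h) φ x t =
      linHeat (A / 3) (C / 2) (fun z => h z * φ (z ^ 2)) √x t / h √x := fun x t ht =>
    kernelSolution_spaceKernel A C hψ x ht
  have hsp := fun t (ht : 0 < t) => hg.sol.transfer (f := f)
    (w := fun z => linHeat (A / 3) (C / 2) (fun z => h z * φ (z ^ 2)) z t)
    (w₁ := fun z => linHeatX (A / 3) (C / 2) (fun z => h z * φ (z ^ 2)) z t)
    (w₂ := fun z => linHeatXX (A / 3) (C / 2) (fun z => h z * φ (z ^ 2)) z t)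
    (fun z hz => hg.pos hz) hh'
    (fun z _ => hasDerivAt_linHeat_space hψ _ _ z ht)
    (fun z _ => hasDerivAt_linHeatX_space hψ _ _ z ht)
    (ContinuousOn.comp (g := fun x : ℝ × ℝ =>
        linHeatXX (A / 3) (C / 2) (fun z => h z * φ (z ^ 2)) x.1 x.2) (f := fun z => (z, t))
      (continuousOn_linHeatXX hψ _ _) (by fun_prop) fun _ _ => ht)
  have hd : ∀ x t, 0 < t → HasDerivAt (fun t => kernelSolution (spaceKernel A C h) φ x t)
      ((linHeatXX (A / 3) (C / 2) (fun z => h z * φ (z ^ 2)) √x t / 4 - (A / 3 * √x + C / 2) *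
        linHeat (A / 3) (C / 2) (fun z => h z * φ (z ^ 2)) √x t) / h √x) t := fun x t ht => by
    refine ((hasDerivAt_linHeat_time hψ (A / 3) (C / 2) √x ht).div_const
      (h √x)).congr_of_eventuallyEq ?_
    filter_upwards [Ioi_mem_nhds ht] with r hr using hu x r hr
  have hfun : ∀ t, 0 < t → (fun x => kernelSolution (spaceKernel A C h) φ x t) =
      fun x => linHeat (A / 3) (C / 2) (fun z => h z * φ (z ^ 2)) √x t / h √x :=
    fun t ht => funext fun x => hu x t ht
  refine ⟨fun t ht => ?_, fun x hx => ?_, fun h1 => absurd h1 (lt_irrefl 1), fun x t hx ht => ?_,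
    fun x hx => ?_⟩
  · rw [hfun t ht]; exact (hsp t ht).1
  · refine contDiffOn_one_of_hasDerivAt isOpen_Ioi (fun t ht => hd x t ht) ?_
    exact (((continuousOn_slice (U := Ioi 0) (continuousOn_linHeatXX hψ _ _) √x).div_const 4).sub
      (continuousOn_const.mul
        (continuousOn_slice (U := Ioi 0) (continuousOn_linHeat hψ _ _) √x))).div_const _
  · rw [caputo, if_pos rfl, (hd x t ht).deriv, hfun t ht, (hsp t ht).2 x hx]
  · have hz : 0 < √x := Real.sqrt_pos.2 hx
    obtain ⟨δ, L, hδ, hL, hb⟩ := hg.exists_lipschitz hφ hz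
    obtain ⟨B, hB, hBb⟩ := abs_linHeat_sub_le hψ (A / 3) (C / 2) √x one_pos hδ hL hb
    have h1 : Tendsto (fun t => linHeat (A / 3) (C / 2) (fun z => h z * φ (z ^ 2)) √x t)
        (𝓝[>] 0) (𝓝 (h √x * φ (√x ^ 2))) := by
      rw [tendsto_iff_norm_sub_tendsto_zero]
      have c : Continuous fun t : ℝ => B * √t := by fun_prop
      have h2 : Tendsto (fun t : ℝ => B * √t) (𝓝[>] 0) (𝓝 0) := by
        have := (c.tendsto 0).mono_left (nhdsWithin_le_nhds (s := Ioi 0))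
        rwa [Real.sqrt_zero, mul_zero] at this
      refine squeeze_zero' (.of_forall fun _ => norm_nonneg _) ?_ h2
      filter_upwards [Ioc_mem_nhdsGT one_pos] with t ht using hBb t ht.1 ht.2
    have h3 := h1.div_const (h √x)
    rw [Real.sq_sqrt hx.le, mul_div_cancel_left₀ _ (hg.pos hz).ne'] at h3
    refine h3.congr' ?_
    filter_upwards [self_mem_nhdsWithin] with t ht using (hu x t ht).symm

/-- Convergence for x in [a², b²] becomes convergence for z = √x in [a, b], since h is bounded on
[a, b]. -/
theorem Gauge.wrightHeat (hg : Gauge A C F h h') (hβ : 0 < β) (hβ1 : β < 1)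
    (hφ : ContDiffOn ℝ 2 φ (Ioi 0)) (hψ : GaussTame fun z => h z * φ (z ^ 2))
    (hconv : WrightConvergent β (kernelSolution (spaceKernel A C h) φ)) :
    WrightHeat β (A / 3) (C / 2) fun z => h z * φ (z ^ 2) where
  tame := hψ
  lipschitz _ hz := hg.exists_lipschitz hφ hz
  convergent a b t ha hab ht := by
    obtain ⟨M, hM, hMb⟩ := hconv (a ^ 2) (b ^ 2) t (by positivity) (by gcongr) ht
    obtain ⟨H, hH⟩ := isCompact_Icc.exists_bound_of_continuousOn
      (hg.sol.continuous.1.continuousOn (s := Icc a b))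
    have hH0 : 0 ≤ H := (norm_nonneg _).trans (hH a ⟨le_rfl, hab⟩)
    refine ⟨fun s => H * M s, ?_, fun z hz s hs => ?_⟩
    · refine IntegrableOn.congr_fun (hM.const_mul H) (fun s hs => ?_) measurableSet_Ioi
      simp only []
      rw [wrightDensity_eq_wrightG hβ hβ1 hs ht, mul_assoc]
    · have hz0 : 0 < z := ha.trans_le hz.1
      have h1 := hMb (z ^ 2) ⟨by gcongr; exact hz.1, by gcongr; exact hz.2⟩ s hs
      rw [kernelSolution_spaceKernel A C hψ _ hs, Real.sqrt_sq hz0.le, abs_div,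
        div_le_iff₀ (abs_pos.2 (hg.pos hz0).ne'), mul_comm] at h1
      refine h1.trans (mul_le_mul_of_nonneg_right (hH z hz) ?_)
      exact (abs_nonneg _).trans (hMb (z ^ 2) ⟨by gcongr; exact hz.1, by gcongr; exact hz.2⟩ s hs)

end

end FracPDE

/-! ### The solution of order less than one, and convergence of its transform -/

namespace FracPDE

open Set Filter Topology MeasureTheory

noncomputable section

variable {A C β : ℝ} {d f F h h' φ : ℝ → ℝ}

theorem WrightTame.div_const (hd : WrightTame β d) (c : ℝ) : WrightTame β fun s => d s / c where
  cont := hd.cont.div_const c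
  small S hS := by
    obtain ⟨B, hB, hb⟩ := hd.small S hS
    refine ⟨B / |c|, by positivity, fun s hs hsS => ?_⟩
    rw [abs_div, div_mul_eq_mul_div]
    gcongr
    exact hb s hs hsS
  integrableOn t ht := by
    refine IntegrableOn.congr_fun ((hd.integrableOn t ht).div_const c) (fun s _ => ?_)
      measurableSet_Ioi
    ring

theorem wrightInt_div_const (β a : ℝ) (d : ℝ → ℝ) (c t : ℝ) :
    wrightInt β a (fun s => d s / c) t = wrightInt β a d t / c := by
  rw [wrightInt, wrightInt, ← integral_div]
  congr 1
  ext s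
  ring

theorem wrightTransform_kernelSolution (hβ : 0 < β) (hβ1 : β < 1)
    (hψ : GaussTame fun z => h z * φ (z ^ 2)) (x : ℝ) {t : ℝ} (ht : 0 < t) :
    wrightTransform β (kernelSolution (spaceKernel A C h) φ) x t =
      (∫ s in Ioi (0 : ℝ), linHeat (A / 3) (C / 2) (fun z => h z * φ (z ^ 2)) √x s *
        wrightG β β s t) / h √x := by
  rw [wrightTransform, ← integral_div]
  refine setIntegral_congr_fun measurableSet_Ioi fun s hs => ?_
  rw [kernelSolution_spaceKernel A C hψ x hs, wrightDensity_eq_wrightG hβ hβ1 hs ht]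
  ring

theorem WrightHeat.continuousOn_deriv_deriv {α γ : ℝ} {ψ : ℝ → ℝ} (hw : WrightHeat β α γ ψ)
    (hβ : 0 < β) (hβ1 : β < 1) {t : ℝ} (ht : 0 < t) :
    ContinuousOn (fun z => 4 * ((α * z + γ) *
      (∫ s in Ioi (0 : ℝ), linHeat α γ ψ z s * wrightG β β s t) +
        wrightInt β (2 * β) (fun s => linHeat α γ ψ z s - ψ z) t)) (Ioi 0) := by
  intro z (hz : 0 < z)
  have h1 := hw.continuousOn_wrightInt hβ hβ1 (half_pos hz) (by linarith : z / 2 ≤ 2 * z) ht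
  have h2 := hw.continuousOn_integral hβ hβ1 (half_pos hz) (by linarith : z / 2 ≤ 2 * z) ht
  have hn : Icc (z / 2) (2 * z) ∈ 𝓝 z := Icc_mem_nhds (by linarith) (by linarith)
  have h3 : ContinuousAt (fun z => α * z + γ) z := by fun_prop
  exact (continuousAt_const.mul ((h3.mul (h2.continuousAt hn)).add
    (h1.continuousAt hn))).continuousWithinAt

/-- Both sides of the equation are the transform of index 2β of w − ψ, divided by h: on the left
through the Caputo derivative, on the right because in the second space derivative the potential
term cancels under the change of variables. -/
theorem Gauge.isSolution_wrightTransform (hg : Gauge A C F h h')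
    (hh' : ∀ z, 0 < z → h' z = h z * ((f (z ^ 2) - 1 / 2) / z)) (hφ : ContDiffOn ℝ 2 φ (Ioi 0))
    (hψ : GaussTame fun z => h z * φ (z ^ 2)) (hβ : 0 < β) (hβ1 : β < 1)
    (hconv : WrightConvergent β (kernelSolution (spaceKernel A C h) φ)) :
    IsSolution β f φ (wrightTransform β (kernelSolution (spaceKernel A C h) φ)) := by
  have hw := hg.wrightHeat hβ hβ1 hφ hψ hconv
  have hfun : ∀ t, 0 < t → (fun x => wrightTransform β (kernelSolution (spaceKernel A C h) φ) x t) =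
      fun x => (∫ s in Ioi (0 : ℝ), linHeat (A / 3) (C / 2) (fun z => h z * φ (z ^ 2)) √x s *
        wrightG β β s t) / h √x :=
    fun t ht => funext fun x => wrightTransform_kernelSolution hβ hβ1 hψ x ht
  have hsp := fun t (ht : 0 < t) => hg.sol.transfer (f := f)
    (w := fun z => ∫ s in Ioi (0 : ℝ),
      linHeat (A / 3) (C / 2) (fun z => h z * φ (z ^ 2)) z s * wrightG β β s t)
    (fun z hz => hg.pos hz) hh'
    (fun z hz => (hw.hasDerivAt_space hβ hβ1 hz ht).1.hasDerivAt)
    (fun z hz => (hw.hasDerivAt_space hβ hβ1 hz ht).2)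
    (hw.continuousOn_deriv_deriv hβ hβ1 ht)
  have htame : ∀ x, 0 < x → WrightTame β fun s =>
      (linHeat (A / 3) (C / 2) (fun z => h z * φ (z ^ 2)) √x s - h √x * φ (√x ^ 2)) / h √x :=
    fun x hx => (hw.wrightTame hβ hβ1 (Real.sqrt_pos.2 hx)).div_const _
  have hv : ∀ x, 0 < x → ∀ t, 0 < t →
      wrightTransform β (kernelSolution (spaceKernel A C h) φ) x t =
        φ x + wrightInt β β (fun s =>
          (linHeat (A / 3) (C / 2) (fun z => h z * φ (z ^ 2)) √x s - h √x * φ (√x ^ 2)) /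
            h √x) t := fun x hx t ht => by
    rw [wrightTransform_kernelSolution hβ hβ1 hψ x ht,
      hw.integral_eq hβ hβ1 (Real.sqrt_pos.2 hx) ht, wrightInt_div_const, add_div,
      Real.sq_sqrt hx.le, mul_div_cancel_left₀ _ (hg.pos (Real.sqrt_pos.2 hx)).ne']
  refine ⟨fun t ht => ?_, fun x hx => ?_, fun _ x t hx ht => ?_, fun x t hx ht => ?_,
    fun x hx => ?_⟩
  · rw [hfun t ht]; exact (hsp t ht).1
  · exact (contDiffOn_const.add ((htame x hx).contDiffOn hβ hβ1)).congr fun t ht => hv x hx t ht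
  · exact ((htame x hx).caputo_eq hβ hβ1 (hv x hx) ht).1
  · rw [((htame x hx).caputo_eq hβ hβ1 (hv x hx) ht).2, hfun t ht, (hsp t ht).2 x hx,
      wrightInt_div_const]
    ring
  · have h1 := ((htame x hx).tendsto_wrightInt hβ hβ1).const_add (φ x)
    rw [add_zero] at h1
    refine h1.congr' ?_
    filter_upwards [self_mem_nhdsWithin] with t ht using (hv x hx t ht).symm

/-- The initial value h(z)φ(z²) grows at most like exp(k|z|) times the Airy growth of h, so the
evolution grows at most like exp(cs + c₃s³), where c₃ is a multiple of A². It vanishes for A = 0,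
and otherwise β > 2/3 lets the density win. -/
theorem Gauge.wrightConvergent (hg : Gauge A C F h h') (hφ : ContinuousOn φ (Ioi 0))
    (hψ : GaussTame fun z => h z * φ (z ^ 2)) (hβ : 0 < β) (hβ1 : β < 1)
    (hA : A = 0 ∨ 2 / 3 < β) {M k : ℝ} (hM : ∀ y, 0 < y → |φ y| ≤ M * Real.exp (k * √y)) :
    WrightConvergent β (kernelSolution (spaceKernel A C h) φ) := by
  intro a b t ha hab ht
  have hM0 : 0 ≤ M := nonneg_of_mul_nonneg_left ((abs_nonneg _).trans (hM 1 one_pos))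
    (Real.exp_pos _)
  have hψc : ContinuousOn (fun z => h z * φ (z ^ 2)) (Ioi 0) :=
    hg.sol.continuous.1.continuousOn.mul
      (hφ.comp (by fun_prop : ContinuousOn (fun y : ℝ => y ^ 2) (Ioi 0)) fun y (hy : 0 < y) => by
        simp only [mem_Ioi]; positivity)
  have hb : ∀ y, y ≠ 0 → |h y * φ (y ^ 2)| ≤ (|h 0| + |h' 0|) * M *
      Real.exp (k * |y| + airyRate (4 * (A / 3)) (4 * (C / 2)) y * |y|) := fun y hy => by
    have h1 := hM (y ^ 2) (by positivity)
    rw [Real.sqrt_sq_eq_abs] at h1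
    rw [abs_mul, Real.exp_add]
    calc |h y| * |φ (y ^ 2)| ≤ ((|h 0| + |h' 0|) *
          Real.exp (airyRate (4 * (A / 3)) (4 * (C / 2)) y * |y|)) * (M * Real.exp (k * |y|)) := by
          gcongr
          exact (hg.sol.abs_le y).1
      _ = _ := by ring
  obtain ⟨D, c, hD, hc, hDb⟩ := exists_abs_linHeat_le_exp hψ hψc (A / 3) (C / 2) √b
    (by positivity) hb (Real.sqrt_pos.2 ha)
  obtain ⟨H, hH⟩ := isCompact_Icc.exists_bound_of_continuousOn (s := Icc √a √b)
    (f := fun z => (h z)⁻¹) (hg.sol.continuous.1.continuousOn.inv₀ fun z hz =>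
      (hg.pos ((Real.sqrt_pos.2 ha).trans_le hz.1)).ne')
  have hH0 : 0 ≤ H := (norm_nonneg _).trans (hH √a ⟨le_rfl, Real.sqrt_le_sqrt hab⟩)
  refine ⟨fun s => D * Real.exp (c * s + (2 * (A / 3) ^ 2 + 8 * (4 * (A / 3)) ^ 2) * s ^ 3) * H,
    ?_, fun x hx s hs => ?_⟩
  · refine IntegrableOn.congr_fun ((integrableOn_exp_mul_wrightG hβ hβ1 ht hc
      (by positivity : 0 ≤ 2 * (A / 3) ^ 2 + 8 * (4 * (A / 3)) ^ 2)
      (hA.imp_left fun h0 => by simp [h0])).const_mul (D * H)) (fun s hs => ?_)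
      measurableSet_Ioi
    beta_reduce
    rw [wrightDensity_eq_wrightG hβ hβ1 hs ht]
    ring
  · have hz : √x ∈ Icc √a √b := ⟨Real.sqrt_le_sqrt hx.1, Real.sqrt_le_sqrt hx.2⟩
    rw [kernelSolution_spaceKernel A C hψ x hs, div_eq_mul_inv, abs_mul]
    exact mul_le_mul (hDb _ hz s hs) (hH _ hz) (abs_nonneg _) (by positivity)

end

end FracPDE

theorem corollary4p3 (A C : ℝ) (f F : ℝ → ℝ)
    (hf : ∀ x : ℝ, 0 < x → DifferentiableAt ℝ f x)
    (hRiccati : ∀ x : ℝ, 0 < x →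
      x * deriv f x - f x + f x ^ 2 / 2 = 2 / 3 * A * x ^ (3 / 2 : ℝ) + C * x - 3 / 8)
    (hF : ∀ x : ℝ, 0 < x → HasDerivAt F (f x / x) x) :
    ∃ p : ℝ → ℝ → ℝ → ℝ,
      -- `p(x, ·, t)` is the inverse Laplace transform of `U_λ(x, t)` in `λ`
      (∀ x t : ℝ, 0 < x → 0 < t →
        FracPDE.IsInverseLaplaceOn (FracPDE.admissible A x t)
          (fun l => FracPDE.laplaceU A C F l x t) (fun y => p x y t)) ∧
      (∀ x t l : ℝ, 0 < x → 0 < t → 0 ≤ l →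
        MeasureTheory.IntegrableOn (fun y => Real.exp (-(l * y)) * p x y t) (Set.Ioi 0)) ∧
      (∀ x t l : ℝ, 0 < x → 0 < t → l ∈ FracPDE.admissible A x t →
        ∫ y in Set.Ioi (0 : ℝ), Real.exp (-(l * y)) * p x y t = FracPDE.laplaceU A C F l x t) ∧
      ∀ φ : ℝ → ℝ, ContDiffOn ℝ 2 φ (Set.Ioi 0) →
        (∀ ε : ℝ, 0 < ε → MeasureTheory.IntegrableOn
          (fun y => Real.exp (-(ε * y)) * (√y)⁻¹ * φ y) (Set.Ioi 0)) →
        (∀ x t : ℝ, 0 < x → 0 < t →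
          MeasureTheory.IntegrableOn (fun y => p x y t * φ y) (Set.Ioi 0)) ∧
        -- order one, where the Wright-type transform is the identity
        FracPDE.IsSolution 1 f φ (FracPDE.kernelSolution p φ) ∧
        -- order less than one
        (∀ β : ℝ, 0 < β → β < 1 →
          FracPDE.WrightConvergent β (FracPDE.kernelSolution p φ) →
          FracPDE.IsSolution β f φ
            (FracPDE.wrightTransform β (FracPDE.kernelSolution p φ))) ∧
        -- convergence of the transform
        (∀ β : ℝ, 0 < β → β < 1 → (A = 0 ∨ 2 / 3 < β) →
          (∃ M k : ℝ, ∀ y : ℝ, 0 < y → |φ y| ≤ M * Real.exp (k * √y)) →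
          FracPDE.WrightConvergent β (FracPDE.kernelSolution p φ)) := by
  obtain ⟨h, h', hg, hh'⟩ := FracPDE.exists_gauge hf hRiccati hF
  refine ⟨FracPDE.spaceKernel A C h, fun x t hx ht => hg.isInverseLaplaceOn hx ht,
    fun x t l _ ht hl => hg.integrableOn_exp_mul_spaceKernel x ht hl,
    fun x t l hx ht hl => hg.integral_exp_mul_spaceKernel hx ht hl, fun φ hφ hφi => ?_⟩
  have hψ := hg.tame hφi
  exact ⟨fun x t _ ht => FracPDE.integrableOn_spaceKernel_mul A C hψ x ht,
    hg.isSolution_one hh' hφ hψ,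
    fun β hβ hβ1 hconv => hg.isSolution_wrightTransform hh' hφ hψ hβ hβ1 hconv,
    fun β hβ hβ1 hA ⟨M, k, hM⟩ => hg.wrightConvergent hφ.continuousOn hψ hβ hβ1 hA hM⟩
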